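/- **Setting.** Let $0<q<1$, $\tau=-2\pi i/\log q$, $\Lambda_\tau=\mathbb{Z}+\mathbb{Z}\tau$, $(z;q)_\infty=\prod_{k\ge 0}(1-q^kz)$, $\theta_q(z)=(z;q)_\infty(q/z;q)_\infty$, $\vartheta_\tau(x)=\theta_q(q^x)$, and write $\theta_q(z_1,\dots,z_n)=\prod_i\theta_q(z_i)$, and similarly for $\vartheta_\tau$. Let $\Theta=(\theta_0,\theta_t,\theta_1,\theta_\infty)\in\mathbb{C}^4$ and $t_0\in\mathbb{C}^*$ satisfy $$2\theta_0,\ 2\theta_t,\ 2\theta_1,\ 2\theta_\infty\notin\Lambda_\tau,\qquad \pm\theta_0\pm\theta_t\pm\theta_1\pm\theta_\infty\notin\Lambda_\tau\ \text{(all signs)},$$ $$t_0\notin q^{\mathbb{Z}\pm(\theta_t+\theta_1)},\ q^{\mathbb{Z}\pm(\theta_t-\theta_1)},\ q^{\mathbb{Z}\pm(\theta_0+\theta_\infty)},\ q^{\mathbb{Z}\pm(\theta_0-\theta_\infty)}.$$ Put $(x_1,x_2,x_3,x_4)=(q^{\theta_t}t_0,q^{-\theta_t}t_0,q^{\theta_1},q^{-\theta_1})$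 and \begin{align*} T_{12}&=\theta_q(q^{\theta_0+\theta_\infty}t_0,q^{-\theta_0+\theta_\infty}t_0)\,\vartheta_\tau(2\theta_t,2\theta_1),\\ T_{34}&=\theta_q(q^{\theta_0-\theta_\infty}t_0,q^{-\theta_0-\theta_\infty}t_0)\,\vartheta_\tau(2\theta_t,2\theta_1)\,q^{2\theta_\infty},\\ T_{13}&=-\theta_q(q^{\theta_t-\theta_1}t_0,q^{-\theta_t+\theta_1}t_0)\,\vartheta_\tau(\theta_0+\theta_t+\theta_1+\theta_\infty,-\theta_0+\theta_t+\theta_1+\theta_\infty),\\ T_{24}&=-\theta_q(q^{\theta_t-\theta_1}t_0,q^{-\theta_t+\theta_1}t_0)\,\vartheta_\tau(\theta_0-\theta_t-\theta_1+\theta_\infty,-\theta_0-\theta_t-\theta_1+\theta_\infty)\,q^{2\theta_t+2\theta_1},\\ T_{23}&=\theta_q(q^{\theta_t+\theta_1}t_0,q^{-\theta_t-\theta_1}t_0)\,\vartheta_\tau(\theta_0-\theta_t+\theta_1+\theta_\infty,-\theta_0-\theta_t+\theta_1+\theta_\infty)\,q^{2\theta_t},\\ T_{14}&=\theta_q(q^{\theta_t+\theta_1}t_0,q^{-\theta_t-\theta_1}t_0)\,\vartheta_\tau(\theta_0+\theta_t-\theta_1+\theta_\infty,-\theta_0+\theta_t-\theta_1+\theta_\infty)\,q^{2\theta_1},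 \end{align*} let $T'_{ij}$ be $T_{ij}$ with $\theta_0$ replaced by $0$, and let $T'(\rho)=\sum_{i<j}T'_{ij}\rho_i\rho_j$. Put $c=\vartheta_\tau(\tfrac12,-\tfrac12)/\vartheta_\tau(\theta_0,-\theta_0)$, $a_\infty=-c$, $b_1=\frac{T_{13}T_{24}}{T_{12}T_{34}}$, $b_2=\frac{T_{14}T_{23}}{T_{12}T_{34}}$, and $$a_{12}=\prod_{\epsilon=\pm1}\frac{\theta_q(q^{\theta_\infty}t_0)}{\theta_q(q^{\epsilon\theta_0+\theta_\infty}t_0)},\quad a_{34}=\prod_{\epsilon=\pm1}\frac{\theta_q(q^{-\theta_\infty}t_0)}{\theta_q(q^{\epsilon\theta_0-\theta_\infty}t_0)},\quad a_{ij}=\prod_{\epsilon=\pm1}\frac{\vartheta_\tau(s_{ij})}{\vartheta_\tau(\epsilon\theta_0+s_{ij})}\ \text{ for } ij=13,14,23,24,$$ where $s_{13}=\theta_t+\theta_1+\theta_\infty$, $s_{14}=\theta_t-\theta_1+\theta_\infty$, $s_{23}=-\theta_t+\theta_1+\theta_\infty$, $s_{24}=-\theta_t-\theta_1+\theta_\infty$.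 The Segre surface $\widehat{\mathcal F}=\widehat{\mathcal F}(\Theta,t_0)\subset\mathbb{CP}^6$ is given, in homogeneous coordinates $(N_{12}:N_{13}:N_{14}:N_{23}:N_{24}:N_{34}:N_\infty)$, by $$\sum_{i<j}N_{ij}=0,\quad \sum_{i<j}a_{ij}N_{ij}+a_\infty N_\infty=0,\quad N_{13}N_{24}=b_1N_{12}N_{34},\quad N_{14}N_{23}=b_2N_{12}N_{34}.$$ Its affine part is $\mathcal F=\{N_\infty\ne0\}$, with coordinates $\eta_{ij}=N_{ij}/N_\infty$, and its hyperplane section at infinity is $\widehat{\mathcal F}\setminus\mathcal F$. A connection matrix is a $2\times2$ matrix function $C(z)$, analytic on $\mathbb{C}^*$, with $C(qz)=\frac{t_0}{z^2}q^{\theta_0\sigma_3}C(z)q^{\theta_\infty\sigma_3}$, where $\sigma_3=\operatorname{diag}(1,-1)$, and $\det C(z)=c'\,\theta_q(z/x_1,z/x_2,z/x_3,z/x_4)$ for some $c'\in\mathbb{C}^*$. For a rank one matrix $R=(R_1,R_2)$, with columns $R_1,R_2$, let $\pi(R)\in\mathbb{CP}^1$ be defined by $R_1=\pi(R)R_2$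 (with $\pi(R)=\infty$ if and only if $R_2=0$), and put $\rho_k=\pi(C(x_k))$ and $\widetilde\rho_k=\pi(C(x_k)^T)$, $1\le k\le4$. A connection matrix determines the point $\eta\in\mathcal F$ with $\eta_{ij}=c\,T_{ij}\rho_i\rho_j/T'(\rho)$ (to be read in homogeneous coordinates of the $\rho_k$). For $1\le k\le 4$ and $\diamond\in\{0,\infty\}$, let $\mathcal L_k^\diamond$ (respectively $\widetilde{\mathcal L}_k^\diamond$) be the closure in $\mathbb{CP}^6$ of the set of the points $\eta\in\mathcal F$ of all connection matrices with $\rho_k=\diamond$ (respectively $\widetilde\rho_k=\diamond$). **Theorem.** The sixteen sets $\mathcal L_k^\diamond,\widetilde{\mathcal L}_k^\diamond$ are pairwise different and are exactly the lines of $\mathbb{CP}^6$ contained in $\widehat{\mathcal F}$, and: 1. None of the sixteen lines lies entirely in the hyperplane section at infinity. 2. Two different lines intersect if and only if they form one of the following pairs, and in that case they have exactly one point in common: $\mathcal L_i^0,\mathcal L_j^\infty$ with $i\neq j$; $\widetilde{\mathcal L}_i^0,\widetilde{\mathcal L}_j^\infty$ with $i\ne j$; $\mathcal L_i^{\diamond},\widetilde{\mathcal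 L}_i^{\star}$ with $1\le i\le 4$ and $\diamond,\star\in\{0,\infty\}$. In particular, each line intersects exactly five other lines, and there are in total exactly $40$ intersection points. 3. If in addition $2\theta_0\pm2\theta_t,\ 2\theta_0\pm2\theta_1,\ 2\theta_\infty\pm2\theta_t,\ 2\theta_\infty\pm2\theta_1\notin\Lambda_\tau$ and $t_0\notin q^{\mathbb{Z}+U}$, where \begin{align*} U=&\{\epsilon_0\theta_0+\epsilon_\infty\theta_\infty+2\epsilon_t\theta_t\}\cup\{\epsilon_t\theta_t+\epsilon_1\theta_1+2\epsilon_\infty\theta_\infty\}\cup\{\epsilon_0\theta_0+\epsilon_\infty\theta_\infty+2\epsilon_1\theta_1\}\cup\{\epsilon_t\theta_t+\epsilon_1\theta_1+2\epsilon_0\theta_0\} \end{align*} with all $\epsilon$'s ranging over $\{\pm1\}$, then all $40$ intersection points are finite, i.e. they lie in $\mathcal F$. -/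

import Mathlib

open scoped LinearAlgebra.Projectivization

noncomputable section

namespace QPVI

/-! ### Theta functions -/

/-- The `q`-Pochhammer symbol `(z; q)_∞ = ∏_{k ≥ 0} (1 - q ^ k z)`. -/
def qPoch (q : ℝ) (z : ℂ) : ℂ := ∏' k : ℕ, (1 - (q : ℂ) ^ k * z)

/-- The `q`-theta function `θ_q(z) = (z; q)_∞ (q / z; q)_∞` on `ℂ \ {0}`. -/
def qTheta (q : ℝ) (z : ℂ) : ℂ := qPoch q z * qPoch q ((q : ℂ) / z)

/-- `ϑ_τ(x) = θ_q(q ^ x)`. -/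
def varTheta (q : ℝ) (x : ℂ) : ℂ := qTheta q ((q : ℂ) ^ x)

/-- `τ = - 2 π i / log q`. -/
def tau (q : ℝ) : ℂ := -(2 * (Real.pi : ℂ) * Complex.I) / (Real.log q : ℂ)

/-- The lattice `Λ_τ = ℤ + ℤ τ`. -/
def lattice (q : ℝ) : Set ℂ := {w | ∃ m n : ℤ, w = m + n * tau q}

/-- The set `q ^ (ℤ + s)`. -/
def qSpiral (q : ℝ) (s : ℂ) : Set ℂ := {w | ∃ n : ℤ, w = (q : ℂ) ^ ((n : ℂ) + s)}

/-! ### Parameters -/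

/-- The data `q`, `Θ = (θ₀, θ_t, θ₁, θ_∞)` and `t₀`. -/
structure Params where
  q : ℝ
  θ0 : ℂ
  θt : ℂ
  θ1 : ℂ
  θi : ℂ
  t0 : ℂ

/-- The two signs `±1`, as complex numbers. -/
def signs : Set ℂ := {1, -1}

/-- The standing assumptions: `0 < q < 1`, `t₀ ≠ 0`,
`2 θ₀, 2 θ_t, 2 θ₁, 2 θ_∞ ∉ Λ_τ`, `± θ₀ ± θ_t ± θ₁ ± θ_∞ ∉ Λ_τ`, and
`t₀ ∉ q ^ (ℤ ± (θ_t + θ₁))`, `q ^ (ℤ ± (θ_t - θ₁))`, `q ^ (ℤ ± (θ₀ + θ_∞))`,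
`q ^ (ℤ ± (θ₀ - θ_∞))`. -/
structure Params.Admissible (P : Params) : Prop where
  q_pos : 0 < P.q
  q_lt_one : P.q < 1
  t0_ne_zero : P.t0 ≠ 0
  two_θ0 : 2 * P.θ0 ∉ lattice P.q
  two_θt : 2 * P.θt ∉ lattice P.q
  two_θ1 : 2 * P.θ1 ∉ lattice P.q
  two_θi : 2 * P.θi ∉ lattice P.q
  sum_θ : ∀ e0 ∈ signs, ∀ et ∈ signs, ∀ e1 ∈ signs, ∀ ei ∈ signs,
    e0 * P.θ0 + et * P.θt + e1 * P.θ1 + ei * P.θi ∉ lattice P.q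
  t0_t1 : ∀ et ∈ signs, ∀ e1 ∈ signs, P.t0 ∉ qSpiral P.q (et * P.θt + e1 * P.θ1)
  t0_0i : ∀ e0 ∈ signs, ∀ ei ∈ signs, P.t0 ∉ qSpiral P.q (e0 * P.θ0 + ei * P.θi)

/-- The additional conditions for finiteness of the intersection points:
`2 θ₀ ± 2 θ_t, 2 θ₀ ± 2 θ₁, 2 θ_∞ ± 2 θ_t, 2 θ_∞ ± 2 θ₁ ∉ Λ_τ` and `t₀ ∉ q ^ (ℤ + U)`. -/
structure Params.FinitenessConditions (P : Params) : Prop where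
  θ0_θt : ∀ e ∈ signs, 2 * P.θ0 + e * (2 * P.θt) ∉ lattice P.q
  θ0_θ1 : ∀ e ∈ signs, 2 * P.θ0 + e * (2 * P.θ1) ∉ lattice P.q
  θi_θt : ∀ e ∈ signs, 2 * P.θi + e * (2 * P.θt) ∉ lattice P.q
  θi_θ1 : ∀ e ∈ signs, 2 * P.θi + e * (2 * P.θ1) ∉ lattice P.q
  t0_0it : ∀ e0 ∈ signs, ∀ ei ∈ signs, ∀ et ∈ signs,
    P.t0 ∉ qSpiral P.q (e0 * P.θ0 + ei * P.θi + 2 * et * P.θt)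
  t0_t1i : ∀ et ∈ signs, ∀ e1 ∈ signs, ∀ ei ∈ signs,
    P.t0 ∉ qSpiral P.q (et * P.θt + e1 * P.θ1 + 2 * ei * P.θi)
  t0_0i1 : ∀ e0 ∈ signs, ∀ ei ∈ signs, ∀ e1 ∈ signs,
    P.t0 ∉ qSpiral P.q (e0 * P.θ0 + ei * P.θi + 2 * e1 * P.θ1)
  t0_t10 : ∀ et ∈ signs, ∀ e1 ∈ signs, ∀ e0 ∈ signs,
    P.t0 ∉ qSpiral P.q (et * P.θt + e1 * P.θ1 + 2 * e0 * P.θ0)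

namespace Params

variable (P : Params)

/-- `q ^ x`. -/
def pow (x : ℂ) : ℂ := (P.q : ℂ) ^ x

/-- `θ_q`. -/
def th (z : ℂ) : ℂ := qTheta P.q z

/-- `ϑ_τ`. -/
def vt (x : ℂ) : ℂ := varTheta P.q x

/-- `(x₁, x₂, x₃, x₄) = (q^θ_t t₀, q^(-θ_t) t₀, q^θ₁, q^(-θ₁))`. -/
def x : Fin 4 → ℂ :=
  ![P.pow P.θt * P.t0, P.pow (-P.θt) * P.t0, P.pow P.θ1, P.pow (-P.θ1)]

/-! ### Connection matrices and Tyurin parameters -/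

/-- The space of connection matrices `ℭ(Θ, t₀)`. The value at `z = 0` is irrelevant. -/
structure IsConnectionMatrix (C : ℂ → Matrix (Fin 2) (Fin 2) ℂ) : Prop where
  analytic : ∀ i j, AnalyticOnNhd ℂ (fun z => C z i j) {0}ᶜ
  qdiff : ∀ z : ℂ, z ≠ 0 → C ((P.q : ℂ) * z) =
    (P.t0 / z ^ 2) • (Matrix.diagonal ![P.pow P.θ0, P.pow (-P.θ0)] * C z *
      Matrix.diagonal ![P.pow P.θi, P.pow (-P.θi)])
  det : ∃ c : ℂ, c ≠ 0 ∧ ∀ z : ℂ, z ≠ 0 → (C z).det =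
    c * (P.th (P.pow (-P.θt) * (z / P.t0)) * P.th (P.pow P.θt * (z / P.t0)) *
      P.th (P.pow (-P.θ1) * z) * P.th (P.pow P.θ1 * z))

end Params

/-- Homogeneous coordinates `(π^x, π^y)` of the point `π(R) ∈ ℂℙ¹` of a rank one matrix
`R = (R₁, R₂)`, defined by `R₁ = π(R) R₂`; a nonzero row of `R` provides such coordinates. -/
def piCoord (R : Matrix (Fin 2) (Fin 2) ℂ) : Fin 2 → ℂ :=
  open Classical in if R 0 = 0 then R 1 else R 0

theorem piCoord_spec (R : Matrix (Fin 2) (Fin 2) ℂ) (h0 : R ≠ 0) (hd : R.det = 0) :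
    piCoord R ≠ 0 ∧ ∀ i, piCoord R 1 * R i 0 = piCoord R 0 * R i 1 := by
  rw [Matrix.det_fin_two] at hd
  unfold piCoord
  split_ifs with h
  · refine ⟨fun h1 => h0 ?_, fun i => ?_⟩
    · ext i j
      fin_cases i
      · exact congrFun h j
      · exact congrFun h1 j
    · fin_cases i
      · simp [h]
      · exact mul_comm _ _
  · refine ⟨h, fun i => ?_⟩
    fin_cases i
    · simp [mul_comm]
    · simp only [Fin.mk_one]
      linear_combination -hd

/-- The two special values `0` and `∞` of a Tyurin parameter. -/
inductive Diamond
  | zero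
  | infty

/-- The point of `ℂℙ¹` with homogeneous coordinates `(v 0 : v 1)` is `0`, respectively `∞`. -/
def Diamond.IsValue : Diamond → (Fin 2 → ℂ) → Prop
  | .zero, v => v 0 = 0
  | .infty, v => v 1 = 0

/-! ### The Segre surface

Pairs `i < j` in `{1, 2, 3, 4}` are indexed by `Fin 6` in the order `12, 13, 14, 23, 24, 34`;
the last of the seven projective coordinates is `N_∞`. -/

/-- Homogenised monomials `ρ_i ρ_j`, e.g. `ρ₁^x ρ₂^x ρ₃^y ρ₄^y` for the pair `12`. -/
def mono (r : Fin 4 → Fin 2 → ℂ) : Fin 6 → ℂ :=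
  ![r 0 0 * r 1 0 * r 2 1 * r 3 1,
    r 0 0 * r 1 1 * r 2 0 * r 3 1,
    r 0 0 * r 1 1 * r 2 1 * r 3 0,
    r 0 1 * r 1 0 * r 2 0 * r 3 1,
    r 0 1 * r 1 0 * r 2 1 * r 3 0,
    r 0 1 * r 1 1 * r 2 0 * r 3 0]

namespace Params

variable (P : Params)

/-- The coefficients `T_{ij}`. -/
def T : Fin 6 → ℂ :=
  ![P.th (P.pow (P.θ0 + P.θi) * P.t0) * P.th (P.pow (-P.θ0 + P.θi) * P.t0) *
      (P.vt (2 * P.θt) * P.vt (2 * P.θ1)),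
    -(P.th (P.pow (P.θt - P.θ1) * P.t0) * P.th (P.pow (-P.θt + P.θ1) * P.t0) *
      (P.vt (P.θ0 + P.θt + P.θ1 + P.θi) * P.vt (-P.θ0 + P.θt + P.θ1 + P.θi))),
    P.th (P.pow (P.θt + P.θ1) * P.t0) * P.th (P.pow (-P.θt - P.θ1) * P.t0) *
      (P.vt (P.θ0 + P.θt - P.θ1 + P.θi) * P.vt (-P.θ0 + P.θt - P.θ1 + P.θi)) *
      P.pow (2 * P.θ1),
    P.th (P.pow (P.θt + P.θ1) * P.t0) * P.th (P.pow (-P.θt - P.θ1) * P.t0) *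
      (P.vt (P.θ0 - P.θt + P.θ1 + P.θi) * P.vt (-P.θ0 - P.θt + P.θ1 + P.θi)) *
      P.pow (2 * P.θt),
    -(P.th (P.pow (P.θt - P.θ1) * P.t0) * P.th (P.pow (-P.θt + P.θ1) * P.t0) *
      (P.vt (P.θ0 - P.θt - P.θ1 + P.θi) * P.vt (-P.θ0 - P.θt - P.θ1 + P.θi)) *
      P.pow (2 * P.θt + 2 * P.θ1)),
    P.th (P.pow (P.θ0 - P.θi) * P.t0) * P.th (P.pow (-P.θ0 - P.θi) * P.t0) *
      (P.vt (2 * P.θt) * P.vt (2 * P.θ1)) * P.pow (2 * P.θi)]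

/-- The coefficients `T'_{ij}`: those of `T` with `θ₀` set equal to `0`. -/
def T' : Fin 6 → ℂ := T { P with θ0 := 0 }

/-- The constant `ϑ_τ(1/2, -1/2) / ϑ_τ(θ₀, -θ₀)`. -/
def etaConst : ℂ := (P.vt (1 / 2) * P.vt (-(1 / 2))) / (P.vt P.θ0 * P.vt (-P.θ0))

/-- `∏_{ε = ±1} ϑ_τ(s) / ϑ_τ(ε θ₀ + s)`. -/
def aQuot (s : ℂ) : ℂ := (P.vt s / P.vt (P.θ0 + s)) * (P.vt s / P.vt (-P.θ0 + s))

/-- The coefficients `a₁₂, a₁₃, a₁₄, a₂₃, a₂₄, a₃₄, a_∞`. -/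
def a : Fin 7 → ℂ :=
  ![(P.th (P.pow P.θi * P.t0) / P.th (P.pow (P.θ0 + P.θi) * P.t0)) *
      (P.th (P.pow P.θi * P.t0) / P.th (P.pow (-P.θ0 + P.θi) * P.t0)),
    P.aQuot (P.θt + P.θ1 + P.θi),
    P.aQuot (P.θt - P.θ1 + P.θi),
    P.aQuot (-P.θt + P.θ1 + P.θi),
    P.aQuot (-P.θt - P.θ1 + P.θi),
    (P.th (P.pow (-P.θi) * P.t0) / P.th (P.pow (P.θ0 - P.θi) * P.t0)) *
      (P.th (P.pow (-P.θi) * P.t0) / P.th (P.pow (-P.θ0 - P.θi) * P.t0)),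
    -P.etaConst]

/-- `b₁ = T₁₃ T₂₄ / (T₁₂ T₃₄)`. -/
def b₁ : ℂ := (P.T 1 * P.T 4) / (P.T 0 * P.T 5)

/-- `b₂ = T₁₄ T₂₃ / (T₁₂ T₃₄)`. -/
def b₂ : ℂ := (P.T 2 * P.T 3) / (P.T 0 * P.T 5)

/-- The four homogeneous equations in `N = (N₁₂, N₁₃, N₁₄, N₂₃, N₂₄, N₃₄, N_∞)`. -/
def SegreEquations (N : Fin 7 → ℂ) : Prop :=
  N 0 + N 1 + N 2 + N 3 + N 4 + N 5 = 0 ∧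
  ∑ i, P.a i * N i = 0 ∧
  N 1 * N 4 - P.b₁ * (N 0 * N 5) = 0 ∧
  N 2 * N 3 - P.b₂ * (N 0 * N 5) = 0

end Params

/-- The point `(η, 1)` of `ℂ⁷`. -/
def affineVec (η : Fin 6 → ℂ) : Fin 7 → ℂ := Fin.snoc (α := fun _ => ℂ) η 1

theorem affineVec_ne_zero (η : Fin 6 → ℂ) : affineVec η ≠ 0 := by
  intro h
  have h1 : affineVec η (Fin.last 6) = 0 := congrFun h (Fin.last 6)
  rw [affineVec, Fin.snoc_last] at h1
  exact one_ne_zero h1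

/-- Six dimensional complex projective space `ℂℙ⁶`. -/
abbrev CP6 : Type := ℙ ℂ (Fin 7 → ℂ)

/-- The embedding `ℂ⁶ → ℂℙ⁶`, `η ↦ (η : 1)`. -/
def affineEmb (η : Fin 6 → ℂ) : CP6 := Projectivization.mk ℂ (affineVec η) (affineVec_ne_zero η)

namespace Params

variable (P : Params)

/-- The affine Segre surface `𝓕(Θ, t₀) ⊆ ℂ⁶`. -/
def affineSurface : Set (Fin 6 → ℂ) := {η | P.SegreEquations (affineVec η)}

/-- The Segre surface, the projective completion of `𝓕(Θ, t₀)` in `ℂℙ⁶`. The equations are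
homogeneous, so the choice of the representative vector is irrelevant. -/
def segreSurface : Set CP6 := {p | P.SegreEquations p.rep}

/-- The hyperplane section at infinity, `X`: the points of the Segre surface outside `𝓕`. -/
def sectionAtInfinity : Set CP6 := P.segreSurface \ (affineEmb '' P.affineSurface)

/-- Homogeneous coordinates of the Tyurin parameters `ρ_k = π(C(x_k))`. -/
def tyurin (C : ℂ → Matrix (Fin 2) (Fin 2) ℂ) (k : Fin 4) : Fin 2 → ℂ := piCoord (C (P.x k))

/-- Homogeneous coordinates of the dual Tyurin parameters `π(C(x_k)ᵀ)`. -/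
def dualTyurin (C : ℂ → Matrix (Fin 2) (Fin 2) ℂ) (k : Fin 4) : Fin 2 → ℂ :=
  piCoord (C (P.x k)).transpose

/-- The coordinates `η_{ij} = ϑ_τ(1/2, -1/2) / ϑ_τ(θ₀, -θ₀) * T_{ij} ρ_i ρ_j / T'(ρ)` of a
connection matrix. -/
def eta (C : ℂ → Matrix (Fin 2) (Fin 2) ℂ) : Fin 6 → ℂ := fun p =>
  P.etaConst * (P.T p * mono (P.tyurin C) p / ∑ p', P.T' p' * mono (P.tyurin C) p')

end Params

/-! ### The lines -/

/-- Names of the sixteen lines; `k : Fin 4` stands for the index `k + 1`. -/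
inductive LineName
  /-- `𝓛_k^◇` -/
  | line (k : Fin 4) (d : Diamond)
  /-- the line with a tilde, defined through dual Tyurin parameters -/
  | dual (k : Fin 4) (d : Diamond)

/-- The closure of a set of points of `ℂℙ⁶` in the usual (quotient) topology, computed on the
cone over the set in `ℂ⁷`. -/
def projClosure (S : Set CP6) : Set CP6 :=
  {p | p.rep ∈ closure {v : Fin 7 → ℂ | ∃ hv : v ≠ 0, Projectivization.mk ℂ v hv ∈ S}}

/-- The condition `ρ_k = ◇`, respectively its dual, on a connection matrix. -/
def Params.LineCondition (P : Params) (C : ℂ → Matrix (Fin 2) (Fin 2) ℂ) : LineName → Prop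
  | .line k d => d.IsValue (P.tyurin C k)
  | .dual k d => d.IsValue (P.dualTyurin C k)

/-- The sixteen subsets `𝓛_k^◇` and their duals: the loci `ρ_k = ◇`, respectively `ρ̃_k = ◇`, in
the `η`-coordinates, completed in `ℂℙ⁶`. -/
def Params.lineSet (P : Params) (l : LineName) : Set CP6 :=
  projClosure {p | ∃ C, P.IsConnectionMatrix C ∧ P.LineCondition C l ∧ p = affineEmb (P.eta C)}

/-- A projective line in `ℂℙ⁶`: the set of points of a two dimensional linear subspace of `ℂ⁷`. -/
def IsProjLine (S : Set CP6) : Prop :=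
  ∃ W : Submodule ℂ (Fin 7 → ℂ), Module.finrank ℂ W = 2 ∧ S = {p | p.submodule ≤ W}

/-- The edges of the intersection graph: `𝓛_i^0 — 𝓛_j^∞` for `i ≠ j`, the same for the dual lines,
and each of `𝓛_i^0, 𝓛_i^∞` with each of the two dual lines of the same index `i`. -/
def LineName.Meets : LineName → LineName → Prop
  | .line i d, .line j e => i ≠ j ∧ d ≠ e
  | .dual i d, .dual j e => i ≠ j ∧ d ≠ e
  | .line i _, .dual j _ => i = j
  | .dual i _, .line j _ => i = j

/-- The graph of lines and intersection points, with `16` vertices. -/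
def lineGraph : SimpleGraph LineName where
  Adj := LineName.Meets
  symm := ⟨by
    rintro (⟨i, d⟩ | ⟨i, d⟩) (⟨j, e⟩ | ⟨j, e⟩) h
    · exact ⟨h.1.symm, h.2.symm⟩
    · exact Eq.symm h
    · exact Eq.symm h
    · exact ⟨h.1.symm, h.2.symm⟩⟩
  loopless := ⟨by
    rintro (⟨i, d⟩ | ⟨i, d⟩) h
    · exact h.1 rfl
    · exact h.1 rfl⟩

/-- The set of points in which two different ones of the sixteen lines meet. -/
def Params.intersectionPoints (P : Params) : Set CP6 :=
  {p | ∃ l m : LineName, l ≠ m ∧ p ∈ P.lineSet l ∩ P.lineSet m}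

end QPVI

end

open scoped LinearAlgebra.Projectivization

noncomputable section
namespace QPVI

/-! ### The theta function -/

section Theta

variable {q : ℝ}

theorem norm_ofReal_lt_one (h0 : 0 < q) (h1 : q < 1) : ‖(q : ℂ)‖ < 1 := by
  rw [Complex.norm_real, Real.norm_eq_abs, abs_of_pos h0]; exact h1

theorem summable_qPoch (h0 : 0 < q) (h1 : q < 1) (z : ℂ) :
    Summable fun k : ℕ => ‖-((q : ℂ) ^ k * z)‖ := by
  simp only [norm_neg, norm_mul, norm_pow]
  exact (summable_geometric_of_lt_one (norm_nonneg _) (norm_ofReal_lt_one h0 h1)).mul_right _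

theorem qPoch_differentiable (h0 : 0 < q) (h1 : q < 1) : Differentiable ℂ (qPoch q) := by
  intro z
  have hq := norm_ofReal_lt_one h0 h1
  have hopen : IsOpen (Metric.ball (0 : ℂ) (‖z‖ + 1)) := Metric.isOpen_ball
  have hmem : z ∈ Metric.ball (0 : ℂ) (‖z‖ + 1) := by simp
  have key := ((summable_geometric_of_lt_one (norm_nonneg _) hq).mul_right
    (‖z‖ + 1)).hasProdLocallyUniformlyOn_nat_one_add (f := fun k w => -((q : ℂ) ^ k * w)) hopen
    (.of_forall fun n x hx => by
      rw [norm_neg, norm_mul, norm_pow]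
      have : ‖x‖ < ‖z‖ + 1 := by simpa using hx
      gcongr) (fun n => by fun_prop)
  have hd := key.differentiableOn (.of_forall fun s => by
    simpa [Finset.prod_fn] using DifferentiableOn.finsetProd (fun _ _ => by fun_prop)) hopen
  have : qPoch q = fun w => ∏' i : ℕ, (1 + -((q : ℂ) ^ i * w)) := by
    funext w; simp only [qPoch, sub_eq_add_neg]
  rw [this]
  exact (hd z hmem).differentiableAt (hopen.mem_nhds hmem)

theorem qPoch_multipliable (h0 : 0 < q) (h1 : q < 1) (z : ℂ) :
    Multipliable fun k : ℕ => 1 - (q : ℂ) ^ k * z := by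
  have := multipliable_one_add_of_summable (f := fun k : ℕ => -((q : ℂ) ^ k * z))
    (summable_qPoch h0 h1 z)
  exact this.congr fun k => (sub_eq_add_neg _ _).symm

theorem qPoch_eq_mul (h0 : 0 < q) (h1 : q < 1) (z : ℂ) :
    qPoch q z = (1 - z) * qPoch q (q * z) := by
  have hs : (fun k : ℕ => 1 - (q : ℂ) ^ k * (q * z)) =
      fun k : ℕ => 1 - (q : ℂ) ^ (k + 1) * z := by
    funext k; rw [pow_succ, mul_assoc]
  have hm := qPoch_multipliable h0 h1 (q * z)
  rw [hs] at hm
  have key := tprod_eq_zero_mul' (f := fun k : ℕ => 1 - (q : ℂ) ^ k * z) hm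
  unfold qPoch
  rw [key, hs, pow_zero, one_mul]

theorem qPoch_ne_zero (h0 : 0 < q) (h1 : q < 1) {z : ℂ} (h : ∀ k : ℕ, (q : ℂ) ^ k * z ≠ 1) :
    qPoch q z ≠ 0 := by
  have := tprod_one_add_ne_zero_of_summable (f := fun k : ℕ => -((q : ℂ) ^ k * z))
    (fun k => by rw [← sub_eq_add_neg, sub_ne_zero]; exact (h k).symm) (summable_qPoch h0 h1 z)
  simpa only [qPoch, sub_eq_add_neg] using this

theorem ofReal_ne_zero' (h0 : 0 < q) : (q : ℂ) ≠ 0 := by exact_mod_cast h0.ne'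

theorem qTheta_analytic (h0 : 0 < q) (h1 : q < 1) : AnalyticOnNhd ℂ (qTheta q) {0}ᶜ := by
  apply DifferentiableOn.analyticOnNhd _ isOpen_compl_singleton
  intro z hz
  have hz' : z ≠ 0 := hz
  apply DifferentiableAt.differentiableWithinAt
  apply DifferentiableAt.mul (qPoch_differentiable h0 h1 z)
  exact (qPoch_differentiable h0 h1 _).comp z (by fun_prop (disch := assumption))

theorem qTheta_q_mul (h0 : 0 < q) (h1 : q < 1) {z : ℂ} (hz : z ≠ 0) :
    qTheta q (q * z) * z = -qTheta q z := by
  have hq := ofReal_ne_zero' h0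
  unfold qTheta
  rw [qPoch_eq_mul h0 h1 z, show (q : ℂ) / (q * z) = 1 / z by field_simp,
    qPoch_eq_mul h0 h1 (1 / z), mul_one_div]
  field_simp
  ring

theorem qTheta_inv (h0 : 0 < q) (h1 : q < 1) {z : ℂ} (hz : z ≠ 0) :
    qTheta q z⁻¹ * z = -qTheta q z := by
  unfold qTheta
  rw [qPoch_eq_mul h0 h1 z, qPoch_eq_mul h0 h1 z⁻¹, div_inv_eq_mul, div_eq_mul_inv]
  field_simp
  ring

theorem qTheta_one (h0 : 0 < q) (h1 : q < 1) : qTheta q 1 = 0 := by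
  unfold qTheta
  rw [qPoch_eq_mul h0 h1 1]; simp

theorem qTheta_q_mul_eq_zero_iff (h0 : 0 < q) (h1 : q < 1) {z : ℂ} (hz : z ≠ 0) :
    qTheta q (q * z) = 0 ↔ qTheta q z = 0 := by
  have := qTheta_q_mul h0 h1 hz
  constructor <;> intro h
  · rw [h, zero_mul] at this; exact neg_eq_zero.mp this.symm
  · rw [h, neg_zero] at this; exact (mul_eq_zero.mp this).resolve_right hz

theorem qTheta_inv_eq_zero_iff (h0 : 0 < q) (h1 : q < 1) {z : ℂ} (hz : z ≠ 0) :
    qTheta q z⁻¹ = 0 ↔ qTheta q z = 0 := by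
  have := qTheta_inv h0 h1 hz
  constructor <;> intro h
  · rw [h, zero_mul] at this; exact neg_eq_zero.mp this.symm
  · rw [h, neg_zero] at this; exact (mul_eq_zero.mp this).resolve_right hz

theorem qTheta_zpow (h0 : 0 < q) (h1 : q < 1) (n : ℤ) : qTheta q ((q : ℂ) ^ n) = 0 := by
  have hq := ofReal_ne_zero' h0
  induction n using Int.induction_on with
  | zero => simpa using qTheta_one h0 h1
  | succ n ih =>
    rw [zpow_add_one₀ hq, mul_comm]
    exact (qTheta_q_mul_eq_zero_iff h0 h1 (zpow_ne_zero _ hq)).mpr ih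
  | pred n ih =>
    rw [← qTheta_q_mul_eq_zero_iff h0 h1 (zpow_ne_zero _ hq), mul_comm, ← zpow_add_one₀ hq,
      sub_add_cancel]
    exact ih

/-- A convergent product vanishes only if one of its factors does: the first Pochhammer symbol
accounts for the powers with exponent ≤ 0, the second for those with exponent ≥ 1. -/
theorem qTheta_eq_zero_iff (h0 : 0 < q) (h1 : q < 1) {z : ℂ} (hz : z ≠ 0) :
    qTheta q z = 0 ↔ ∃ n : ℤ, z = (q : ℂ) ^ n := by
  have hq := ofReal_ne_zero' h0
  constructor
  · intro h
    by_contra! hn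
    refine mul_ne_zero (qPoch_ne_zero h0 h1 fun k hk => hn (-k) ?_)
      (qPoch_ne_zero h0 h1 fun k hk => hn (k + 1) ?_) h
    · rw [zpow_neg, zpow_natCast]; exact eq_inv_of_mul_eq_one_right hk
    · rw [← mul_div_assoc, div_eq_one_iff_eq hz] at hk
      rw [zpow_add_one₀ hq, zpow_natCast, hk]
  · rintro ⟨n, rfl⟩
    exact qTheta_zpow h0 h1 n

/-- Powers of q are positive. This makes -a a convenient test point at which θ_q(z / a) does not
vanish. -/
theorem qTheta_neg_one_ne_zero (h0 : 0 < q) (h1 : q < 1) : qTheta q (-1) ≠ 0 := by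
  rw [Ne, qTheta_eq_zero_iff h0 h1 (by norm_num)]
  rintro ⟨n, hn⟩
  have h2 : (-1 : ℝ) = q ^ n := by exact_mod_cast hn
  have : 0 < q ^ n := zpow_pos h0 n
  linarith

/-- Splitting off the factor 1 - z leaves the value (q; q)_∞² ≠ 0 at 1, so the zero is simple. -/
theorem deriv_qTheta_one (h0 : 0 < q) (h1 : q < 1) : deriv (qTheta q) 1 ≠ 0 := by
  have hE : DifferentiableAt ℂ (fun z : ℂ => qPoch q (q * z) * qPoch q (q / z)) 1 := by
    apply DifferentiableAt.mul
    · exact (qPoch_differentiable h0 h1 _).comp (1 : ℂ) (by fun_prop)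
    · exact (qPoch_differentiable h0 h1 _).comp (1 : ℂ) (by fun_prop (disch := simp))
  have heq : qTheta q = fun z => (1 - z) * (qPoch q (q * z) * qPoch q (q / z)) := by
    funext z
    rw [qTheta, qPoch_eq_mul h0 h1 z, mul_assoc]
  have hd : HasDerivAt (fun z : ℂ => 1 - z) (-1) 1 := by
    simpa using (hasDerivAt_id (1 : ℂ)).const_sub 1
  have := (hd.mul hE.hasDerivAt).deriv
  rw [heq]
  erw [this]
  have hne : qPoch q q ≠ 0 := by
    apply qPoch_ne_zero h0 h1
    intro k hk
    have h2 : q ^ k * q = 1 := by exact_mod_cast hk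
    have : q ^ (k + 1) < 1 := pow_lt_one₀ h0.le h1 (by simp)
    rw [pow_succ] at this
    linarith
  simp [hne]

/-- Differentiating θ(qz) z = -θ(z) at a zero carries simplicity from one power of q to the next. -/
theorem deriv_qTheta_zpow (h0 : 0 < q) (h1 : q < 1) (n : ℤ) :
    deriv (qTheta q) ((q : ℂ) ^ n) ≠ 0 := by
  have hq := ofReal_ne_zero' h0
  have step : ∀ n : ℤ, deriv (qTheta q) ((q : ℂ) ^ (n + 1)) * (q * (q : ℂ) ^ n) =
      -deriv (qTheta q) ((q : ℂ) ^ n) := by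
    intro n
    have hz : (q : ℂ) ^ n ≠ 0 := zpow_ne_zero _ hq
    have hqz : (q : ℂ) * (q : ℂ) ^ n = (q : ℂ) ^ (n + 1) := by rw [zpow_add_one₀ hq, mul_comm]
    have d1 : HasDerivAt (qTheta q) (deriv (qTheta q) ((q : ℂ) ^ (n + 1)))
        ((q : ℂ) * (q : ℂ) ^ n) := by
      rw [hqz]
      exact (qTheta_analytic h0 h1 _ (zpow_ne_zero _ hq)).differentiableAt.hasDerivAt
    have dl : HasDerivAt (fun z : ℂ => (q : ℂ) * z) q ((q : ℂ) ^ n) := by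
      simpa using (hasDerivAt_id ((q : ℂ) ^ n)).const_mul (q : ℂ)
    have d2 : HasDerivAt (fun z : ℂ => qTheta q (q * z) * z) _ ((q : ℂ) ^ n) :=
      (d1.comp ((q : ℂ) ^ n) dl).mul (hasDerivAt_id _)
    have d3 : HasDerivAt (fun z : ℂ => -qTheta q z) _ ((q : ℂ) ^ n) :=
      (qTheta_analytic h0 h1 _ hz).differentiableAt.hasDerivAt.neg
    have hev : (fun z : ℂ => qTheta q (q * z) * z) =ᶠ[nhds ((q : ℂ) ^ n)]
        fun z : ℂ => -qTheta q z := by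
      filter_upwards [isOpen_ne.mem_nhds hz] with z hz
      exact qTheta_q_mul h0 h1 hz
    have := (hev.symm.hasDerivAt_iff.mp d3).unique d2
    simp only [Function.comp_apply, hqz, qTheta_zpow h0 h1 (n + 1), mul_one, add_zero] at this
    rw [this]; ring
  induction n using Int.induction_on with
  | zero => simpa using deriv_qTheta_one h0 h1
  | succ n ih => intro h; apply ih; have := step n; rw [h, zero_mul] at this
                 exact neg_eq_zero.mp this.symm
  | pred n ih =>
    intro h
    have := step (-n - 1)
    rw [h, sub_add_cancel, neg_zero] at this
    exact ih ((mul_eq_zero.mp this).resolve_right (mul_ne_zero hq (zpow_ne_zero _ hq)))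

end Theta

/-! ### Quasi-periodic functions -/

/-- Analytic functions on `ℂ \ {0}` with `f (q z) = c (-z)⁻ⁿ f z`. -/
structure IsTheta (q : ℝ) (n : ℕ) (c : ℂ) (f : ℂ → ℂ) : Prop where
  analytic : AnalyticOnNhd ℂ f {0}ᶜ
  qdiff : ∀ z : ℂ, z ≠ 0 → f (q * z) * (-z) ^ n = c * f z

namespace IsTheta

variable {q : ℝ} {n m : ℕ} {c d : ℂ} {f g : ℂ → ℂ}

theorem add (hf : IsTheta q n c f) (hg : IsTheta q n c g) :
    IsTheta q n c (fun z => f z + g z) where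
  analytic z hz := (hf.analytic z hz).add (hg.analytic z hz)
  qdiff z hz := by rw [add_mul, mul_add, hf.qdiff z hz, hg.qdiff z hz]

theorem sub (hf : IsTheta q n c f) (hg : IsTheta q n c g) :
    IsTheta q n c (fun z => f z - g z) where
  analytic z hz := (hf.analytic z hz).sub (hg.analytic z hz)
  qdiff z hz := by rw [sub_mul, mul_sub, hf.qdiff z hz, hg.qdiff z hz]

theorem const_mul (hf : IsTheta q n c f) (a : ℂ) : IsTheta q n c (fun z => a * f z) where
  analytic z hz := analyticAt_const.mul (hf.analytic z hz)
  qdiff z hz := by rw [mul_assoc, hf.qdiff z hz]; ring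

theorem mul (hf : IsTheta q n c f) (hg : IsTheta q m d g) :
    IsTheta q (n + m) (c * d) (fun z => f z * g z) where
  analytic z hz := (hf.analytic z hz).mul (hg.analytic z hz)
  qdiff z hz := by
    rw [pow_add, mul_mul_mul_comm, hf.qdiff z hz, hg.qdiff z hz]; ring

theorem congr_const (hf : IsTheta q n c f) (h : c = d) : IsTheta q n d f := h ▸ hf

end IsTheta

/-! ### Division of quasi-periodic functions by theta functions -/

section Theta

variable {q : ℝ} {n : ℕ} {c : ℂ} {f g : ℂ → ℂ}

theorem qTheta_div_analytic (h0 : 0 < q) (h1 : q < 1) {a : ℂ} (ha : a ≠ 0) :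
    AnalyticOnNhd ℂ (fun z => qTheta q (z / a)) {0}ᶜ := by
  intro z hz
  have hz : z ≠ 0 := hz
  exact (qTheta_analytic h0 h1 (z / a) (div_ne_zero hz ha)).comp_of_eq
    (analyticAt_id.div_const) rfl

theorem isTheta_qTheta (h0 : 0 < q) (h1 : q < 1) {a : ℂ} (ha : a ≠ 0) :
    IsTheta q 1 a (fun z => qTheta q (z / a)) where
  analytic := qTheta_div_analytic h0 h1 ha
  qdiff z hz := by
    have := qTheta_q_mul h0 h1 (div_ne_zero hz ha)
    rw [pow_one]
    field_simp at this
    linear_combination -this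

theorem deriv_qTheta_div (h0 : 0 < q) (h1 : q < 1) {a z : ℂ} (ha : a ≠ 0) (hz : z ≠ 0)
    (h : qTheta q (z / a) = 0) : deriv (fun w => qTheta q (w / a)) z ≠ 0 := by
  obtain ⟨k, hk⟩ := (qTheta_eq_zero_iff h0 h1 (div_ne_zero hz ha)).mp h
  have hd : HasDerivAt (qTheta q) (deriv (qTheta q) (z / a)) (z / a) :=
    (qTheta_analytic h0 h1 _ (div_ne_zero hz ha)).differentiableAt.hasDerivAt
  have := (hd.comp z ((hasDerivAt_id z).div_const a)).deriv
  have he : (fun w => qTheta q (w / a)) = qTheta q ∘ fun x => id x / a := rfl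
  rw [he, this, hk]
  exact mul_ne_zero (deriv_qTheta_zpow h0 h1 k) (one_div_ne_zero ha)

/-- The zeros of θ_q(z / a) form the orbit q^ℤ a, and quasi-periodicity carries a zero of f at a
along this orbit. -/
theorem IsTheta.eq_zero_of_theta (h0 : 0 < q) (h1 : q < 1) (hc : c ≠ 0) (hf : IsTheta q n c f)
    {a z : ℂ} (ha : a ≠ 0) (hfa : f a = 0) (hz : z ≠ 0) (h : qTheta q (z / a) = 0) :
    f z = 0 := by
  have hq := ofReal_ne_zero' h0
  obtain ⟨k, hk⟩ := (qTheta_eq_zero_iff h0 h1 (div_ne_zero hz ha)).mp h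
  rw [div_eq_iff ha] at hk
  have step : ∀ w : ℂ, w ≠ 0 → (f (q * w) = 0 ↔ f w = 0) := by
    intro w hw
    have := hf.qdiff w hw
    constructor <;> intro h
    · rw [h, zero_mul] at this; exact (mul_eq_zero.mp this.symm).resolve_left hc
    · rw [h, mul_zero] at this
      exact (mul_eq_zero.mp this).resolve_right (pow_ne_zero _ (neg_ne_zero.mpr hw))
  have : ∀ k : ℤ, f ((q : ℂ) ^ k * a) = 0 := by
    intro k
    induction k using Int.induction_on with
    | zero => simpa using hfa
    | succ n ih =>
      rw [zpow_add_one₀ hq, mul_comm _ (q : ℂ), mul_assoc,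
        step _ (mul_ne_zero (zpow_ne_zero _ hq) ha)]
      exact ih
    | pred n ih =>
      rw [← step _ (mul_ne_zero (zpow_ne_zero _ hq) ha), ← mul_assoc, mul_comm (q : ℂ),
        ← zpow_add_one₀ hq, sub_add_cancel]
      exact ih
  rw [hk]; exact this k

theorem analyticAt_dslope {f : ℂ → ℂ} {z : ℂ} (hf : AnalyticAt ℂ f z) :
    AnalyticAt ℂ (dslope f z) z := by
  obtain ⟨p, hp⟩ := hf
  exact ⟨_, hp.has_fpower_series_dslope_fslope⟩

/-- A quasi-periodic function vanishing at `a` is divisible by `θ_q(z / a)`. -/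
theorem IsTheta.exists_div (h0 : 0 < q) (h1 : q < 1) (hc : c ≠ 0) (hf : IsTheta q (n + 1) c f)
    {a : ℂ} (ha : a ≠ 0) (hfa : f a = 0) :
    ∃ g, IsTheta q n (c / a) g ∧ ∀ z, z ≠ 0 → f z = qTheta q (z / a) * g z := by
  classical
  set t : ℂ → ℂ := fun z => qTheta q (z / a) with ht
  have hta := qTheta_div_analytic h0 h1 ha
  -- At a zero of t, which is simple, the ratio of the derivatives is the value that removes the
  -- singularity of f / t.
  let g : ℂ → ℂ := fun z => if t z = 0 then deriv f z / deriv t z else f z / t z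
  have hfg : ∀ z, z ≠ 0 → f z = t z * g z := by
    intro z hz
    by_cases h : t z = 0
    · rw [h, zero_mul]; exact hf.eq_zero_of_theta h0 h1 hc ha hfa hz h
    · simp only [g, if_neg h]; field_simp
  have hne : ∀ z, z ≠ 0 → ∀ᶠ w in nhdsWithin z {z}ᶜ, t w ≠ 0 := by
    intro z hz
    by_cases h : t z = 0
    · have hd : HasDerivAt t (deriv t z) z := (hta z hz).differentiableAt.hasDerivAt
      exact hd.eventually_ne (deriv_qTheta_div h0 h1 ha hz h)
    · exact ((hta z hz).continuousAt.eventually_ne h).filter_mono nhdsWithin_le_nhds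
  have hg : AnalyticOnNhd ℂ g {0}ᶜ := by
    intro z hz
    have hz' : z ≠ 0 := hz
    by_cases h : t z = 0
    · have hfz : f z = 0 := hf.eq_zero_of_theta h0 h1 hc ha hfa hz' h
      have hd := deriv_qTheta_div h0 h1 ha hz' h
      -- Both functions vanish at z, so f / t is the quotient of their difference quotients, with
      -- nonzero denominator at z.
      have han : AnalyticAt ℂ (fun w => dslope f z w / dslope t z w) z :=
        (analyticAt_dslope (hf.analytic z hz)).div (analyticAt_dslope (hta z hz))
          (by rw [dslope_same]; exact hd)
      refine han.congr ?_
      have := hne z hz'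
      rw [eventually_nhdsWithin_iff] at this
      filter_upwards [this] with w hw
      by_cases hwz : w = z
      · subst hwz; simp only [g, if_pos h, dslope_same]
      · have htw := hw hwz
        have hsub : w - z ≠ 0 := sub_ne_zero.mpr hwz
        simp only [g, if_neg htw, dslope_of_ne _ hwz, slope_def_field, hfz, h, sub_zero]
        field_simp
    · refine ((hf.analytic z hz).div (hta z hz) h).congr ?_
      filter_upwards [(hta z hz).continuousAt.eventually_ne h] with w hw
      simp only [g, Pi.div_apply]
      rw [if_neg hw]
  refine ⟨g, ⟨hg, ?_⟩, hfg⟩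
  intro z hz
  have hq := ofReal_ne_zero' h0
  have hqz : (q : ℂ) * z ≠ 0 := mul_ne_zero hq hz
  have hL : AnalyticAt ℂ (fun z => g (q * z) * (-z) ^ n) z := by
    refine AnalyticAt.mul ?_ (analyticAt_id.neg.pow n)
    exact (hg _ hqz).comp_of_eq (f := fun w : ℂ => (q : ℂ) * w)
      (analyticAt_const.mul analyticAt_id) rfl
  have hR : AnalyticAt ℂ (fun z => c / a * g z) z := analyticAt_const.mul (hg z hz)
  -- Away from the zeros of t the functional equation follows by cancelling t; the identity theorem
  -- extends it to z.
  refine ((hL.frequently_eq_iff_eventually_eq hR).mp ?_).self_of_nhds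
  refine Filter.Eventually.frequently ?_
  have hz' : ∀ᶠ w in nhdsWithin z {z}ᶜ, w ≠ 0 :=
    (continuousAt_id.eventually_ne hz).filter_mono nhdsWithin_le_nhds
  filter_upwards [hne z hz, hz'] with w hw hw0
  have e1 := hf.qdiff w hw0
  have e2 := (isTheta_qTheta h0 h1 ha).qdiff w hw0
  rw [hfg w hw0, hfg _ (mul_ne_zero hq hw0)] at e1
  have e2 : t (q * w) * (-w) ^ 1 = a * t w := e2
  have : t w * (a * (g (q * w) * (-w) ^ n)) = t w * (c * g w) := by
    rw [pow_succ] at e1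
    linear_combination e1 - g (q * w) * (-w) ^ n * e2
  have := mul_left_cancel₀ hw this
  field_simp
  linear_combination this

end Theta

/-! ### Functions of degree zero and the counting of zeros -/

section Theta

variable {q : ℝ} {n : ℕ} {c : ℂ} {f g : ℂ → ℂ}

/-- The quasi-periodic functions of degree `0` are the multiples of integral powers. -/
theorem IsTheta.degree_zero (h0 : 0 < q) (h1 : q < 1) {l : ℂ} (hl : l ≠ 0)
    (hg : IsTheta q 0 l g) :
    ∃ (K : ℂ) (s : ℝ), ‖l‖ = q ^ s ∧ ∀ x : ℂ, g (Complex.exp x) = K * Complex.exp (s * x) := by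
  have hq := ofReal_ne_zero' h0
  have hlog : Real.log q ≠ 0 := (Real.log_neg h0 h1).ne
  -- With ‖l‖ = q^s the function ‖g z‖ ‖z‖^(-s) is invariant under z ↦ q z, hence bounded by its
  -- maximum on the annulus q ≤ ‖z‖ ≤ 1.
  set s : ℝ := Real.log ‖l‖ / Real.log q with hs
  have hls : ‖l‖ = q ^ s := by
    rw [Real.rpow_def_of_pos h0, hs, mul_div_cancel₀ _ hlog, Real.exp_log (norm_pos_iff.mpr hl)]
  have hqd : ∀ z : ℂ, z ≠ 0 → g (q * z) = l * g z := fun z hz => by simpa using hg.qdiff z hz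
  let N : ℂ → ℝ := fun z => ‖g z‖ * ‖z‖ ^ (-s)
  have hN : ∀ z : ℂ, z ≠ 0 → N (q * z) = N z := by
    intro z hz
    simp only [N]
    rw [hqd z hz, norm_mul, norm_mul, Complex.norm_real, Real.norm_eq_abs, abs_of_pos h0,
      Real.mul_rpow h0.le (norm_nonneg _), hls, Real.rpow_neg h0.le]
    have : q ^ s ≠ 0 := (Real.rpow_pos_of_pos h0 s).ne'
    field_simp
  have hNz : ∀ (k : ℤ) (z : ℂ), z ≠ 0 → N ((q : ℂ) ^ k * z) = N z := by
    intro k z hz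
    induction k using Int.induction_on with
    | zero => simp
    | succ n ih =>
      rw [zpow_add_one₀ hq, mul_comm _ (q : ℂ), mul_assoc,
        hN _ (mul_ne_zero (zpow_ne_zero _ hq) hz)]
      exact ih
    | pred n ih =>
      rw [← hN _ (mul_ne_zero (zpow_ne_zero _ hq) hz), ← mul_assoc, mul_comm (q : ℂ),
        ← zpow_add_one₀ hq, sub_add_cancel]
      exact ih
  have hcomp : IsCompact (Metric.closedBall (0 : ℂ) 1 \ Metric.ball 0 q) :=
    (isCompact_closedBall _ _).diff Metric.isOpen_ball
  have hcont : ContinuousOn N (Metric.closedBall (0 : ℂ) 1 \ Metric.ball 0 q) := by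
    intro z hz
    have hz0 : z ≠ 0 := by
      rintro rfl
      exact hz.2 (by simpa using h0)
    apply ContinuousAt.continuousWithinAt
    exact ((hg.analytic z hz0).continuousAt.norm).mul
      (continuousAt_id.norm.rpow_const (Or.inl (norm_ne_zero_iff.mpr hz0)))
  obtain ⟨M, hM⟩ := hcomp.bddAbove_image hcont
  have hbound : ∀ z : ℂ, z ≠ 0 → N z ≤ M := by
    intro z hz
    obtain ⟨k, hk1, hk2⟩ := exists_mem_Ico_zpow (norm_pos_iff.mpr hz) ((one_lt_inv₀ h0).mpr h1)
    rw [← hNz (k + 1) z hz]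
    refine hM ⟨_, ⟨?_, ?_⟩, rfl⟩
    · rw [mem_closedBall_zero_iff, norm_mul, norm_zpow, Complex.norm_real, Real.norm_eq_abs,
        abs_of_pos h0]
      rw [inv_zpow] at hk2
      have hp := zpow_pos h0 (k + 1)
      calc q ^ (k + 1) * ‖z‖ ≤ q ^ (k + 1) * (q ^ (k + 1))⁻¹ := by gcongr
        _ = 1 := mul_inv_cancel₀ hp.ne'
    · rw [mem_ball_zero_iff, not_lt, norm_mul, norm_zpow, Complex.norm_real, Real.norm_eq_abs,
        abs_of_pos h0]
      rw [inv_zpow] at hk1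
      have hp := zpow_pos h0 k
      calc q = q ^ (k + 1) * (q ^ k)⁻¹ := by rw [zpow_add_one₀ h0.ne']; field_simp
        _ ≤ q ^ (k + 1) * ‖z‖ := by
          have := zpow_pos h0 (k + 1)
          gcongr
  -- On the universal cover of the punctured plane g z z^(-s) becomes an entire bounded function, to
  -- which Liouville's theorem applies.
  let H : ℂ → ℂ := fun x => g (Complex.exp x) * Complex.exp (-(s * x))
  have hHd : Differentiable ℂ H := by
    intro x
    refine DifferentiableAt.mul ?_ (by fun_prop)
    exact (hg.analytic _ (Complex.exp_ne_zero x)).differentiableAt.comp x (by fun_prop)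
  have hHb : Bornology.IsBounded (Set.range H) := by
    rw [isBounded_iff_forall_norm_le]
    refine ⟨M, ?_⟩
    rintro _ ⟨x, rfl⟩
    have := hbound (Complex.exp x) (Complex.exp_ne_zero x)
    simp only [N] at this
    simp only [H]
    rw [norm_mul, Complex.norm_exp (-(s * x))]
    rw [Complex.norm_exp x, ← Real.exp_mul] at this
    convert this using 3
    simp [mul_comm]
  obtain ⟨K, hK⟩ := hHd.exists_const_forall_eq_of_bounded hHb
  refine ⟨K, s, hls, fun x => ?_⟩
  rw [← hK x]
  simp only [H]
  rw [mul_assoc, ← Complex.exp_add, neg_add_cancel, Complex.exp_zero, mul_one]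

theorem IsTheta.eq_const (h0 : 0 < q) (h1 : q < 1) (hg : IsTheta q 0 1 g) :
    ∃ K, ∀ z, z ≠ 0 → g z = K := by
  obtain ⟨K, s, hs, hK⟩ := hg.degree_zero h0 h1 one_ne_zero
  have : s = 0 := by
    rw [norm_one, Real.rpow_def_of_pos h0, eq_comm, Real.exp_eq_one_iff] at hs
    exact (mul_eq_zero.mp hs).resolve_left (Real.log_neg h0 h1).ne
  refine ⟨K, fun z hz => ?_⟩
  have := hK (Complex.log z)
  rw [Complex.exp_log hz] at this
  simpa [‹s = 0›] using this

/-- A nonzero g is K z^s; being single-valued it has an integral exponent, and then the multiplier l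
is an integral power of q, where θ_q vanishes. -/
theorem IsTheta.eq_zero (h0 : 0 < q) (h1 : q < 1) {l : ℂ} (hl : l ≠ 0) (hl' : qTheta q l ≠ 0)
    (hg : IsTheta q 0 l g) {z : ℂ} (hz : z ≠ 0) : g z = 0 := by
  obtain ⟨K, s, hs, hK⟩ := hg.degree_zero h0 h1 hl
  by_cases hK0 : K = 0
  · have := hK (Complex.log z)
    rwa [Complex.exp_log hz, hK0, zero_mul] at this
  exfalso
  have h2 := hK (2 * Real.pi * Complex.I)
  rw [Complex.exp_two_pi_mul_I] at h2
  have h3 := hK 0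
  rw [Complex.exp_zero] at h3
  have h4 : Complex.exp (s * (2 * Real.pi * Complex.I)) = 1 := by
    have : K * Complex.exp (s * (2 * Real.pi * Complex.I)) = K * 1 := by
      rw [← h2, h3]; simp
    exact mul_left_cancel₀ hK0 this
  obtain ⟨k, hk⟩ := Complex.exp_eq_one_iff.mp h4
  have hsk : (s : ℂ) = k := mul_right_cancel₀ Complex.two_pi_I_ne_zero hk
  have hg1 : g 1 = K := by rw [h3]; simp
  have hgq := hg.qdiff 1 one_ne_zero
  have h5 := hK (Real.log q)
  rw [← Complex.ofReal_exp, Real.exp_log h0, hsk] at h5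
  rw [mul_one, pow_zero, mul_one, hg1, h5, mul_comm K] at hgq
  have h6 := mul_right_cancel₀ hK0 hgq
  rw [Complex.exp_int_mul, ← Complex.ofReal_exp, Real.exp_log h0] at h6
  exact hl' (h6 ▸ qTheta_zpow h0 h1 k)

/-- A quasi-periodic function of degree `n` with `n` distinct zeros. -/
theorem IsTheta.exists_prod (h0 : 0 < q) (h1 : q < 1) :
    ∀ {n : ℕ} {c : ℂ} {f : ℂ → ℂ}, c ≠ 0 → IsTheta q n c f → ∀ p : Fin n → ℂ, (∀ i, p i ≠ 0) →
      (∀ i j, i ≠ j → qTheta q (p i / p j) ≠ 0) → (∀ i, f (p i) = 0) →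
      ∃ g, IsTheta q 0 (c / ∏ i, p i) g ∧ ∀ z, z ≠ 0 → f z = (∏ i, qTheta q (z / p i)) * g z := by
  intro n
  induction n with
  | zero =>
    intro c f hc hf p _ _ _
    exact ⟨f, by simpa using hf, by simp⟩
  | succ n ih =>
    intro c f hc hf p hp hpp hfp
    obtain ⟨g, hg, hfg⟩ := hf.exists_div h0 h1 hc (hp 0) (hfp 0)
    obtain ⟨h, hh, hgh⟩ := ih (div_ne_zero hc (hp 0)) hg (fun i => p i.succ) (fun i => hp _)
      (fun i j hij => hpp _ _ (by simpa using hij)) (fun i => by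
        have := hfg (p i.succ) (hp _)
        rw [hfp] at this
        exact (mul_eq_zero.mp this.symm).resolve_left (hpp _ _ (Fin.succ_ne_zero i)))
    refine ⟨h, hh.congr_const ?_, fun z hz => ?_⟩
    · rw [Fin.prod_univ_succ, div_div]
    · rw [hfg z hz, hgh z hz, Fin.prod_univ_succ, mul_assoc]

/-- Dividing out n zeros leaves a function of degree zero with multiplier c / ∏ p_i. This is the
uniqueness half of Abel's theorem: the product of the zeros is determined modulo q^ℤ. -/
theorem IsTheta.eq_zero_of_zeros (h0 : 0 < q) (h1 : q < 1) (hc : c ≠ 0) (hf : IsTheta q n c f)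
    (p : Fin n → ℂ) (hp : ∀ i, p i ≠ 0) (hpp : ∀ i j, i ≠ j → qTheta q (p i / p j) ≠ 0)
    (hfp : ∀ i, f (p i) = 0) (hcp : qTheta q (c / ∏ i, p i) ≠ 0) {z : ℂ} (hz : z ≠ 0) :
    f z = 0 := by
  obtain ⟨g, hg, hfg⟩ := hf.exists_prod h0 h1 hc p hp hpp hfp
  rw [hfg z hz, hg.eq_zero h0 h1 (div_ne_zero hc (Finset.prod_ne_zero_iff.mpr fun i _ => hp i))
    hcp hz, mul_zero]

theorem qTheta_div_ne_zero_comm (h0 : 0 < q) (h1 : q < 1) {u v : ℂ} (hu : u ≠ 0) (hv : v ≠ 0)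
    (h : qTheta q (u / v) ≠ 0) : qTheta q (v / u) ≠ 0 := by
  rwa [← inv_div, Ne, qTheta_inv_eq_zero_iff h0 h1 (div_ne_zero hu hv)]

theorem IsTheta.eq_zero_of_two (h0 : 0 < q) (h1 : q < 1) (hc : c ≠ 0) (hf : IsTheta q 2 c f)
    {u v : ℂ} (hu : u ≠ 0) (hv : v ≠ 0) (huv : qTheta q (u / v) ≠ 0)
    (hfu : f u = 0) (hfv : f v = 0) (hcp : qTheta q (u * v / c) ≠ 0) {z : ℂ} (hz : z ≠ 0) :
    f z = 0 := by
  refine hf.eq_zero_of_zeros h0 h1 hc ![u, v] ?_ ?_ ?_ ?_ hz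
  · intro i; fin_cases i <;> assumption
  · intro i j hij
    fin_cases i <;> fin_cases j
    · exact absurd rfl hij
    · exact huv
    · exact qTheta_div_ne_zero_comm h0 h1 hu hv huv
    · exact absurd rfl hij
  · intro i; fin_cases i <;> assumption
  · simpa using qTheta_div_ne_zero_comm h0 h1 (mul_ne_zero hu hv) hc hcp

/-- Quasi-periodic functions of degree one. -/
theorem IsTheta.degree_one (h0 : 0 < q) (h1 : q < 1) (hc : c ≠ 0) (hf : IsTheta q 1 c f) :
    ∃ K, ∀ z, z ≠ 0 → f z = K * qTheta q (z / c) := by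
  have ht := isTheta_qTheta h0 h1 hc
  have hw : qTheta q (-c / c) ≠ 0 := by
    rw [neg_div, div_self hc]; exact qTheta_neg_one_ne_zero h0 h1
  -- The constant is matched at -c. A further zero there has c / (-c) = -1 as the remaining
  -- multiplier, which is not a power of q.
  refine ⟨f (-c) / qTheta q (-c / c), fun z hz => ?_⟩
  have := (hf.sub (ht.const_mul (f (-c) / qTheta q (-c / c)))).eq_zero_of_zeros h0 h1 hc
    ![-c] (by simpa using hc) (by intro i j hij; exact absurd (Subsingleton.elim i j) hij)
    (by intro i; fin_cases i; simp [hw])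
    (by simpa [neg_div, div_neg, hc] using qTheta_neg_one_ne_zero h0 h1) hz
  exact sub_eq_zero.mp this

/-- The product of the two zeros is c modulo q^ℤ, so one zero u forces the other one to be c / u. -/
theorem IsTheta.degree_two (h0 : 0 < q) (h1 : q < 1) (hc : c ≠ 0) (hf : IsTheta q 2 c f)
    {u : ℂ} (hu : u ≠ 0) (hfu : f u = 0) :
    ∃ K, ∀ z, z ≠ 0 → f z = K * (qTheta q (z / u) * qTheta q (z * u / c)) := by
  obtain ⟨g, hg, hfg⟩ := hf.exists_div h0 h1 hc hu hfu
  obtain ⟨K, hK⟩ := hg.degree_one h0 h1 (div_ne_zero hc hu)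
  refine ⟨K, fun z hz => ?_⟩
  rw [hfg z hz, hK z hz, div_div_eq_mul_div]; ring

/-- Analytic functions on the connected punctured plane have no zero divisors. This is what allows
common theta factors to be cancelled from identities. -/
theorem IsTheta.eq_zero_or_eq_zero {m : ℕ} {d : ℂ} (hf : IsTheta q n c f) (hg : IsTheta q m d g)
    (h : ∀ z, z ≠ 0 → f z * g z = 0) : (∀ z, z ≠ 0 → f z = 0) ∨ (∀ z, z ≠ 0 → g z = 0) :=
  AnalyticOnNhd.eq_zero_or_eq_zero_of_mul_eq_zero hf.analytic hg.analytic h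
    (isConnected_compl_singleton_of_one_lt_rank (by simp) 0).isPreconnected

end Theta

/-! ### Interpolation by quasi-periodic functions of degree two -/

section Theta

variable {q : ℝ}

/-- The function `θ_q(z / a)²`. -/
def thetaSq (q : ℝ) (a z : ℂ) : ℂ := qTheta q (z / a) * qTheta q (z / a)

theorem isTheta_thetaSq (h0 : 0 < q) (h1 : q < 1) {a : ℂ} (ha : a ≠ 0) :
    IsTheta q 2 (a * a) (thetaSq q a) :=
  (isTheta_qTheta h0 h1 ha).mul (isTheta_qTheta h0 h1 ha)

theorem isTheta_thetaSq_neg (h0 : 0 < q) (h1 : q < 1) {a : ℂ} (ha : a ≠ 0) :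
    IsTheta q 2 (a * a) (thetaSq q (-a)) :=
  (isTheta_thetaSq h0 h1 (neg_ne_zero.mpr ha)).congr_const (by ring)

theorem thetaSq_self (h0 : 0 < q) (h1 : q < 1) {a : ℂ} (ha : a ≠ 0) : thetaSq q a a = 0 := by
  rw [thetaSq, div_self ha, qTheta_one h0 h1, zero_mul]

theorem thetaSq_neg (a : ℂ) (ha : a ≠ 0) : thetaSq q a (-a) = qTheta q (-1) ^ 2 := by
  rw [thetaSq, neg_div, div_self ha, sq]

theorem thetaSq_neg' (a : ℂ) (ha : a ≠ 0) : thetaSq q (-a) a = qTheta q (-1) ^ 2 := by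
  rw [thetaSq, div_neg, div_self ha, sq]

theorem isTheta_mul_shift (h0 : 0 < q) (h1 : q < 1) {c v : ℂ} (hc : c ≠ 0) (hv : v ≠ 0) :
    IsTheta q 2 c (fun z => qTheta q (z / v) * qTheta q (z * v / c)) := by
  have := (isTheta_qTheta h0 h1 hv).mul (isTheta_qTheta h0 h1 (div_ne_zero hc hv))
  simp only [div_div_eq_mul_div] at this
  exact this.congr_const (by field_simp)

/-- The points a and -a determine functions with multiplier a²: both their quotient and their
product divided by a² are -1. -/
theorem IsTheta.eq_zero_of_pm (h0 : 0 < q) (h1 : q < 1) {a : ℂ} (ha : a ≠ 0) {f : ℂ → ℂ}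
    (hf : IsTheta q 2 (a * a) f) (hfa : f a = 0) (hfa' : f (-a) = 0) {z : ℂ} (hz : z ≠ 0) :
    f z = 0 := by
  have h := qTheta_neg_one_ne_zero h0 h1
  refine hf.eq_zero_of_two h0 h1 (mul_ne_zero ha ha) ha (neg_ne_zero.mpr ha) ?_ hfa hfa' ?_ hz
  · rwa [div_neg, div_self ha]
  · rwa [mul_neg, neg_div, div_self (mul_ne_zero ha ha)]

/-- As functions of u both sides have degree two and multiplier a², so they need only be compared at
u = ±a. The identity turns the minors of the interpolation matrix into products of theta functions.
-/
theorem thetaSq_wronskian (h0 : 0 < q) (h1 : q < 1) {a : ℂ} (ha : a ≠ 0) {u v : ℂ} (hu : u ≠ 0)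
    (hv : v ≠ 0) :
    thetaSq q a u * thetaSq q (-a) v - thetaSq q a v * thetaSq q (-a) u =
      qTheta q (-1) ^ 2 / a * (v * (qTheta q (u / v) * qTheta q (u * v / (a * a)))) := by
  have hF := (((isTheta_thetaSq h0 h1 ha).const_mul (thetaSq q (-a) v)).sub
    ((isTheta_thetaSq_neg h0 h1 ha).const_mul (thetaSq q a v))).sub
    ((isTheta_mul_shift h0 h1 (mul_ne_zero ha ha) hv).const_mul (qTheta q (-1) ^ 2 / a * v))
  have i1 := qTheta_inv h0 h1 (div_ne_zero hv ha)
  have i2 := qTheta_inv h0 h1 (div_ne_zero hv (neg_ne_zero.mpr ha))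
  rw [inv_div] at i1 i2
  have := hF.eq_zero_of_pm h0 h1 ha ?_ ?_ hu
  · linear_combination this
  · rw [thetaSq_self h0 h1 ha, thetaSq_neg' a ha, mul_div_mul_left _ _ ha]
    simp only [thetaSq]
    field_simp at i1 ⊢
    linear_combination -qTheta q (v / a) * qTheta q (-1) ^ 2 * i1
  · rw [thetaSq_neg a ha, thetaSq_self h0 h1 (neg_ne_zero.mpr ha),
      show -a * v / (a * a) = v / -a by field_simp]
    simp only [thetaSq]
    field_simp at i2 ⊢
    linear_combination qTheta q (-(v / a)) * qTheta q (-1) ^ 2 * i2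

/-- Of the two squares one vanishes at a and the other at -a, so the coefficients are read off from
the values at -a and a. -/
theorem IsTheta.degree_two_basis (h0 : 0 < q) (h1 : q < 1) {a : ℂ} (ha : a ≠ 0) {f : ℂ → ℂ}
    (hf : IsTheta q 2 (a * a) f) :
    ∃ K L, ∀ z, z ≠ 0 → f z = K * thetaSq q a z + L * thetaSq q (-a) z := by
  have h := qTheta_neg_one_ne_zero h0 h1
  have hF := hf.sub (((isTheta_thetaSq h0 h1 ha).const_mul (f (-a) / qTheta q (-1) ^ 2)).add
    ((isTheta_thetaSq_neg h0 h1 ha).const_mul (f a / qTheta q (-1) ^ 2)))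
  refine ⟨_, _, fun z hz => sub_eq_zero.mp (hF.eq_zero_of_pm h0 h1 ha ?_ ?_ hz)⟩
  · rw [thetaSq_self h0 h1 ha, thetaSq_neg' a ha]; field_simp; ring
  · rw [thetaSq_self h0 h1 (neg_ne_zero.mpr ha), thetaSq_neg a ha]; field_simp; ring

/-- Laplace expansion along the first two columns against the last two: the six choices of two rows
for the last two columns correspond to the six pairs. -/
theorem det_interpolation (p p' u u' : Fin 4 → ℂ) (r : Fin 4 → Fin 2 → ℂ) :
    (Matrix.of fun j : Fin 4 => ![r j 1 * p j, r j 1 * p' j, -(r j 0 * u j), -(r j 0 * u' j)]).det =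
      ∑ i, ![(p 2 * p' 3 - p 3 * p' 2) * (u 0 * u' 1 - u 1 * u' 0),
        -((p 1 * p' 3 - p 3 * p' 1) * (u 0 * u' 2 - u 2 * u' 0)),
        (p 1 * p' 2 - p 2 * p' 1) * (u 0 * u' 3 - u 3 * u' 0),
        (p 0 * p' 3 - p 3 * p' 0) * (u 1 * u' 2 - u 2 * u' 1),
        -((p 0 * p' 2 - p 2 * p' 0) * (u 1 * u' 3 - u 3 * u' 1)),
        (p 0 * p' 1 - p 1 * p' 0) * (u 2 * u' 3 - u 3 * u' 2)] i * mono r i := by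
  rw [Fin.sum_univ_six]
  simp [Matrix.det_succ_row_zero, Fin.sum_univ_succ, mono, Fin.succAbove]
  ring

/-- The coefficients of the interpolation determinant. -/
def interpCoeff (q : ℝ) (x : Fin 4 → ℂ) (c d : ℂ) : Fin 6 → ℂ :=
  let w (c : ℂ) (k l : Fin 4) : ℂ := x l * (qTheta q (x k / x l) * qTheta q (x k * x l / c))
  ![w c 2 3 * w d 0 1, -(w c 1 3 * w d 0 2), w c 1 2 * w d 0 3, w c 0 3 * w d 1 2,
    -(w c 0 2 * w d 1 3), w c 0 1 * w d 2 3]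

/-- A nonzero row of two quasi-periodic functions of degree two which has the values `r j` (up to
factors) at the points `x j`. -/
def HasInterpolant (q : ℝ) (x : Fin 4 → ℂ) (c : Fin 2 → ℂ) (r : Fin 4 → Fin 2 → ℂ) : Prop :=
  ∃ f : Fin 2 → ℂ → ℂ, (∀ d, IsTheta q 2 (c d) (f d)) ∧ (∃ z d, z ≠ 0 ∧ f d z ≠ 0) ∧
    ∀ j, r j 1 * f 0 (x j) = r j 0 * f 1 (x j)

/-- In the bases of squares of theta functions a row has four coefficients, and the four conditions
at the x_j form a homogeneous linear system. Its determinant is computed by `det_interpolation` and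
`thetaSq_wronskian`. -/
theorem hasInterpolant_iff (h0 : 0 < q) (h1 : q < 1) {x : Fin 4 → ℂ} (hx : ∀ j, x j ≠ 0)
    {c : Fin 2 → ℂ} (hc : ∀ d, c d ≠ 0) (r : Fin 4 → Fin 2 → ℂ) :
    HasInterpolant q x c r ↔ ∑ i, interpCoeff q x (c 0) (c 1) i * mono r i = 0 := by
  have hm := qTheta_neg_one_ne_zero h0 h1
  obtain ⟨a, ha⟩ : ∃ a : Fin 2 → ℂ, ∀ d, c d = a d * a d :=
    ⟨fun d => (IsAlgClosed.exists_pow_nat_eq (c d) (n := 2) (by norm_num)).choose, fun d => by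
      have := (IsAlgClosed.exists_pow_nat_eq (c d) (n := 2) (by norm_num)).choose_spec
      rw [← sq]; exact this.symm⟩
  have ha0 : ∀ d, a d ≠ 0 := fun d h => hc d (by rw [ha d, h, zero_mul])
  set M : Matrix (Fin 4) (Fin 4) ℂ := Matrix.of fun j : Fin 4 =>
    ![r j 1 * thetaSq q (a 0) (x j), r j 1 * thetaSq q (-a 0) (x j),
      -(r j 0 * thetaSq q (a 1) (x j)), -(r j 0 * thetaSq q (-a 1) (x j))] with hM
  have hdet : M.det = qTheta q (-1) ^ 2 / a 0 * (qTheta q (-1) ^ 2 / a 1) *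
      ∑ i, interpCoeff q x (c 0) (c 1) i * mono r i := by
    rw [hM, det_interpolation (fun j => thetaSq q (a 0) (x j)) (fun j => thetaSq q (-a 0) (x j))
      (fun j => thetaSq q (a 1) (x j)) (fun j => thetaSq q (-a 1) (x j)), Finset.mul_sum]
    refine Finset.sum_congr rfl fun i _ => ?_
    rw [← mul_assoc]
    congr 1
    fin_cases i <;> simp [interpCoeff, thetaSq_wronskian h0 h1 (ha0 0) (hx _) (hx _),
      thetaSq_wronskian h0 h1 (ha0 1) (hx _) (hx _), ha] <;> ring
  have hmv : ∀ v : Fin 4 → ℂ, ∀ j, (M.mulVec v) j =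
      r j 1 * (v 0 * thetaSq q (a 0) (x j) + v 1 * thetaSq q (-a 0) (x j)) -
      r j 0 * (v 2 * thetaSq q (a 1) (x j) + v 3 * thetaSq q (-a 1) (x j)) := by
    intro v j
    simp [hM, Matrix.mulVec, dotProduct, Fin.sum_univ_four]
    ring
  have hS : (∑ i, interpCoeff q x (c 0) (c 1) i * mono r i = 0) ↔ M.det = 0 := by
    rw [hdet, mul_eq_zero, or_iff_right]
    exact mul_ne_zero (div_ne_zero (pow_ne_zero _ hm) (ha0 0))
      (div_ne_zero (pow_ne_zero _ hm) (ha0 1))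
  rw [hS, ← Matrix.exists_mulVec_eq_zero_iff]
  constructor
  · rintro ⟨f, hf, ⟨z, d, hz, hfz⟩, hr⟩
    obtain ⟨K0, L0, e0⟩ := ((hf 0).congr_const (ha 0)).degree_two_basis h0 h1 (ha0 0)
    obtain ⟨K1, L1, e1⟩ := ((hf 1).congr_const (ha 1)).degree_two_basis h0 h1 (ha0 1)
    refine ⟨![K0, L0, K1, L1], fun h => hfz ?_, ?_⟩
    · have k0 := congrFun h 0
      have k1 := congrFun h 1
      have k2 := congrFun h 2
      have k3 := congrFun h 3
      simp at k0 k1 k2 k3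
      fin_cases d
      · simp only [Fin.zero_eta]; rw [e0 z hz, k0, k1]; simp
      · simp only [Fin.mk_one]; rw [e1 z hz, k2, k3]; simp
    · funext j
      rw [hmv]
      have := hr j
      rw [e0 _ (hx j), e1 _ (hx j)] at this
      simp
      linear_combination this
  · rintro ⟨v, hv, hMv⟩
    refine ⟨![fun z => v 0 * thetaSq q (a 0) z + v 1 * thetaSq q (-a 0) z,
      fun z => v 2 * thetaSq q (a 1) z + v 3 * thetaSq q (-a 1) z], ?_, ?_, ?_⟩
    · intro d
      fin_cases d
      · exact (((isTheta_thetaSq h0 h1 (ha0 0)).const_mul _).add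
          ((isTheta_thetaSq_neg h0 h1 (ha0 0)).const_mul _)).congr_const (ha 0).symm
      · exact (((isTheta_thetaSq h0 h1 (ha0 1)).const_mul _).add
          ((isTheta_thetaSq_neg h0 h1 (ha0 1)).const_mul _)).congr_const (ha 1).symm
    -- Evaluation at ±a_d isolates each of the four coefficients.
    · by_contra! hcon
      apply hv
      have e1 := fun d => hcon (a d) d (ha0 d)
      have e2 := fun d => hcon (-a d) d (neg_ne_zero.mpr (ha0 d))
      have s1 := fun d => thetaSq_self h0 h1 (ha0 d)
      have s2 := fun d => thetaSq_self h0 h1 (neg_ne_zero.mpr (ha0 d))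
      have s3 := fun d => thetaSq_neg (q := q) (a d) (ha0 d)
      have s4 := fun d => thetaSq_neg' (q := q) (a d) (ha0 d)
      have a0 := e1 0
      have a1 := e1 1
      have b0 := e2 0
      have b1 := e2 1
      simp [s1, s2, s3, s4, hm] at a0 a1 b0 b1
      funext i
      fin_cases i <;> assumption
    · intro j
      have := congrFun hMv j
      rw [hmv] at this
      simpa using sub_eq_zero.mp this

end Theta

/-! ### Exponents -/

theorem neg_mem_lattice {q : ℝ} {X : ℂ} : -X ∈ lattice q ↔ X ∈ lattice q := by
  have : ∀ {Y : ℂ}, Y ∈ lattice q → -Y ∈ lattice q := by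
    rintro Y ⟨m, n, rfl⟩
    exact ⟨-m, -n, by push_cast; ring⟩
  exact ⟨fun h => by simpa using this h, this⟩

theorem neg_mem_signs {e : ℂ} (h : e ∈ signs) : -e ∈ signs := by
  rcases h with rfl | h
  · exact Or.inr rfl
  · rw [Set.mem_singleton_iff.mp h, neg_neg]; exact Or.inl rfl

theorem one_mem_signs : (1 : ℂ) ∈ signs := Or.inl rfl

theorem neg_one_mem_signs : (-1 : ℂ) ∈ signs := Or.inr rfl

namespace Params

variable (P : Params)

theorem pow_add (h0 : 0 < P.q) (X Y : ℂ) : P.pow (X + Y) = P.pow X * P.pow Y :=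
  Complex.cpow_add _ _ (ofReal_ne_zero' h0)

theorem pow_ne_zero (h0 : 0 < P.q) (X : ℂ) : P.pow X ≠ 0 := by
  simp [pow, Complex.cpow_eq_zero_iff, h0.ne']

theorem pow_zero : P.pow 0 = 1 := Complex.cpow_zero _

theorem pow_neg (X : ℂ) : P.pow (-X) = (P.pow X)⁻¹ := Complex.cpow_neg _ _

theorem pow_sub (h0 : 0 < P.q) (X Y : ℂ) : P.pow (X - Y) = P.pow X / P.pow Y :=
  Complex.cpow_sub _ _ (ofReal_ne_zero' h0)

theorem th_pow (X : ℂ) : P.th (P.pow X) = P.vt X := rfl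

/-- The exponent of `t₀`. -/
def kap : ℂ := Complex.log P.t0 / (Real.log P.q : ℂ)

/-- The exponents of the points `x_k`. -/
def xi : Fin 4 → ℂ := ![P.θt + P.kap, -P.θt + P.kap, P.θ1, -P.θ1]

/-- The pair of signs `(1, -1)`. -/
def _root_.QPVI.sg : Fin 2 → ℂ := ![1, -1]

/-- The exponents of the multipliers of a row. -/
def nu (s : ℂ) (d : Fin 2) : ℂ := P.kap + s + sg d * P.θi

/-- The multipliers of a row. -/
def mu (s : ℂ) (d : Fin 2) : ℂ := P.pow (P.nu s d)

theorem log_q_ne_zero (h0 : 0 < P.q) (h1 : P.q < 1) : (Real.log P.q : ℂ) ≠ 0 := by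
  exact_mod_cast (Real.log_neg h0 h1).ne

theorem pow_eq_exp (h0 : 0 < P.q) (X : ℂ) : P.pow X = Complex.exp (Real.log P.q * X) := by
  rw [pow, Complex.cpow_def_of_ne_zero (ofReal_ne_zero' h0), Complex.ofReal_log h0.le]

theorem pow_kap (h0 : 0 < P.q) (h1 : P.q < 1) (ht : P.t0 ≠ 0) : P.pow P.kap = P.t0 := by
  rw [pow_eq_exp P h0, kap, mul_div_cancel₀ _ (P.log_q_ne_zero h0 h1), Complex.exp_log ht]

theorem x_eq (h0 : 0 < P.q) (h1 : P.q < 1) (ht : P.t0 ≠ 0) (j : Fin 4) :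
    P.x j = P.pow (P.xi j) := by
  fin_cases j <;> simp [x, xi, P.pow_add h0, P.pow_kap h0 h1 ht]

/-- The exponential has period 2πi, so q^X determines X up to multiples of τ; together with integral
shifts of the exponent this is Λ_τ. -/
theorem pow_eq_zpow_iff (h0 : 0 < P.q) (h1 : P.q < 1) (X : ℂ) :
    (∃ n : ℤ, P.pow X = (P.q : ℂ) ^ n) ↔ X ∈ lattice P.q := by
  have hl := P.log_q_ne_zero h0 h1
  have key : ∀ n : ℤ, (P.q : ℂ) ^ n = Complex.exp (Real.log P.q * n) := by
    intro n
    rw [← P.pow_eq_exp h0, pow, Complex.cpow_intCast]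
  constructor
  · rintro ⟨n, hn⟩
    rw [key, P.pow_eq_exp h0, Complex.exp_eq_exp_iff_exists_int] at hn
    obtain ⟨k, hk⟩ := hn
    refine ⟨n, -k, ?_⟩
    rw [tau]
    push_cast
    field_simp
    linear_combination hk
  · rintro ⟨m, n, rfl⟩
    refine ⟨m, ?_⟩
    rw [key, P.pow_eq_exp h0, Complex.exp_eq_exp_iff_exists_int]
    refine ⟨-n, ?_⟩
    rw [tau]
    push_cast
    field_simp

theorem vt_eq_zero_iff (h0 : 0 < P.q) (h1 : P.q < 1) (X : ℂ) :
    P.vt X = 0 ↔ X ∈ lattice P.q := by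
  rw [← P.pow_eq_zpow_iff h0 h1, ← P.th_pow, th, qTheta_eq_zero_iff h0 h1 (P.pow_ne_zero h0 X)]

/-- Since t₀ = q^κ with κ = `kap`, the conditions on spirals become conditions modulo Λ_τ, like the
other assumptions. -/
theorem kap_sub_notMem (h0 : 0 < P.q) (h1 : P.q < 1) (ht : P.t0 ≠ 0) {s : ℂ}
    (h : P.t0 ∉ qSpiral P.q s) : P.kap - s ∉ lattice P.q := by
  intro hk
  apply h
  obtain ⟨n, hn⟩ := (P.pow_eq_zpow_iff h0 h1 _).mpr hk
  refine ⟨n, ?_⟩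
  rw [P.pow_sub h0, P.pow_kap h0 h1 ht, div_eq_iff (P.pow_ne_zero h0 s)] at hn
  rw [hn, Complex.cpow_add _ _ (ofReal_ne_zero' h0), Complex.cpow_intCast]
  rfl

theorem vt_neg (h0 : 0 < P.q) (h1 : P.q < 1) (X : ℂ) :
    P.vt (-X) = -(P.pow (-X) * P.vt X) := by
  have := qTheta_inv h0 h1 (P.pow_ne_zero h0 X)
  rw [← P.th_pow, ← P.th_pow, P.pow_neg, th, th]
  have hne := P.pow_ne_zero h0 X
  apply mul_right_cancel₀ hne
  rw [this, neg_mul, mul_right_comm, inv_mul_cancel₀ hne, one_mul]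

theorem vt_ne_zero_of_eq (h0 : 0 < P.q) (h1 : P.q < 1) {X : ℂ} (Y : ℂ)
    (hY : Y ∉ lattice P.q) (h : X = Y) : P.vt X ≠ 0 := by
  rw [Ne, P.vt_eq_zero_iff h0 h1, h]; exact hY

theorem vt_ne_zero_of_neg (h0 : 0 < P.q) (h1 : P.q < 1) {X : ℂ} (Y : ℂ)
    (hY : Y ∉ lattice P.q) (h : X = -Y) : P.vt X ≠ 0 := by
  rw [Ne, P.vt_eq_zero_iff h0 h1, h, neg_mem_lattice]; exact hY

theorem vt_neg_ne_zero (h0 : 0 < P.q) (h1 : P.q < 1) {X : ℂ} (h : P.vt X ≠ 0) :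
    P.vt (-X) ≠ 0 :=
  P.vt_ne_zero_of_neg h0 h1 X (by rwa [← P.vt_eq_zero_iff h0 h1]) rfl

/-! ### Theta factors that the standing assumptions make nonzero -/

namespace Admissible

variable {P} (hP : P.Admissible)

include hP

theorem kap_t1 {et e1 : ℂ} (ht : et ∈ signs) (h1 : e1 ∈ signs) :
    P.kap - (et * P.θt + e1 * P.θ1) ∉ lattice P.q :=
  P.kap_sub_notMem hP.q_pos hP.q_lt_one hP.t0_ne_zero (hP.t0_t1 et ht e1 h1)

theorem kap_0i {e0 ei : ℂ} (h0 : e0 ∈ signs) (hi : ei ∈ signs) :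
    P.kap - (e0 * P.θ0 + ei * P.θi) ∉ lattice P.q :=
  P.kap_sub_notMem hP.q_pos hP.q_lt_one hP.t0_ne_zero (hP.t0_0i e0 h0 ei hi)

/-- The points x_k are different modulo q^ℤ: the differences of exponents are 2θ_t, 2θ₁ and κ ± θ_t
± θ₁. -/
theorem vt_xi_sub_lt {i j : Fin 4} (hij : i < j) : P.vt (P.xi i - P.xi j) ≠ 0 := by
  have H := fun {X : ℂ} => P.vt_ne_zero_of_eq hP.q_pos hP.q_lt_one (X := X)
  have s1 := one_mem_signs
  have s2 := neg_one_mem_signs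
  fin_cases i <;> fin_cases j <;> first | exact absurd hij (by decide) | skip
  · exact H _ hP.two_θt (by simp [xi]; ring)
  · exact H _ (hP.kap_t1 s2 s1) (by simp [xi]; ring)
  · exact H _ (hP.kap_t1 s2 s2) (by simp [xi]; ring)
  · exact H _ (hP.kap_t1 s1 s1) (by simp [xi]; ring)
  · exact H _ (hP.kap_t1 s1 s2) (by simp [xi]; ring)
  · exact H _ hP.two_θ1 (by simp [xi]; ring)

theorem vt_xi_sub {i j : Fin 4} (hij : i ≠ j) : P.vt (P.xi i - P.xi j) ≠ 0 := by
  rcases lt_or_gt_of_ne hij with h | h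
  · exact hP.vt_xi_sub_lt h
  · rw [← neg_sub]
    exact P.vt_neg_ne_zero hP.q_pos hP.q_lt_one (hP.vt_xi_sub_lt h)

/-- This keeps x_i x_j apart from the multipliers of the rows, so that an entry with zeros at both
x_i and x_j is identically zero. The pairs 12 and 34 use the condition on t₀, the mixed pairs the
condition on ±θ₀ ± θ_t ± θ₁ ± θ_∞. -/
theorem vt_xi_add_lt {i j : Fin 4} (hij : i < j) {e ei : ℂ} (he : e ∈ signs) (hi : ei ∈ signs) :
    P.vt (P.xi i + P.xi j - (P.kap + e * P.θ0 + ei * P.θi)) ≠ 0 := by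
  have H := fun {X : ℂ} => P.vt_ne_zero_of_eq hP.q_pos hP.q_lt_one (X := X)
  have H' := fun {X : ℂ} => P.vt_ne_zero_of_neg hP.q_pos hP.q_lt_one (X := X)
  have s1 := one_mem_signs
  have s2 := neg_one_mem_signs
  have he' := neg_mem_signs he
  have hi' := neg_mem_signs hi
  fin_cases i <;> fin_cases j <;> first | exact absurd hij (by decide) | skip
  · exact H _ (hP.kap_0i he hi) (by simp [xi]; ring)
  · exact H _ (hP.sum_θ _ he' _ s1 _ s1 _ hi') (by simp [xi]; ring)
  · exact H _ (hP.sum_θ _ he' _ s1 _ s2 _ hi') (by simp [xi]; ring)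
  · exact H _ (hP.sum_θ _ he' _ s2 _ s1 _ hi') (by simp [xi]; ring)
  · exact H _ (hP.sum_θ _ he' _ s2 _ s2 _ hi') (by simp [xi]; ring)
  · exact H' _ (hP.kap_0i he' hi') (by simp [xi]; ring)

theorem vt_xi_add {i j : Fin 4} (hij : i ≠ j) {e ei : ℂ} (he : e ∈ signs) (hi : ei ∈ signs) :
    P.vt (P.xi i + P.xi j - (P.kap + e * P.θ0 + ei * P.θi)) ≠ 0 := by
  rcases lt_or_gt_of_ne hij with h | h
  · exact hP.vt_xi_add_lt h he hi
  · rw [add_comm (P.xi i)]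
    exact hP.vt_xi_add_lt h he hi

theorem vt_two_θ0 {e : ℂ} (he : e ∈ signs) : P.vt (e * (2 * P.θ0)) ≠ 0 := by
  rcases he with rfl | h
  · exact P.vt_ne_zero_of_eq hP.q_pos hP.q_lt_one _ hP.two_θ0 (by ring)
  · rw [Set.mem_singleton_iff.mp h]
    exact P.vt_ne_zero_of_neg hP.q_pos hP.q_lt_one _ hP.two_θ0 (by ring)

theorem vt_two_θi {e : ℂ} (he : e ∈ signs) : P.vt (e * (2 * P.θi)) ≠ 0 := by
  rcases he with rfl | h
  · exact P.vt_ne_zero_of_eq hP.q_pos hP.q_lt_one _ hP.two_θi (by ring)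
  · rw [Set.mem_singleton_iff.mp h]
    exact P.vt_ne_zero_of_neg hP.q_pos hP.q_lt_one _ hP.two_θi (by ring)

theorem vt_θ0 {e : ℂ} (he : e ∈ signs) : P.vt (e * P.θ0) ≠ 0 := by
  have hm : P.θ0 ∉ lattice P.q := by
    rintro ⟨m, n, h⟩
    exact hP.two_θ0 ⟨2 * m, 2 * n, by rw [h]; push_cast; ring⟩
  rcases he with rfl | h
  · exact P.vt_ne_zero_of_eq hP.q_pos hP.q_lt_one _ hm (by ring)
  · rw [Set.mem_singleton_iff.mp h]
    exact P.vt_ne_zero_of_neg hP.q_pos hP.q_lt_one _ hm (by ring)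

end Admissible

/-! ### Theta factors that the additional conditions make nonzero -/

namespace FinitenessConditions

variable {P} (hP : P.Admissible) (hF : P.FinitenessConditions)

include hP hF

theorem vt_xi_sub_θi {i j : Fin 4} (hij : i ≠ j) {e : ℂ} (he : e ∈ signs) :
    P.vt (P.xi i - P.xi j + e * (2 * P.θi)) ≠ 0 := by
  wlog h : i < j generalizing i j e
  · have := P.vt_neg_ne_zero hP.q_pos hP.q_lt_one
      (this hij.symm (neg_mem_signs he) (lt_of_le_of_ne (not_lt.mp h) hij.symm))
    convert this using 2; ring
  have H := fun {X : ℂ} => P.vt_ne_zero_of_eq hP.q_pos hP.q_lt_one (X := X)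
  have H' := fun {X : ℂ} => P.vt_ne_zero_of_neg hP.q_pos hP.q_lt_one (X := X)
  have s1 := one_mem_signs
  have s2 := neg_one_mem_signs
  have K := fun {s : ℂ} => P.kap_sub_notMem hP.q_pos hP.q_lt_one hP.t0_ne_zero (s := s)
  have he' := neg_mem_signs he
  fin_cases i <;> fin_cases j <;> first | exact absurd h (by decide) | skip
  · rcases he with rfl | he
    · exact H _ (hF.θi_θt _ s1) (by simp [xi]; ring)
    · rw [Set.mem_singleton_iff.mp he]
      exact H' _ (hF.θi_θt _ s2) (by simp [xi]; ring)
  · exact H _ (K (hF.t0_t1i _ s2 _ s1 _ he')) (by simp [xi]; ring)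
  · exact H _ (K (hF.t0_t1i _ s2 _ s2 _ he')) (by simp [xi]; ring)
  · exact H _ (K (hF.t0_t1i _ s1 _ s1 _ he')) (by simp [xi]; ring)
  · exact H _ (K (hF.t0_t1i _ s1 _ s2 _ he')) (by simp [xi]; ring)
  · rcases he with rfl | he
    · exact H _ (hF.θi_θ1 _ s1) (by simp [xi]; ring)
    · rw [Set.mem_singleton_iff.mp he]
      exact H' _ (hF.θi_θ1 _ s2) (by simp [xi]; ring)

theorem vt_xi_sub_θ0 {i j : Fin 4} (hij : i ≠ j) {e : ℂ} (he : e ∈ signs) :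
    P.vt (P.xi i - P.xi j + e * (2 * P.θ0)) ≠ 0 := by
  wlog h : i < j generalizing i j e
  · have := P.vt_neg_ne_zero hP.q_pos hP.q_lt_one
      (this hij.symm (neg_mem_signs he) (lt_of_le_of_ne (not_lt.mp h) hij.symm))
    convert this using 2; ring
  have H := fun {X : ℂ} => P.vt_ne_zero_of_eq hP.q_pos hP.q_lt_one (X := X)
  have H' := fun {X : ℂ} => P.vt_ne_zero_of_neg hP.q_pos hP.q_lt_one (X := X)
  have s1 := one_mem_signs
  have s2 := neg_one_mem_signs
  have K := fun {s : ℂ} => P.kap_sub_notMem hP.q_pos hP.q_lt_one hP.t0_ne_zero (s := s)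
  have he' := neg_mem_signs he
  fin_cases i <;> fin_cases j <;> first | exact absurd h (by decide) | skip
  · rcases he with rfl | he
    · exact H _ (hF.θ0_θt _ s1) (by simp [xi]; ring)
    · rw [Set.mem_singleton_iff.mp he]
      exact H' _ (hF.θ0_θt _ s2) (by simp [xi]; ring)
  · exact H _ (K (hF.t0_t10 _ s2 _ s1 _ he')) (by simp [xi]; ring)
  · exact H _ (K (hF.t0_t10 _ s2 _ s2 _ he')) (by simp [xi]; ring)
  · exact H _ (K (hF.t0_t10 _ s1 _ s1 _ he')) (by simp [xi]; ring)
  · exact H _ (K (hF.t0_t10 _ s1 _ s2 _ he')) (by simp [xi]; ring)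
  · rcases he with rfl | he
    · exact H _ (hF.θ0_θ1 _ s1) (by simp [xi]; ring)
    · rw [Set.mem_singleton_iff.mp he]
      exact H' _ (hF.θ0_θ1 _ s2) (by simp [xi]; ring)

/-- The diagonal counterpart i = j of `Admissible.vt_xi_add`; it decides where a row that vanishes
at x_k has its second zero. -/
theorem vt_two_xi (k : Fin 4) {e ei : ℂ} (he : e ∈ signs) (hi : ei ∈ signs) :
    P.vt (P.xi k + P.xi k - (P.kap + e * P.θ0 + ei * P.θi)) ≠ 0 := by
  have H := fun {X : ℂ} => P.vt_ne_zero_of_eq hP.q_pos hP.q_lt_one (X := X)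
  have H' := fun {X : ℂ} => P.vt_ne_zero_of_neg hP.q_pos hP.q_lt_one (X := X)
  have s1 := one_mem_signs
  have s2 := neg_one_mem_signs
  have K := fun {s : ℂ} => P.kap_sub_notMem hP.q_pos hP.q_lt_one hP.t0_ne_zero (s := s)
  have he' := neg_mem_signs he
  have hi' := neg_mem_signs hi
  fin_cases k
  · exact H _ (K (hF.t0_0it _ he _ hi _ s2)) (by simp [xi]; ring)
  · exact H _ (K (hF.t0_0it _ he _ hi _ s1)) (by simp [xi]; ring)
  · exact H' _ (K (hF.t0_0i1 _ he' _ hi' _ s1)) (by simp [xi]; ring)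
  · exact H' _ (K (hF.t0_0i1 _ he' _ hi' _ s2)) (by simp [xi]; ring)

end FinitenessConditions

end Params
-- The coefficients T_ij as coefficients of the interpolation determinant
namespace Params

variable (P : Params)

/-- The coefficients `T_{ij}` with `θ₀` replaced by `s`. -/
def Tat (s : ℂ) : Fin 6 → ℂ := T { P with θ0 := s }

theorem Tat_θ0 : P.Tat P.θ0 = P.T := rfl

theorem Tat_zero : P.Tat 0 = P.T' := rfl

theorem Tat_eq (s : ℂ) : P.Tat s =
  ![P.th (P.pow (s + P.θi) * P.t0) * P.th (P.pow (-s + P.θi) * P.t0) *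
      (P.vt (2 * P.θt) * P.vt (2 * P.θ1)),
    -(P.th (P.pow (P.θt - P.θ1) * P.t0) * P.th (P.pow (-P.θt + P.θ1) * P.t0) *
      (P.vt (s + P.θt + P.θ1 + P.θi) * P.vt (-s + P.θt + P.θ1 + P.θi))),
    P.th (P.pow (P.θt + P.θ1) * P.t0) * P.th (P.pow (-P.θt - P.θ1) * P.t0) *
      (P.vt (s + P.θt - P.θ1 + P.θi) * P.vt (-s + P.θt - P.θ1 + P.θi)) *
      P.pow (2 * P.θ1),
    P.th (P.pow (P.θt + P.θ1) * P.t0) * P.th (P.pow (-P.θt - P.θ1) * P.t0) *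
      (P.vt (s - P.θt + P.θ1 + P.θi) * P.vt (-s - P.θt + P.θ1 + P.θi)) *
      P.pow (2 * P.θt),
    -(P.th (P.pow (P.θt - P.θ1) * P.t0) * P.th (P.pow (-P.θt + P.θ1) * P.t0) *
      (P.vt (s - P.θt - P.θ1 + P.θi) * P.vt (-s - P.θt - P.θ1 + P.θi)) *
      P.pow (2 * P.θt + 2 * P.θ1)),
    P.th (P.pow (s - P.θi) * P.t0) * P.th (P.pow (-s - P.θi) * P.t0) *
      (P.vt (2 * P.θt) * P.vt (2 * P.θ1)) * P.pow (2 * P.θi)] := rfl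

/-- The sign change swaps the two theta factors that contain s. Therefore the rows with exponents θ₀
and -θ₀ have the same solvability condition. -/
theorem Tat_neg (s : ℂ) : P.Tat (-s) = P.Tat s := by
  funext p
  rw [Tat_eq, Tat_eq]
  fin_cases p <;> simp only [neg_neg, Matrix.cons_val, Fin.reduceFinMk] <;> ring

theorem th_pow_mul_t0 (h0 : 0 < P.q) (h1 : P.q < 1) (ht : P.t0 ≠ 0) (X : ℂ) :
    P.th (P.pow X * P.t0) = P.vt (X + P.kap) := by
  rw [← P.th_pow, P.pow_add h0, P.pow_kap h0 h1 ht]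

theorem th_div (h0 : 0 < P.q) (X Y : ℂ) : qTheta P.q (P.pow X / P.pow Y) = P.vt (X - Y) := by
  rw [← P.pow_sub h0]; rfl

theorem th_mul_div (h0 : 0 < P.q) (X Y Z : ℂ) :
    qTheta P.q (P.pow X * P.pow Y / P.pow Z) = P.vt (X + Y - Z) := by
  rw [← P.pow_add h0, ← P.pow_sub h0]; rfl

/-- Where the T_ij come from. The reflection ϑ(-X) = -q^(-X) ϑ(X) brings each term to the stated
form, and the powers of q that arise combine to one factor common to all pairs. -/
theorem interpCoeff_eq (h0 : 0 < P.q) (h1 : P.q < 1) (ht : P.t0 ≠ 0) (s : ℂ) (p : Fin 6) :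
    interpCoeff P.q P.x (P.mu s 0) (P.mu s 1) p =
      -P.pow (-(s + P.θt + P.θ1 + P.θi)) * P.Tat s p := by
  have N := P.vt_neg h0 h1
  have A := P.pow_add h0
  have TT := P.th_pow_mul_t0 h0 h1 ht
  fin_cases p <;>
    simp only [interpCoeff, Tat_eq, P.x_eq h0 h1 ht, mu, P.th_div h0, P.th_mul_div h0,
      Matrix.cons_val, xi, nu, sg, TT, Fin.reduceFinMk]
  · rw [show P.θ1 + -P.θ1 - (P.kap + s + 1 * P.θi) = -(s + P.θi + P.kap) by ring, N,
      show P.θ1 - -P.θ1 = 2 * P.θ1 by ring,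
      show P.θt + P.kap - (-P.θt + P.kap) = 2 * P.θt by ring,
      show P.θt + P.kap + (-P.θt + P.kap) - (P.kap + s + -1 * P.θi) = -s + P.θi + P.kap by ring]
    have e : P.pow (-P.θ1) * P.pow (-P.θt + P.kap) * P.pow (-(s + P.θi + P.kap)) =
        P.pow (-(s + P.θt + P.θ1 + P.θi)) := by rw [← A, ← A]; congr 1; ring
    rw [← e]; ring
  · rw [show -P.θt + P.kap + -P.θ1 - (P.kap + s + 1 * P.θi) = -(s + P.θt + P.θ1 + P.θi) by ring, N,
      show -P.θt + P.kap - -P.θ1 = -P.θt + P.θ1 + P.kap by ring,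
      show P.θt + P.kap - P.θ1 = P.θt - P.θ1 + P.kap by ring,
      show P.θt + P.kap + P.θ1 - (P.kap + s + -1 * P.θi) = -s + P.θt + P.θ1 + P.θi by ring]
    have e : P.pow (-P.θ1) * P.pow (P.θ1) = 1 := by
      rw [← A, neg_add_cancel, P.pow_zero]
    linear_combination P.vt (s + P.θt + P.θ1 + P.θi) * P.pow (-(s + P.θt + P.θ1 + P.θi)) *
      P.vt (-P.θt + P.θ1 + P.kap) * P.vt (P.θt - P.θ1 + P.kap) *
      P.vt (-s + P.θt + P.θ1 + P.θi) * e
  · rw [show -P.θt + P.kap + P.θ1 - (P.kap + s + 1 * P.θi) = -(s + P.θt - P.θ1 + P.θi) by ring, N,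
      show -P.θt + P.kap - P.θ1 = -P.θt - P.θ1 + P.kap by ring,
      show P.θt + P.kap - -P.θ1 = P.θt + P.θ1 + P.kap by ring,
      show P.θt + P.kap + -P.θ1 - (P.kap + s + -1 * P.θi) = -s + P.θt - P.θ1 + P.θi by ring]
    have e : P.pow P.θ1 * P.pow (-P.θ1) * P.pow (-(s + P.θt - P.θ1 + P.θi)) =
        P.pow (-(s + P.θt + P.θ1 + P.θi)) * P.pow (2 * P.θ1) := by
      rw [← A, ← A, ← A]; congr 1; ring
    linear_combination -P.vt (s + P.θt - P.θ1 + P.θi) * P.vt (-P.θt - P.θ1 + P.kap) *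
      P.vt (P.θt + P.θ1 + P.kap) * P.vt (-s + P.θt - P.θ1 + P.θi) * e
  · rw [show P.θt + P.kap + -P.θ1 - (P.kap + s + 1 * P.θi) = -(s - P.θt + P.θ1 + P.θi) by ring, N,
      show P.θt + P.kap - -P.θ1 = P.θt + P.θ1 + P.kap by ring,
      show -P.θt + P.kap - P.θ1 = -P.θt - P.θ1 + P.kap by ring,
      show -P.θt + P.kap + P.θ1 - (P.kap + s + -1 * P.θi) = -s - P.θt + P.θ1 + P.θi by ring]
    have e : P.pow P.θ1 * P.pow (-P.θ1) * P.pow (-(s - P.θt + P.θ1 + P.θi)) =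
        P.pow (-(s + P.θt + P.θ1 + P.θi)) * P.pow (2 * P.θt) := by
      rw [← A, ← A, ← A]; congr 1; ring
    linear_combination -P.vt (s - P.θt + P.θ1 + P.θi) * P.vt (-P.θt - P.θ1 + P.kap) *
      P.vt (P.θt + P.θ1 + P.kap) * P.vt (-s - P.θt + P.θ1 + P.θi) * e
  · rw [show P.θt + P.kap + P.θ1 - (P.kap + s + 1 * P.θi) = -(s - P.θt - P.θ1 + P.θi) by ring, N,
      show P.θt + P.kap - P.θ1 = P.θt - P.θ1 + P.kap by ring,
      show -P.θt + P.kap - -P.θ1 = -P.θt + P.θ1 + P.kap by ring,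
      show -P.θt + P.kap + -P.θ1 - (P.kap + s + -1 * P.θi) = -s - P.θt - P.θ1 + P.θi by ring]
    have e : P.pow P.θ1 * P.pow (-P.θ1) * P.pow (-(s - P.θt - P.θ1 + P.θi)) =
        P.pow (-(s + P.θt + P.θ1 + P.θi)) * P.pow (2 * P.θt + 2 * P.θ1) := by
      rw [← A, ← A, ← A]; congr 1; ring
    linear_combination P.vt (s - P.θt - P.θ1 + P.θi) * P.vt (-P.θt + P.θ1 + P.kap) *
      P.vt (P.θt - P.θ1 + P.kap) * P.vt (-s - P.θt - P.θ1 + P.θi) * e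
  · rw [show P.θ1 + -P.θ1 - (P.kap + s + -1 * P.θi) = -(s - P.θi + P.kap) by ring, N,
      show P.θ1 - -P.θ1 = 2 * P.θ1 by ring,
      show P.θt + P.kap - (-P.θt + P.kap) = 2 * P.θt by ring,
      show P.θt + P.kap + (-P.θt + P.kap) - (P.kap + s + 1 * P.θi) = -s - P.θi + P.kap by ring]
    have e : P.pow (-P.θ1) * P.pow (-P.θt + P.kap) * P.pow (-(s - P.θi + P.kap)) =
        P.pow (-(s + P.θt + P.θ1 + P.θi)) * P.pow (2 * P.θi) := by
      rw [← A, ← A, ← A]; congr 1; ring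
    linear_combination -P.vt (s - P.θi + P.kap) * P.vt (2 * P.θ1) * P.vt (2 * P.θt) *
      P.vt (-s - P.θi + P.kap) * e

/-- The polynomial `T(ρ)` in homogeneous coordinates, with `θ₀` replaced by `s`. -/
def Tpoly (s : ℂ) (r : Fin 4 → Fin 2 → ℂ) : ℂ := ∑ p, P.Tat s p * mono r p

theorem Tpoly_neg (s : ℂ) (r : Fin 4 → Fin 2 → ℂ) : P.Tpoly (-s) r = P.Tpoly s r := by
  rw [Tpoly, Tat_neg]; rfl

theorem x_ne_zero (h0 : 0 < P.q) (h1 : P.q < 1) (ht : P.t0 ≠ 0) (j : Fin 4) : P.x j ≠ 0 := by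
  rw [P.x_eq h0 h1 ht]; exact P.pow_ne_zero h0 _

theorem mu_ne_zero (h0 : 0 < P.q) (s : ℂ) (d : Fin 2) : P.mu s d ≠ 0 := P.pow_ne_zero h0 _

/-- Interpolation of Tyurin parameters by a row with exponent `s`. -/
theorem hasInterpolant_iff (h0 : 0 < P.q) (h1 : P.q < 1) (ht : P.t0 ≠ 0) (s : ℂ)
    (r : Fin 4 → Fin 2 → ℂ) : HasInterpolant P.q P.x (P.mu s) r ↔ P.Tpoly s r = 0 := by
  rw [QPVI.hasInterpolant_iff h0 h1 (P.x_ne_zero h0 h1 ht) (P.mu_ne_zero h0 s)]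
  simp only [P.interpCoeff_eq h0 h1 ht, mul_assoc]
  rw [← Finset.mul_sum, mul_eq_zero, or_iff_right]
  · rfl
  · exact neg_ne_zero.mpr (P.pow_ne_zero h0 _)

end Params

/-! ### Linear algebra of the sixteen lines -/

/-- For each index `k`, the pairs containing `k` (`d = 0`) and their complements (`d = 1`), ordered
by the three splittings `12|34`, `13|24`, `14|23`. -/
def pr : Fin 4 → Fin 2 → Fin 3 → Fin 6 :=
  ![![![0, 1, 2], ![5, 4, 3]], ![![0, 4, 3], ![5, 1, 2]], ![![5, 1, 3], ![0, 4, 2]],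
    ![![5, 4, 2], ![0, 1, 3]]]

/-- The partner of `k` in the splittings `12|34`, `13|24`, `14|23`. -/
def oth : Fin 4 → Fin 3 → Fin 4 := ![![1, 2, 3], ![0, 3, 2], ![3, 0, 1], ![2, 1, 0]]

/-- The splitting to which a pair belongs. -/
def cl : Fin 6 → Fin 3 := ![0, 1, 2, 2, 1, 0]

/-- Whether a pair contains `k`. -/
def sd (k : Fin 4) (p : Fin 6) : Fin 2 := if ∃ m, pr k 0 m = p then 0 else 1

theorem cl_pr : ∀ k d m, cl (pr k d m) = m := by decide

theorem sd_pr : ∀ k d m, sd k (pr k d m) = d := by decide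

theorem pr_sd_cl : ∀ k p, pr k (sd k p) (cl p) = p := by decide

theorem ext_pr (k : Fin 4) {v v' : Fin 6 → ℂ} (h : ∀ d m, v (pr k d m) = v' (pr k d m)) :
    v = v' := by
  funext p
  rw [← pr_sd_cl k p]; exact h _ _

theorem sum_pr (k : Fin 4) (d : Fin 2) (v : Fin 6 → ℂ) :
    ∑ p, v p = ∑ m, v (pr k d m) + ∑ m, v (pr k (d + 1) m) := by
  rw [Fin.sum_univ_six, Fin.sum_univ_three, Fin.sum_univ_three]
  fin_cases k <;> fin_cases d <;> simp [pr] <;> ring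

theorem sum_shift (m : Fin 3) (f : Fin 3 → ℂ) : ∑ n, f n = f m + f (m + 1) + f (m + 2) := by
  rw [Fin.sum_univ_three]
  fin_cases m
  · rfl
  · simp only [Fin.mk_one, Fin.reduceAdd]; ring
  · simp only [Fin.reduceFinMk, Fin.reduceAdd]; ring

/-- The splitting m is the one with i and j in the same block. In the other two the block of i is
the complement of the block of j. -/
theorem exists_common : ∀ i j : Fin 4, i ≠ j → ∃ m, (∀ d, pr i d m = pr j d m) ∧
    ∀ d n, n ≠ m → pr i d n = pr j (d + 1) n := by decide

/-- One edge from each perfect matching of the complete graph on four vertices: three such edges are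
a star at a vertex k (d = 0) or the triangle avoiding k (d = 1). -/
theorem exists_choice : ∀ c : Fin 3 → Fin 2, ∃ k d, ∀ m, pr k d m = pr 0 (c m) m ∧
    pr k (d + 1) m = pr 0 (c m + 1) m := by decide

theorem pr_product (k : Fin 4) (m : Fin 3) (v : Fin 6 → ℂ) :
    v (pr k 0 m) * v (pr k 1 m) = v (pr 0 0 m) * v (pr 0 1 m) := by
  fin_cases k <;> fin_cases m <;> simp [pr] <;> ring

theorem fin2_add_one_add_one : ∀ d : Fin 2, d + 1 + 1 = d := by decide

theorem fin2_eq_or : ∀ d e : Fin 2, e = d ∨ e = d + 1 := by decide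

/-- The lines `ρ_k = 0` (`d = 0`) and `ρ_k = ∞` (`d = 1`), without the coordinate `N_∞`. -/
def lineSub (k : Fin 4) (d : Fin 2) : Submodule ℂ (Fin 6 → ℂ) where
  carrier := {v | (∀ m, v (pr k d m) = 0) ∧ ∑ m, v (pr k (d + 1) m) = 0}
  zero_mem' := by simp
  add_mem' := by
    rintro a b ⟨ha, ha'⟩ ⟨hb, hb'⟩
    exact ⟨fun m => by simp [ha, hb], by simp [Finset.sum_add_distrib, ha', hb']⟩
  smul_mem' := by
    rintro c a ⟨ha, ha'⟩
    exact ⟨fun m => by simp [ha], by simp [← Finset.mul_sum, ha']⟩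

/-- The dual lines, without the coordinate `N_∞`. -/
def dualSub (w : Fin 2 → Fin 3 → ℂ) (k : Fin 4) (e : Fin 2) : Submodule ℂ (Fin 6 → ℂ) where
  carrier := {v | ∃ c : Fin 2 → ℂ, ∀ d m, v (pr k d m) = c d * w (e + d) m}
  zero_mem' := ⟨0, by simp⟩
  add_mem' := by
    rintro a b ⟨c, hc⟩ ⟨c', hc'⟩
    exact ⟨c + c', fun d m => by simp [hc, hc', add_mul]⟩
  smul_mem' := by
    rintro x a ⟨c, hc⟩
    exact ⟨x • c, fun d m => by simp [hc, mul_assoc]⟩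

/-- A parametrisation of `lineSub`. -/
def lineParam (k : Fin 4) (d : Fin 2) : (Fin 2 → ℂ) →ₗ[ℂ] (Fin 6 → ℂ) where
  toFun s p := if sd k p = d then 0 else ![s 0, s 1, -s 0 - s 1] (cl p)
  map_add' s t := by
    funext p
    by_cases h : sd k p = d
    · simp [h]
    · simp only [h, if_false, Pi.add_apply]
      generalize cl p = m
      fin_cases m <;> simp
      ring
  map_smul' c s := by
    funext p
    by_cases h : sd k p = d
    · simp [h]
    · simp only [h, if_false, Pi.smul_apply, smul_eq_mul, RingHom.id_apply]
      generalize cl p = m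
      fin_cases m <;> simp
      ring

/-- A parametrisation of `dualSub`. -/
def dualParam (w : Fin 2 → Fin 3 → ℂ) (k : Fin 4) (e : Fin 2) :
    (Fin 2 → ℂ) →ₗ[ℂ] (Fin 6 → ℂ) where
  toFun s p := s (sd k p) * w (e + sd k p) (cl p)
  map_add' s t := by funext p; simp [add_mul]
  map_smul' c s := by funext p; simp [mul_assoc]

theorem lineParam_pr (k : Fin 4) (d : Fin 2) (s : Fin 2 → ℂ) (m : Fin 3) :
    lineParam k d s (pr k d m) = 0 ∧
      lineParam k d s (pr k (d + 1) m) = ![s 0, s 1, -s 0 - s 1] m := by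
  have : ∀ d : Fin 2, d + 1 ≠ d := by decide
  simp [lineParam, sd_pr, cl_pr, this]

theorem dualParam_pr (w : Fin 2 → Fin 3 → ℂ) (k : Fin 4) (e d : Fin 2) (s : Fin 2 → ℂ)
    (m : Fin 3) : dualParam w k e s (pr k d m) = s d * w (e + d) m := by
  simp [dualParam, sd_pr, cl_pr]

theorem range_lineParam (k : Fin 4) (d : Fin 2) :
    LinearMap.range (lineParam k d) = lineSub k d := by
  ext v
  constructor
  · rintro ⟨s, rfl⟩
    refine ⟨fun m => (lineParam_pr k d s m).1, ?_⟩
    simp only [(lineParam_pr k d s _).2, Fin.sum_univ_three]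
    simp
  · rintro ⟨h1, h2⟩
    refine ⟨![v (pr k (d + 1) 0), v (pr k (d + 1) 1)], ext_pr k fun d' m => ?_⟩
    rw [Fin.sum_univ_three] at h2
    rcases fin2_eq_or d d' with rfl | rfl
    · rw [(lineParam_pr _ _ _ _).1, h1]
    · rw [(lineParam_pr _ _ _ _).2]
      fin_cases m
      · rfl
      · rfl
      · simp only [Matrix.cons_val, Fin.reduceFinMk]; linear_combination -h2

theorem range_dualParam (w : Fin 2 → Fin 3 → ℂ) (k : Fin 4) (e : Fin 2) :
    LinearMap.range (dualParam w k e) = dualSub w k e := by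
  ext v
  constructor
  · rintro ⟨s, rfl⟩
    exact ⟨s, fun d m => dualParam_pr w k e d s m⟩
  · rintro ⟨c, hc⟩
    exact ⟨c, ext_pr k fun d m => by rw [dualParam_pr, hc]⟩

theorem finrank_lineSub (k : Fin 4) (d : Fin 2) : Module.finrank ℂ (lineSub k d) = 2 := by
  rw [← range_lineParam, LinearMap.finrank_range_of_inj, Module.finrank_fin_fun]
  intro s t h
  have e := fun m => (lineParam_pr k d s m).2.symm.trans
    ((congrFun h (pr k (d + 1) m)).trans (lineParam_pr k d t m).2)
  funext i
  fin_cases i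
  · exact e 0
  · exact e 1

theorem finrank_dualSub {w : Fin 2 → Fin 3 → ℂ} (hw : ∀ e m, w e m ≠ 0) (k : Fin 4) (e : Fin 2) :
    Module.finrank ℂ (dualSub w k e) = 2 := by
  rw [← range_dualParam, LinearMap.finrank_range_of_inj, Module.finrank_fin_fun]
  intro s t h
  funext d
  have := congrFun h (pr k d 0)
  rw [dualParam_pr, dualParam_pr] at this
  exact mul_right_cancel₀ (hw _ _) this

/-- The index of a special value. -/
def Diamond.idx : Diamond → Fin 2
  | .zero => 0
  | .infty => 1

theorem Diamond.idx_ne {d e : Diamond} : d ≠ e → e.idx = d.idx + 1 := by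
  cases d <;> cases e <;> simp [Diamond.idx]

/-- The sixteen lines, without the coordinate `N_∞`. -/
def linSub (w : Fin 2 → Fin 3 → ℂ) : LineName → Submodule ℂ (Fin 6 → ℂ)
  | .line k d => lineSub k d.idx
  | .dual k d => dualSub w k d.idx

/-- The equations of the Segre surface without the coordinate `N_∞`. -/
def SegreForm (w : Fin 2 → Fin 3 → ℂ) (v : Fin 6 → ℂ) : Prop :=
  ∑ p, v p = 0 ∧ ∀ m n, v (pr 0 0 m) * v (pr 0 1 m) * (w 0 n * w 1 n) =
    v (pr 0 0 n) * v (pr 0 1 n) * (w 0 m * w 1 m)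

/-- On `lineSub` every product of complementary coordinates has a zero factor; on `dualSub` it is c₀
c₁ w₀ₘ w₁ₘ. -/
theorem linSub_segreForm {w : Fin 2 → Fin 3 → ℂ} (hs : ∀ e, ∑ m, w e m = 0) (l : LineName)
    {v : Fin 6 → ℂ} (hv : v ∈ linSub w l) : SegreForm w v := by
  rcases l with ⟨k, d⟩ | ⟨k, d⟩
  · obtain ⟨h1, h2⟩ := hv
    refine ⟨?_, fun m n => ?_⟩
    · rw [sum_pr k d.idx, h2]; simp [h1]
    · have : ∀ m, v (pr 0 0 m) * v (pr 0 1 m) = 0 := by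
        intro m
        rw [← pr_product k]
        cases d
        · have := h1 m; simp only [Diamond.idx] at this; rw [this, zero_mul]
        · have := h1 m; simp only [Diamond.idx] at this; rw [this, mul_zero]
      rw [this, this]; ring
  · obtain ⟨c, hc⟩ := hv
    refine ⟨?_, fun m n => ?_⟩
    · rw [sum_pr k 0]
      simp only [hc, ← Finset.mul_sum, hs, mul_zero, add_zero]
    · rw [← pr_product k m, ← pr_product k n, hc, hc, hc, hc]
      cases d
      · simp only [Diamond.idx, zero_add]; ring
      · simp only [Diamond.idx, add_zero, show (1 : Fin 2) + 1 = 0 from rfl]; ring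

/-- The product relations make bₘ proportional to w₀ₘ w₁ₘ / aₘ. Then ∑ b = 0, with a₂, w₀₂, w₁₂
eliminated through the vanishing sums, is a quadratic equation for a₀ : a₁ that splits with the
roots w₀ and w₁. -/
theorem quadratic_roots {w : Fin 2 → Fin 3 → ℂ} (hw : ∀ e m, w e m ≠ 0)
    (hs : ∀ e, ∑ m, w e m = 0) {a b : Fin 3 → ℂ} (ha : ∀ m, a m ≠ 0) (hb : ∀ m, b m ≠ 0)
    (has : ∑ m, a m = 0) (hbs : ∑ m, b m = 0)
    (hab : ∀ m n, a m * b m * (w 0 n * w 1 n) = a n * b n * (w 0 m * w 1 m)) :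
    ∃ e s t, (∀ m, a m = s * w e m) ∧ ∀ m, b m = t * w (e + 1) m := by
  rw [Fin.sum_univ_three] at has hbs
  have s0 := hs 0
  have s1 := hs 1
  rw [Fin.sum_univ_three] at s0 s1
  have h1 := hab 1 0
  have h2 := hab 2 0
  have key : (w 0 0 * a 1 - w 0 1 * a 0) * (w 1 0 * a 1 - w 1 1 * a 0) = 0 := by
    have k1 : w 0 0 * w 1 0 * (a 0 * (a 1 * a 2)) * (b 0 + b 1 + b 2) = 0 := by rw [hbs]; ring
    have k2 : a 0 * b 0 * (w 0 0 * w 1 0 * (a 1 * a 2) + w 0 1 * w 1 1 * (a 0 * a 2) +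
        w 0 2 * w 1 2 * (a 0 * a 1)) = 0 := by
      linear_combination k1 - a 0 * a 2 * h1 - a 0 * a 1 * h2
    have k3 := (mul_eq_zero.mp k2).resolve_left (mul_ne_zero (ha 0) (hb 0))
    have e2 : a 2 = -a 0 - a 1 := by linear_combination has
    have e3 : w 0 2 = -w 0 0 - w 0 1 := by linear_combination s0
    have e4 : w 1 2 = -w 1 0 - w 1 1 := by linear_combination s1
    rw [e2, e3, e4] at k3
    linear_combination -k3
  have fin : ∀ e : Fin 2, w e 0 * a 1 - w e 1 * a 0 = 0 →
      (∀ m, w 0 m * w 1 m = w e m * w (e + 1) m) →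
      ∃ e s t, (∀ m, a m = s * w e m) ∧ ∀ m, b m = t * w (e + 1) m := by
    intro e he hp
    have ha' : ∀ m, a m = a 0 / w e 0 * w e m := by
      have hse := hs e
      rw [Fin.sum_univ_three] at hse
      have := hw e 0
      intro m
      fin_cases m
      · simp only [Fin.zero_eta]; field_simp
      · simp only [Fin.mk_one]; field_simp; linear_combination he
      · simp only [Fin.reduceFinMk]; field_simp
        linear_combination w e 0 * has - he - a 0 * hse
    refine ⟨e, a 0 / w e 0, b 0 / w (e + 1) 0, ha', fun m => ?_⟩
    have h := hab m 0
    rw [hp, hp, ha' m] at h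
    have n1 := hw e 0
    have n2 := hw (e + 1) 0
    have n3 := hw e m
    have n4 := ha 0
    field_simp at h ⊢
    linear_combination h
  rcases mul_eq_zero.mp key with h | h
  · exact fin 0 h fun m => by simp
  · exact fin 1 h fun m => by simp [mul_comm]

/-- A product of two linear forms vanishes on a linear space only if one of the forms does. -/
theorem forall_eq_zero_or {Q : Submodule ℂ (Fin 6 → ℂ)} {p p' : Fin 6}
    (h : ∀ v ∈ Q, v p * v p' = 0) : (∀ v ∈ Q, v p = 0) ∨ (∀ v ∈ Q, v p' = 0) := by
  by_contra! hcon
  obtain ⟨⟨a, ha, ha0⟩, b, hb, hb0⟩ := hcon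
  have h1 := (mul_eq_zero.mp (h a ha)).resolve_left ha0
  have h2 := (mul_eq_zero.mp (h b hb)).resolve_right hb0
  have := h _ (Q.add_mem ha hb)
  simp [h1, h2, ha0, hb0] at this

theorem exists_mem_coord_eq_zero {Q : Submodule ℂ (Fin 6 → ℂ)} (hQ : Module.finrank ℂ Q = 2)
    (p : Fin 6) : ∃ v ∈ Q, v ≠ 0 ∧ v p = 0 := by
  have h := LinearMap.ker_ne_bot_of_finrank_lt
    (f := (LinearMap.proj p : (Fin 6 → ℂ) →ₗ[ℂ] ℂ).domRestrict Q) (by simp [hQ])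
  obtain ⟨v, hv, hv0⟩ := Submodule.exists_mem_ne_zero_of_ne_bot h
  exact ⟨v, v.2, fun h => hv0 (Subtype.ext h), hv⟩

/-- If both coordinates 12 and 34 of e vanished, so would all products of e, and comparison of v + e
with v would kill the polar terms as well. All coordinates of v are nonzero, so this forces e = 0.
-/
theorem exists_mem_of_segreForm {w : Fin 2 → Fin 3 → ℂ} (hw : ∀ e m, w e m ≠ 0)
    {Q : Submodule ℂ (Fin 6 → ℂ)} (hQ : Module.finrank ℂ Q = 2) (hX : ∀ v ∈ Q, SegreForm w v)
    {v : Fin 6 → ℂ} (hv : v ∈ Q) (hv0 : v 0 * v 5 ≠ 0) (d : Fin 2) :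
    ∃ e ∈ Q, e (pr 0 d 0) = 0 ∧ e (pr 0 (d + 1) 0) ≠ 0 := by
  obtain ⟨e, he, he0, hed⟩ := exists_mem_coord_eq_zero hQ (pr 0 d 0)
  refine ⟨e, he, hed, fun hed' => he0 ?_⟩
  have p00 : pr 0 0 0 = 0 := rfl
  have p01 : pr 0 1 0 = 5 := rfl
  have h0 : e 0 = 0 ∧ e 5 = 0 := by
    fin_cases d
    · exact ⟨hed, hed'⟩
    · exact ⟨hed', hed⟩
  refine ext_pr 0 fun d' m => ?_
  have hne := fun m => mul_ne_zero (hw 0 m) (hw 1 m)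
  have h1 := (hX e he).2 m 0
  have h2 := (hX v hv).2 m 0
  have h3 := (hX _ (Q.add_mem hv he)).2 m 0
  simp only [Pi.add_apply, p00, p01, h0.1, h0.2, add_zero, zero_mul] at h1 h2 h3
  have h1' := (mul_eq_zero.mp h1).resolve_right (hne 0)
  have h2' : v (pr 0 0 m) * v (pr 0 1 m) ≠ 0 := by
    intro h
    rw [h, zero_mul] at h2
    exact mul_ne_zero hv0 (hne m) h2.symm
  have h3' : v (pr 0 0 m) * e (pr 0 1 m) + e (pr 0 0 m) * v (pr 0 1 m) = 0 := by
    apply mul_right_cancel₀ (hne 0)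
    linear_combination h3 - h2 - h1
  have a0 := left_ne_zero_of_mul h2'
  have a1 := right_ne_zero_of_mul h2'
  have : e (pr 0 0 m) = 0 ∧ e (pr 0 1 m) = 0 := by
    rcases mul_eq_zero.mp h1' with h | h
    · rw [h, zero_mul, add_zero] at h3'
      exact ⟨h, (mul_eq_zero.mp h3').resolve_left a0⟩
    · rw [h, mul_zero, zero_add] at h3'
      exact ⟨(mul_eq_zero.mp h3').resolve_right a1, h⟩
  rcases fin2_eq_or 0 d' with rfl | rfl
  · exact this.1
  · exact this.2

theorem finrank_span_pair {a b : Fin 6 → ℂ} {p p' : Fin 6} (ha : a p ≠ 0) (ha' : a p' = 0)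
    (hb : b p = 0) (hb' : b p' ≠ 0) :
    Module.finrank ℂ (Submodule.span ℂ {a, b}) = 2 := by
  have hli : LinearIndependent ℂ ![a, b] := by
    rw [LinearIndependent.pair_iff]
    intro s t h
    have h1 := congrFun h p
    have h2 := congrFun h p'
    simp [ha, hb, ha', hb'] at h1 h2
    exact ⟨h1, h2⟩
  have := finrank_span_eq_card hli
  rwa [Matrix.range_cons_cons_empty, Fintype.card_fin] at this

/-- The two dimensional spaces of solutions of the Segre equations. -/
theorem exists_eq_linSub {w : Fin 2 → Fin 3 → ℂ} (hw : ∀ e m, w e m ≠ 0)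
    (hs : ∀ e, ∑ m, w e m = 0) {Q : Submodule ℂ (Fin 6 → ℂ)} (hQ : Module.finrank ℂ Q = 2)
    (hX : ∀ v ∈ Q, SegreForm w v) : ∃ l, Q = linSub w l := by
  have hne := fun m => mul_ne_zero (hw 0 m) (hw 1 m)
  have idx : ∀ d : Fin 2, ∃ D : Diamond, D.idx = d := by
    intro d; fin_cases d
    · exact ⟨.zero, rfl⟩
    · exact ⟨.infty, rfl⟩
  -- All three products are fixed multiples of N₁₂N₃₄ on Q, so the dichotomy is whether this
  -- quadratic form vanishes on Q.
  by_cases hA : ∀ v ∈ Q, v 0 * v 5 = 0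
  · have hzero : ∀ m, ∀ v ∈ Q, v (pr 0 0 m) * v (pr 0 1 m) = 0 := by
      intro m v hv
      have := (hX v hv).2 m 0
      have h0 : v (pr 0 0 0) * v (pr 0 1 0) = 0 := hA v hv
      rw [h0, zero_mul] at this
      exact (mul_eq_zero.mp this).resolve_right (hne 0)
    have hc : ∀ m, ∃ c : Fin 2, ∀ v ∈ Q, v (pr 0 c m) = 0 := by
      intro m
      rcases forall_eq_zero_or (hzero m) with h | h
      · exact ⟨0, h⟩
      · exact ⟨1, h⟩
    choose c hc using hc
    obtain ⟨k, d, hkd⟩ := exists_choice c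
    obtain ⟨D, rfl⟩ := idx d
    refine ⟨.line k D, Submodule.eq_of_le_of_finrank_eq (S₂ := lineSub k D.idx) ?_ ?_⟩
    · intro v hv
      have h1 : ∀ m, v (pr k D.idx m) = 0 := fun m => by rw [(hkd m).1]; exact hc m v hv
      refine ⟨h1, ?_⟩
      have := (hX v hv).1
      rw [sum_pr k D.idx] at this
      simpa [h1] using this
    · rw [hQ, finrank_lineSub]
  · push Not at hA
    obtain ⟨v, hv, hv0⟩ := hA
    obtain ⟨e, he, he1, he0⟩ := exists_mem_of_segreForm hw hQ hX hv hv0 1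
    obtain ⟨f, hf, hf0, hf1⟩ := exists_mem_of_segreForm hw hQ hX hv hv0 0
    have he0 : e (pr 0 0 0) ≠ 0 := he0
    have hf1 : f (pr 0 1 0) ≠ 0 := hf1
    -- Polarised product relations; together with those for e and f they show that in each splitting
    -- e and f have complementary supports.
    have cross : ∀ m n, (e (pr 0 0 m) * f (pr 0 1 m) + f (pr 0 0 m) * e (pr 0 1 m)) *
        (w 0 n * w 1 n) = (e (pr 0 0 n) * f (pr 0 1 n) + f (pr 0 0 n) * e (pr 0 1 n)) *
        (w 0 m * w 1 m) := by
      intro m n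
      have h1 := (hX e he).2 m n
      have h2 := (hX f hf).2 m n
      have h3 := (hX _ (Q.add_mem he hf)).2 m n
      simp only [Pi.add_apply] at h3
      linear_combination h3 - h2 - h1
    have hee : ∀ m, e (pr 0 0 m) * e (pr 0 1 m) = 0 := by
      intro m
      have := (hX e he).2 m 0
      rw [he1, mul_zero, zero_mul] at this
      exact (mul_eq_zero.mp this).resolve_right (hne 0)
    have hff : ∀ m, f (pr 0 0 m) * f (pr 0 1 m) = 0 := by
      intro m
      have := (hX f hf).2 m 0
      rw [hf0, zero_mul, zero_mul] at this
      exact (mul_eq_zero.mp this).resolve_right (hne 0)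
    have hcross : ∀ m, e (pr 0 0 m) * f (pr 0 1 m) + f (pr 0 0 m) * e (pr 0 1 m) ≠ 0 := by
      intro m h
      have := cross m 0
      rw [h, zero_mul, hf0, zero_mul, add_zero] at this
      exact mul_ne_zero (mul_ne_zero he0 hf1) (hne m) this.symm
    have hc : ∀ m, ∃ c : Fin 2, (e (pr 0 c m) = 0 ∧ f (pr 0 (c + 1) m) = 0) ∧
        (e (pr 0 (c + 1) m) ≠ 0 ∧ f (pr 0 c m) ≠ 0) := by
      intro m
      have hm := hcross m
      rcases mul_eq_zero.mp (hee m) with h | h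
      · rw [h, zero_mul, zero_add] at hm
        have := hff m
        exact ⟨0, ⟨h, (mul_eq_zero.mp this).resolve_left (left_ne_zero_of_mul hm)⟩,
          right_ne_zero_of_mul hm, left_ne_zero_of_mul hm⟩
      · rw [h, mul_zero, add_zero] at hm
        have := hff m
        exact ⟨1, ⟨h, (mul_eq_zero.mp this).resolve_right (right_ne_zero_of_mul hm)⟩,
          left_ne_zero_of_mul hm, right_ne_zero_of_mul hm⟩
    choose c hc using hc
    obtain ⟨k, d, hkd⟩ := exists_choice c
    -- By `exists_choice` one of the spanning vectors is supported on the three pairs through k, the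
    -- other on their complements; here e denotes the former.
    have main : ∀ e ∈ Q, ∀ f ∈ Q, (∀ m, e (pr k 1 m) = 0) → (∀ m, f (pr k 0 m) = 0) →
        (∀ m, e (pr k 0 m) ≠ 0) → (∀ m, f (pr k 1 m) ≠ 0) → ∃ l, Q = linSub w l := by
      intro e he f hf e1 f0 e0 f1
      have hes := (hX e he).1
      have hfs := (hX f hf).1
      rw [sum_pr k 0] at hes
      rw [sum_pr k 1] at hfs
      simp only [show (0 : Fin 2) + 1 = 1 from rfl, show (1 : Fin 2) + 1 = 0 from rfl, e1, f0,
        Finset.sum_const_zero, add_zero] at hes hfs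
      obtain ⟨i, s, t, hi, hi'⟩ := quadratic_roots hw hs e0 f1 hes hfs (fun m n => by
        have h := (hX _ (Q.add_mem he hf)).2 m n
        rw [← pr_product k m, ← pr_product k n] at h
        simpa [e1, f0] using h)
      obtain ⟨D, rfl⟩ := idx i
      have hspan : Module.finrank ℂ (Submodule.span ℂ {e, f}) = 2 :=
        finrank_span_pair (e0 0) (e1 0) (f0 0) (f1 0)
      have h1 : Submodule.span ℂ {e, f} = Q := by
        refine Submodule.eq_of_le_of_finrank_eq ?_ (by rw [hspan, hQ])
        rw [Submodule.span_le]
        rintro x (rfl | hx)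
        · exact he
        · rw [Set.mem_singleton_iff.mp hx]; exact hf
      refine ⟨.dual k D, ?_⟩
      rw [← h1]
      refine Submodule.eq_of_le_of_finrank_eq (S₂ := dualSub w k D.idx) ?_
        (by rw [hspan, finrank_dualSub hw])
      rw [Submodule.span_le]
      have two : ∀ d : Fin 2, d = 0 ∨ d = 1 := by decide
      rintro x (rfl | hx)
      · refine ⟨![s, 0], fun d m => ?_⟩
        rcases two d with rfl | rfl
        · simp [hi]
        · simp [e1]
      · rw [Set.mem_singleton_iff.mp hx]
        refine ⟨![0, t], fun d m => ?_⟩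
        rcases two d with rfl | rfl
        · simp [f0]
        · simp [hi']
    have q1 : ∀ m, e (pr k d m) = 0 := fun m => by rw [(hkd m).1]; exact (hc m).1.1
    have q2 : ∀ m, f (pr k (d + 1) m) = 0 := fun m => by rw [(hkd m).2]; exact (hc m).1.2
    have q3 : ∀ m, e (pr k (d + 1) m) ≠ 0 := fun m => by rw [(hkd m).2]; exact (hc m).2.1
    have q4 : ∀ m, f (pr k d m) ≠ 0 := fun m => by rw [(hkd m).1]; exact (hc m).2.2
    rcases fin2_eq_or d 0 with rfl | h
    · exact main f hf e he q2 q1 q4 q3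
    · obtain rfl : d = 1 := (by decide : ∀ d : Fin 2, 0 = d + 1 → d = 1) d h
      exact main e he f hf q1 q2 q3 q4


/-! ### Intersections of the sixteen lines -/

theorem exists_common_shift {i j : Fin 4} (hij : i ≠ j) : ∃ m, (∀ d, pr i d m = pr j d m) ∧
    (∀ d, pr i d (m + 1) = pr j (d + 1) (m + 1)) ∧
    (∀ d, pr i d (m + 2) = pr j (d + 1) (m + 2)) := by
  obtain ⟨m, h1, h2⟩ := exists_common i j hij
  exact ⟨m, h1, fun d => h2 d _ (by simp), fun d => h2 d _ (by simp)⟩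

theorem fin3_cases (m n : Fin 3) : n = m ∨ n = m + 1 ∨ n = m + 2 := by
  revert m n; decide

theorem fin2_shift₁ : ∀ {e d : Fin 2}, e + 1 + (d + 1) = e + d := by decide

theorem fin2_shift₂ : ∀ {e d : Fin 2}, e + (d + 1) + 1 = e + d := by decide

theorem fin2_shift₃ : ∀ {e d : Fin 2}, e + (d + 1) = e + 1 + d := by decide

/-- The vector with two opposite coordinates in the splittings different from `m`. -/
def diffVec (i : Fin 4) (d : Fin 2) (m : Fin 3) : Fin 6 → ℂ := fun p =>
  if sd i p = d + 1 then (if cl p = m + 1 then 1 else if cl p = m + 2 then -1 else 0) else 0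

theorem diffVec_self (i : Fin 4) (d : Fin 2) (m n : Fin 3) : diffVec i d m (pr i d n) = 0 := by
  have : ∀ d : Fin 2, ¬ d = d + 1 := by decide
  simp [diffVec, sd_pr, this]

theorem diffVec_other (i : Fin 4) (d : Fin 2) (m : Fin 3) :
    diffVec i d m (pr i (d + 1) m) = 0 ∧ diffVec i d m (pr i (d + 1) (m + 1)) = 1 ∧
      diffVec i d m (pr i (d + 1) (m + 2)) = -1 := by
  have h1 : ∀ m : Fin 3, ¬ m = m + 1 ∧ ¬ m = m + 2 ∧ ¬ m + 2 = m + 1 := by decide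
  simp [diffVec, sd_pr, cl_pr, h1]

/-- The vanishing conditions leave the two coordinates at the splittings m + 1 and m + 2, tied by a
vanishing sum. -/
theorem lineSub_inter_line {i j : Fin 4} {d : Fin 2} {m : Fin 3}
    (hm : ∀ d, pr i d m = pr j d m) (hm1 : ∀ d, pr i d (m + 1) = pr j (d + 1) (m + 1))
    (hm2 : ∀ d, pr i d (m + 2) = pr j (d + 1) (m + 2)) (v : Fin 6 → ℂ) :
    (v ∈ lineSub i d ∧ v ∈ lineSub j (d + 1)) ↔ ∃ c : ℂ, v = c • diffVec i d m := by
  constructor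
  · rintro ⟨⟨h1, h2⟩, h3, -⟩
    have e1 := h3 m
    rw [← hm] at e1
    rw [sum_shift m, e1, zero_add] at h2
    obtain ⟨a, b, c⟩ := diffVec_other i d m
    refine ⟨v (pr i (d + 1) (m + 1)), ext_pr i fun d' n => ?_⟩
    rw [Pi.smul_apply, smul_eq_mul]
    rcases fin2_eq_or d d' with rfl | rfl
    · rw [diffVec_self, h1, mul_zero]
    · rcases fin3_cases m n with rfl | rfl | rfl
      · rw [a, e1, mul_zero]
      · rw [b, mul_one]
      · rw [c]; linear_combination h2
  · rintro ⟨c, rfl⟩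
    obtain ⟨h0, h1, h2⟩ := diffVec_other i d m
    refine ⟨⟨fun n => ?_, ?_⟩, fun n => ?_, ?_⟩
    · simp [diffVec_self]
    · rw [sum_shift m]; simp [h0, h1, h2]
    · rcases fin3_cases m n with rfl | rfl | rfl
      · rw [← hm]; simp [h0]
      · rw [← hm1]; simp [diffVec_self]
      · rw [← hm2]; simp [diffVec_self]
    · rw [sum_shift m, fin2_add_one_add_one]
      rw [← hm]
      have e1 := hm1 (d + 1)
      have e2 := hm2 (d + 1)
      rw [fin2_add_one_add_one] at e1 e2
      rw [← e1, ← e2]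
      simp [diffVec_self, h1, h2]

/-- Five coordinates vanish for both lines together, and the linear relation removes the sixth. -/
theorem lineSub_inter_line_eq_zero {i j : Fin 4} {d : Fin 2} (hij : i ≠ j) {v : Fin 6 → ℂ}
    (h : v ∈ lineSub i d) (h' : v ∈ lineSub j d) : v = 0 := by
  obtain ⟨m, hm, hm1, hm2⟩ := exists_common_shift hij
  obtain ⟨h1, h2⟩ := h
  obtain ⟨h3, -⟩ := h'
  have e1 := hm1 (d + 1)
  have e2 := hm2 (d + 1)
  rw [fin2_add_one_add_one] at e1 e2
  rw [sum_shift m, e1, e2, h3, h3, add_zero, add_zero] at h2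
  refine ext_pr i fun d' n => ?_
  rcases fin2_eq_or d d' with rfl | rfl
  · exact h1 n
  · rcases fin3_cases m n with rfl | rfl | rfl
    · exact h2
    · rw [e1]; exact h3 _
    · rw [e2]; exact h3 _

theorem lineSub_inter_self_eq_zero {i : Fin 4} {d : Fin 2} {v : Fin 6 → ℂ}
    (h : v ∈ lineSub i d) (h' : v ∈ lineSub i (d + 1)) : v = 0 := by
  refine ext_pr i fun d' n => ?_
  rcases fin2_eq_or d d' with rfl | rfl
  · exact h.1 n
  · exact h'.1 n

/-- The vanishing block kills one of the two parameters of the dual line; the weights have sum zero,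
so the other one stays free. -/
theorem lineSub_inter_dual {w : Fin 2 → Fin 3 → ℂ} (hw : ∀ e m, w e m ≠ 0)
    (hs : ∀ e, ∑ m, w e m = 0) (i : Fin 4) (d e : Fin 2) (v : Fin 6 → ℂ) :
    (v ∈ lineSub i d ∧ v ∈ dualSub w i e) ↔
      ∃ c : ℂ, v = c • dualParam w i e (Pi.single (d + 1) 1) := by
  have hd : ∀ d : Fin 2, d ≠ d + 1 := by decide
  constructor
  · rintro ⟨⟨h1, h2⟩, c, hc⟩
    have hcd : c d = 0 := by
      have := h1 0
      rw [hc] at this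
      exact (mul_eq_zero.mp this).resolve_right (hw _ _)
    refine ⟨c (d + 1), ext_pr i fun d' n => ?_⟩
    rw [Pi.smul_apply, smul_eq_mul, dualParam_pr, hc]
    rcases fin2_eq_or d d' with rfl | rfl
    · rw [hcd, Pi.single_eq_of_ne (hd _)]; ring
    · rw [Pi.single_eq_same]; ring
  · rintro ⟨c, rfl⟩
    refine ⟨⟨fun m => ?_, ?_⟩, ?_⟩
    · rw [Pi.smul_apply, dualParam_pr, Pi.single_eq_of_ne (hd d)]; simp
    · simp only [Pi.smul_apply, dualParam_pr, ← Finset.smul_sum, ← Finset.mul_sum, hs]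
      simp
    · exact Submodule.smul_mem _ _ (range_dualParam w i e ▸ LinearMap.mem_range_self _ _)

/-- For i ≠ j both blocks of j meet the vanishing block of i, which kills both parameters. -/
theorem lineSub_inter_dual_eq_zero {w : Fin 2 → Fin 3 → ℂ} (hw : ∀ e m, w e m ≠ 0)
    {i j : Fin 4} (hij : i ≠ j) {d e : Fin 2} {v : Fin 6 → ℂ} (h : v ∈ lineSub i d)
    (h' : v ∈ dualSub w j e) : v = 0 := by
  obtain ⟨m, hm, hm1, hm2⟩ := exists_common_shift hij
  obtain ⟨c, hc⟩ := h'
  have c1 : c d = 0 := by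
    have := h.1 m
    rw [hm, hc] at this
    exact (mul_eq_zero.mp this).resolve_right (hw _ _)
  have c2 : c (d + 1) = 0 := by
    have := h.1 (m + 1)
    rw [hm1, hc] at this
    exact (mul_eq_zero.mp this).resolve_right (hw _ _)
  refine ext_pr j fun d' n => ?_
  rw [hc]
  rcases fin2_eq_or d d' with rfl | rfl
  · rw [c1, zero_mul]; rfl
  · rw [c2, zero_mul]; rfl

theorem eq_zero_of_proportional {w : Fin 2 → Fin 3 → ℂ}
    (hnp : ∀ m n, m ≠ n → w 0 m * w 1 n ≠ w 0 n * w 1 m) (hw : ∀ e m, w e m ≠ 0) {m n : Fin 3}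
    (hmn : m ≠ n) {a b : ℂ} {e : Fin 2} (h1 : a * w e m = b * w (e + 1) m)
    (h2 : a * w e n = b * w (e + 1) n) : a = 0 ∧ b = 0 := by
  have hne : w e m * w (e + 1) n - w e n * w (e + 1) m ≠ 0 := by
    have two : e = 0 ∨ e = 1 := (by decide : ∀ e : Fin 2, e = 0 ∨ e = 1) e
    rcases two with rfl | rfl
    · exact sub_ne_zero.mpr (hnp m n hmn)
    · rw [show (1 : Fin 2) + 1 = 0 from rfl]
      have := hnp n m hmn.symm
      intro h; apply this; linear_combination h
  have ha : a = 0 := by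
    refine (mul_eq_zero.mp (?_ : a * _ = 0)).resolve_right hne
    linear_combination w (e + 1) n * h1 - w (e + 1) m * h2
  refine ⟨ha, ?_⟩
  rw [ha, zero_mul] at h1
  exact (mul_eq_zero.mp h1.symm).resolve_right (hw _ _)

theorem dualSub_inter_self_eq_zero {w : Fin 2 → Fin 3 → ℂ}
    (hnp : ∀ m n, m ≠ n → w 0 m * w 1 n ≠ w 0 n * w 1 m) (hw : ∀ e m, w e m ≠ 0)
    {i : Fin 4} {e : Fin 2} {v : Fin 6 → ℂ}
    (h : v ∈ dualSub w i e) (h' : v ∈ dualSub w i (e + 1)) : v = 0 := by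
  obtain ⟨c, hc⟩ := h
  obtain ⟨c', hc'⟩ := h'
  have key : ∀ d, c d = 0 := by
    intro d
    have e1 : ∀ m, c d * w (e + d) m = c' d * w (e + d + 1) m := fun m => by
      rw [← hc, hc', add_right_comm]
    exact (eq_zero_of_proportional hnp hw (by decide : (0 : Fin 3) ≠ 1) (e1 0) (e1 1)).1
  refine ext_pr i fun d n => ?_
  rw [hc, key, zero_mul]; rfl

/-- The shared splitting identifies the parameters of the two lines; the other two splittings then
impose a homogeneous system of rank two, because the weights are not proportional. -/
theorem dualSub_inter_dual_eq_zero {w : Fin 2 → Fin 3 → ℂ}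
    (hnp : ∀ m n, m ≠ n → w 0 m * w 1 n ≠ w 0 n * w 1 m) (hw : ∀ e m, w e m ≠ 0)
    {i j : Fin 4} (hij : i ≠ j) {e : Fin 2} {v : Fin 6 → ℂ}
    (h : v ∈ dualSub w i e) (h' : v ∈ dualSub w j e) : v = 0 := by
  obtain ⟨m, hm, hm1, hm2⟩ := exists_common_shift hij
  obtain ⟨c, hc⟩ := h
  obtain ⟨c', hc'⟩ := h'
  have hcc : ∀ d, c' d = c d := by
    intro d
    have := hc' d m
    rw [← hm, hc] at this
    exact (mul_right_cancel₀ (hw _ _) this).symm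
  have h1 : c 0 * w e (m + 1) = c 1 * w (e + 1) (m + 1) := by
    have := hc 0 (m + 1)
    rw [hm1, hc', hcc, zero_add, add_zero] at this
    exact this.symm
  have h2 : c 0 * w e (m + 2) = c 1 * w (e + 1) (m + 2) := by
    have := hc 0 (m + 2)
    rw [hm2, hc', hcc, zero_add, add_zero] at this
    exact this.symm
  obtain ⟨k0, k1⟩ := eq_zero_of_proportional hnp hw (by simp : m + 1 ≠ m + 2) h1 h2
  refine ext_pr i fun d n => ?_
  rw [hc]
  rcases fin2_eq_or 0 d with rfl | rfl
  · rw [k0, zero_mul]; rfl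
  · rw [zero_add, k1, zero_mul]; rfl

/-- With opposite values the splittings m + 1 and m + 2 merely identify the parameters crosswise,
and the splitting m leaves a single linear equation. -/
theorem dualSub_inter_dual {w : Fin 2 → Fin 3 → ℂ} (hw : ∀ e m, w e m ≠ 0)
    {i j : Fin 4} {e : Fin 2} {m : Fin 3} (hm : ∀ d, pr i d m = pr j d m)
    (hm1 : ∀ d, pr i d (m + 1) = pr j (d + 1) (m + 1))
    (hm2 : ∀ d, pr i d (m + 2) = pr j (d + 1) (m + 2)) (v : Fin 6 → ℂ) :
    (v ∈ dualSub w i e ∧ v ∈ dualSub w j (e + 1)) ↔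
      ∃ c : ℂ, v = c • dualParam w i e (fun d => w (e + d + 1) m) := by
  have two : ∀ d : Fin 2, d = 0 ∨ d = 1 := by decide
  constructor
  · rintro ⟨⟨c, hc⟩, c', hc'⟩
    have h1 : ∀ d, c' (d + 1) = c d := by
      intro d
      have := hc d (m + 1)
      rw [hm1, hc', fin2_shift₁] at this
      exact mul_right_cancel₀ (hw _ _) this
    have h2 : c 0 * w e m = c 1 * w (e + 1) m := by
      have := hc 0 m
      rw [hm, hc', add_zero, add_zero, ← fin2_add_one_add_one 0, h1] at this
      exact this.symm
    refine ⟨c 0 / w (e + 1) m, ext_pr i fun d n => ?_⟩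
    rw [Pi.smul_apply, smul_eq_mul, dualParam_pr, hc, ← mul_assoc]
    congr 1
    rcases two d with rfl | rfl
    · rw [add_zero]; exact (div_mul_cancel₀ _ (hw _ _)).symm
    · rw [fin2_add_one_add_one]
      have := hw (e + 1) m
      field_simp
      exact h2.symm
  · rintro ⟨c, rfl⟩
    refine ⟨Submodule.smul_mem _ _ (range_dualParam w i e ▸ LinearMap.mem_range_self _ _),
      Submodule.smul_mem _ _ ⟨fun d => w (e + d) m, fun d n => ?_⟩⟩
    rcases fin3_cases m n with rfl | rfl | rfl
    · rw [← hm, dualParam_pr, mul_comm, add_right_comm]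
    · have := hm1 (d + 1)
      rw [fin2_add_one_add_one] at this
      rw [← this, dualParam_pr, fin2_shift₂,
        fin2_shift₃]
    · have := hm2 (d + 1)
      rw [fin2_add_one_add_one] at this
      rw [← this, dualParam_pr, fin2_shift₂,
        fin2_shift₃]

theorem dualParam_ne_zero {w : Fin 2 → Fin 3 → ℂ} (hw : ∀ e m, w e m ≠ 0) (i : Fin 4) (e d : Fin 2)
    {s : Fin 2 → ℂ} (hs : s d ≠ 0) : dualParam w i e s ≠ 0 := by
  intro h
  have := congrFun h (pr i d 0)
  rw [dualParam_pr] at this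
  exact mul_ne_zero hs (hw _ _) this

/-- Two lines which do not meet. -/
theorem linSub_inter_eq_zero {w : Fin 2 → Fin 3 → ℂ}
    (hnp : ∀ m n, m ≠ n → w 0 m * w 1 n ≠ w 0 n * w 1 m) (hw : ∀ e m, w e m ≠ 0)
    {l m : LineName} (hlm : l ≠ m) (h : ¬ l.Meets m) {v : Fin 6 → ℂ} (hl : v ∈ linSub w l)
    (hm : v ∈ linSub w m) : v = 0 := by
  rcases l with ⟨i, d⟩ | ⟨i, d⟩ <;> rcases m with ⟨j, e⟩ | ⟨j, e⟩
  · have h : ¬ (i ≠ j ∧ d ≠ e) := h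
    by_cases hij : i = j
    · subst hij
      have hde : d ≠ e := fun h => hlm (by rw [h])
      have hm : v ∈ lineSub i e.idx := hm
      rw [Diamond.idx_ne hde] at hm
      exact lineSub_inter_self_eq_zero hl hm
    · have hde : d = e := by by_contra hde; exact h ⟨hij, hde⟩
      subst hde
      exact lineSub_inter_line_eq_zero hij hl hm
  · exact lineSub_inter_dual_eq_zero hw h hl hm
  · exact lineSub_inter_dual_eq_zero hw (fun hij => h hij.symm) hm hl
  · have h : ¬ (i ≠ j ∧ d ≠ e) := h
    by_cases hij : i = j
    · subst hij
      have hde : d ≠ e := fun h => hlm (by rw [h])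
      have hm : v ∈ dualSub w i e.idx := hm
      rw [Diamond.idx_ne hde] at hm
      exact dualSub_inter_self_eq_zero hnp hw hl hm
    · have hde : d = e := by by_contra hde; exact h ⟨hij, hde⟩
      subst hde
      exact dualSub_inter_dual_eq_zero hnp hw hij hl hm

/-- Two lines which meet do so in a point. -/
theorem linSub_inter_of_meets {w : Fin 2 → Fin 3 → ℂ} (hw : ∀ e m, w e m ≠ 0)
    (hs : ∀ e, ∑ m, w e m = 0) {l m : LineName} (h : l.Meets m) :
    ∃ u ≠ 0, ∀ v, (v ∈ linSub w l ∧ v ∈ linSub w m) ↔ ∃ c : ℂ, v = c • u := by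
  rcases l with ⟨i, d⟩ | ⟨i, d⟩ <;> rcases m with ⟨j, e⟩ | ⟨j, e⟩
  · obtain ⟨hij, hde⟩ := h
    obtain ⟨m, hm, hm1, hm2⟩ := exists_common_shift hij
    refine ⟨diffVec i d.idx m, fun h => ?_, fun v => ?_⟩
    · have := (diffVec_other i d.idx m).2.1
      rw [h] at this
      exact zero_ne_one this
    · rw [← lineSub_inter_line hm hm1 hm2, ← Diamond.idx_ne hde]; rfl
  · obtain rfl : i = j := h
    refine ⟨_, dualParam_ne_zero hw i e.idx (d.idx + 1) (s := Pi.single (d.idx + 1) 1) (by simp),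
      fun v => ?_⟩
    rw [← lineSub_inter_dual hw hs]; rfl
  · obtain rfl : i = j := h
    refine ⟨_, dualParam_ne_zero hw i d.idx (e.idx + 1) (s := Pi.single (e.idx + 1) 1) (by simp),
      fun v => ?_⟩
    rw [← lineSub_inter_dual hw hs, and_comm]; rfl
  · obtain ⟨hij, hde⟩ := h
    obtain ⟨m, hm, hm1, hm2⟩ := exists_common_shift hij
    refine ⟨_, dualParam_ne_zero hw i d.idx 0 (s := fun d' => w (d.idx + d' + 1) m) (hw _ _),
      fun v => ?_⟩
    rw [← dualSub_inter_dual hw hm hm1 hm2, ← Diamond.idx_ne hde]; rfl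


/-! ### Special Tyurin parameters -/

theorem sg_mem_signs (e : Fin 2) : sg e ∈ signs := by
  fin_cases e
  · exact one_mem_signs
  · exact neg_one_mem_signs

theorem sg_add_one (e : Fin 2) : sg (e + 1) = -sg e := by
  fin_cases e
  · rfl
  · simp [sg]

theorem mono_pr (r : Fin 4 → Fin 2 → ℂ) (k : Fin 4) (d : Fin 2) (m : Fin 3) :
    mono r (pr k d m) = r k d * r (oth k m) d *
      (r (oth k (m + 1)) (d + 1) * r (oth k (m + 2)) (d + 1)) := by
  have h2 : (1 : Fin 2) + 1 = 0 := rfl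
  have h3 : (2 : Fin 3) + 1 = 0 := rfl
  have h4 : (2 : Fin 3) + 2 = 1 := rfl
  have h5 : (1 : Fin 3) + 2 = 0 := rfl
  fin_cases k <;> fin_cases d <;> fin_cases m <;> simp [pr, oth, mono, h2, h3, h4, h5] <;> ring

theorem oth_ne : ∀ k m, oth k m ≠ k := by decide

theorem oth_ne_oth : ∀ k m n, m ≠ n → oth k m ≠ oth k n := by decide

theorem exists_oth : ∀ k j, j ≠ k → ∃ m, j = oth k m := by decide

namespace Params

variable (P : Params)

/-- The exponents `±θ₀` of the two rows of a connection matrix. -/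
def ex (e : Fin 2) : ℂ := sg e * P.θ0

theorem ex_add_one (e : Fin 2) : P.ex (e + 1) = -P.ex e := by
  rw [ex, sg_add_one, neg_mul]; rfl

theorem Tpoly_ex (e : Fin 2) (r : Fin 4 → Fin 2 → ℂ) : P.Tpoly (P.ex e) r = P.Tpoly P.θ0 r := by
  rcases fin2_eq_or 0 e with rfl | rfl
  · simp [ex, sg]
  · rw [ex_add_one, Tpoly_neg]; simp [ex, sg]

/-- The exponents of the products `x_i x_j`. -/
def xs : Fin 6 → ℂ := ![P.xi 0 + P.xi 1, P.xi 0 + P.xi 2, P.xi 0 + P.xi 3, P.xi 1 + P.xi 2,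
  P.xi 1 + P.xi 3, P.xi 2 + P.xi 3]

theorem sum_xi : P.xi 0 + P.xi 1 + P.xi 2 + P.xi 3 = 2 * P.kap := by
  simp [xi]; ring

theorem xs_pr (k : Fin 4) (m : Fin 3) : P.xs (pr k 0 m) = P.xi (oth k m) + P.xi k := by
  fin_cases k <;> fin_cases m <;> simp [pr, oth, xs] <;> ring

theorem xs_pr_one (k : Fin 4) (m : Fin 3) :
    P.xs (pr k 1 m) = 2 * P.kap - P.xs (pr k 0 m) := by
  rw [← P.sum_xi]
  fin_cases k <;> fin_cases m <;> simp [pr, xs] <;> ring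

/-- The linear factor of a row with exponent `s` whose entries vanish at `x_k`. -/
def fac (s : ℂ) (k : Fin 4) (d : Fin 2) (z : ℂ) : ℂ := qTheta P.q (z * P.x k / P.mu s d)

/-- The value of `fac` at `x_j`. -/
def facAt (e : Fin 2) (k : Fin 4) (d : Fin 2) (j : Fin 4) : ℂ :=
  P.vt (P.xi j + P.xi k - P.nu (P.ex e) d)

/-- The point with coordinates `T_{ij} ρ_i ρ_j`. -/
def tv (r : Fin 4 → Fin 2 → ℂ) : Fin 6 → ℂ := fun p => P.T p * mono r p

theorem sum_tv (r : Fin 4 → Fin 2 → ℂ) : ∑ p, P.tv r p = P.Tpoly P.θ0 r := rfl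

/-- Tyurin parameters with an arbitrary value at `k`, for which a row of the connection matrix
vanishes at `x_k`. -/
def dualR (k : Fin 4) (e : Fin 2) (v : Fin 2 → ℂ) : Fin 4 → Fin 2 → ℂ := fun j d =>
  if j = k then v d else P.facAt e k d j

/-- The quotients `T_{ij} θ_q(x_i x_j / μ₀) / θ_q(x_i x_j / μ₁)`. -/
def Wf (e : Fin 2) (p : Fin 6) : ℂ :=
  P.T p * (P.vt (P.xs p - P.nu (P.ex e) 0) / P.vt (P.xs p - P.nu (P.ex e) 1))

/-- The coefficients of the dual lines. -/
def lw (e : Fin 2) (m : Fin 3) : ℂ := P.Wf e (pr 0 0 m)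

/-- Product of the values of `fac` at the points different from `x_k`. -/
def facProd (e : Fin 2) (k : Fin 4) (d : Fin 2) : ℂ :=
  P.facAt e k d (oth k 0) * P.facAt e k d (oth k 1) * P.facAt e k d (oth k 2)

theorem facProd_eq (e : Fin 2) (k : Fin 4) (d : Fin 2) (m : Fin 3) :
    P.facProd e k d = P.facAt e k d (oth k m) * (P.facAt e k d (oth k (m + 1)) *
      P.facAt e k d (oth k (m + 2))) := by
  rw [facProd]
  fin_cases m
  · simp only [Fin.zero_eta, zero_add]; ring
  · simp only [Fin.mk_one, Fin.reduceAdd]; ring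
  · simp only [Fin.reduceFinMk, Fin.reduceAdd]; ring

theorem facAt_eq (k : Fin 4) (e d : Fin 2) (m : Fin 3) :
    P.facAt e k d (oth k m) = P.vt (P.xs (pr k 0 m) - P.nu (P.ex e) d) := by
  rw [P.xs_pr, facAt]

theorem Wf_pr_zero (k : Fin 4) (e : Fin 2) (m : Fin 3) : P.Wf e (pr k 0 m) =
    P.T (pr k 0 m) * (P.facAt e k 0 (oth k m) / P.facAt e k 1 (oth k m)) := by
  rw [Wf, P.facAt_eq, P.facAt_eq]

namespace Admissible

variable {P} (hP : P.Admissible)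

include hP

theorem x_eq (j : Fin 4) : P.x j = P.pow (P.xi j) :=
  P.x_eq hP.q_pos hP.q_lt_one hP.t0_ne_zero j

theorem x_ne_zero (j : Fin 4) : P.x j ≠ 0 :=
  P.x_ne_zero hP.q_pos hP.q_lt_one hP.t0_ne_zero j

theorem mu_ne_zero (s : ℂ) (d : Fin 2) : P.mu s d ≠ 0 := P.mu_ne_zero hP.q_pos s d

theorem th_x_div {i j : Fin 4} : qTheta P.q (P.x i / P.x j) = P.vt (P.xi i - P.xi j) := by
  rw [hP.x_eq, hP.x_eq, P.th_div hP.q_pos]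

theorem th_x_div_ne_zero {i j : Fin 4} (h : i ≠ j) : qTheta P.q (P.x i / P.x j) ≠ 0 := by
  rw [hP.th_x_div]; exact hP.vt_xi_sub h

theorem fac_x (e : Fin 2) (k : Fin 4) (d : Fin 2) (j : Fin 4) :
    P.fac (P.ex e) k d (P.x j) = P.facAt e k d j := by
  rw [fac, facAt, hP.x_eq, hP.x_eq, mu, P.th_mul_div hP.q_pos]

theorem facAt_ne_zero (e : Fin 2) {k j : Fin 4} (h : j ≠ k) (d : Fin 2) :
    P.facAt e k d j ≠ 0 :=
  hP.vt_xi_add h (sg_mem_signs e) (sg_mem_signs d)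

theorem th_x_mul_div_ne_zero (e : Fin 2) {k j : Fin 4} (h : j ≠ k) (d : Fin 2) :
    qTheta P.q (P.x j * P.x k / P.mu (P.ex e) d) ≠ 0 := by
  have := hP.facAt_ne_zero e h d
  rwa [← hP.fac_x] at this

theorem facProd_ne_zero (e : Fin 2) (k : Fin 4) (d : Fin 2) : P.facProd e k d ≠ 0 := by
  have := fun m => hP.facAt_ne_zero e (oth_ne k m) d
  exact mul_ne_zero (mul_ne_zero (this 0) (this 1)) (this 2)

/-- Every theta factor of T_ij belongs to a quotient of two points x_k or to a product x_i x_j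
divided by a multiplier, and both kinds are excluded by the assumptions. -/
theorem T_ne_zero (p : Fin 6) : P.T p ≠ 0 := by
  have key := P.interpCoeff_eq hP.q_pos hP.q_lt_one hP.t0_ne_zero P.θ0 p
  have hw : ∀ k l d, k ≠ l → P.x l * (qTheta P.q (P.x k / P.x l) *
      qTheta P.q (P.x k * P.x l / P.mu P.θ0 d)) ≠ 0 := by
    intro k l d hkl
    refine mul_ne_zero (hP.x_ne_zero l) (mul_ne_zero (hP.th_x_div_ne_zero hkl) ?_)
    have := hP.th_x_mul_div_ne_zero 0 hkl d
    simpa [ex, sg] using this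
  intro h
  rw [Tat_θ0, h, mul_zero] at key
  revert key
  fin_cases p <;> simp only [interpCoeff, Matrix.cons_val, Fin.reduceFinMk] <;>
    (try simp only [neg_eq_zero]) <;> refine mul_ne_zero (hw _ _ _ ?_) (hw _ _ _ ?_) <;> decide

theorem isTheta_fac (s : ℂ) (k : Fin 4) (d : Fin 2) :
    IsTheta P.q 1 (P.mu s d / P.x k) (P.fac s k d) := by
  have := isTheta_qTheta hP.q_pos hP.q_lt_one (div_ne_zero (hP.mu_ne_zero s d) (hP.x_ne_zero k))
  simp only [div_div_eq_mul_div] at this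
  exact this

theorem hasInterpolant_iff (s : ℂ) (r : Fin 4 → Fin 2 → ℂ) :
    HasInterpolant P.q P.x (P.mu s) r ↔ P.Tpoly s r = 0 :=
  P.hasInterpolant_iff hP.q_pos hP.q_lt_one hP.t0_ne_zero s r

theorem isTheta_mul_fac (s : ℂ) (k : Fin 4) (d : Fin 2) :
    IsTheta P.q 2 (P.mu s d) (fun z => qTheta P.q (z / P.x k) * P.fac s k d z) :=
  isTheta_mul_shift hP.q_pos hP.q_lt_one (hP.mu_ne_zero s d) (hP.x_ne_zero k)

/-- The row with a zero at `x_k` interpolates `dualR`. -/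
theorem dualR_interpolates (k : Fin 4) (e : Fin 2) (v : Fin 2 → ℂ) (j : Fin 4) :
    P.dualR k e v j 1 * (qTheta P.q (P.x j / P.x k) * P.fac (P.ex e) k 0 (P.x j)) =
      P.dualR k e v j 0 * (qTheta P.q (P.x j / P.x k) * P.fac (P.ex e) k 1 (P.x j)) := by
  by_cases h : j = k
  · subst h
    rw [div_self (hP.x_ne_zero j), qTheta_one hP.q_pos hP.q_lt_one]; ring
  · simp only [dualR, if_neg h, hP.fac_x]; ring

/-- The row vanishes at x_k and therefore imposes nothing on the value v there. -/
theorem dualR_Tpoly (k : Fin 4) (e : Fin 2) (v : Fin 2 → ℂ) :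
    P.Tpoly P.θ0 (P.dualR k e v) = 0 := by
  rw [← P.Tpoly_ex e, ← hP.hasInterpolant_iff]
  refine ⟨fun d z => qTheta P.q (z / P.x k) * P.fac (P.ex e) k d z,
    fun d => hP.isTheta_mul_fac _ k d, ⟨P.x (oth k 0), 0, hP.x_ne_zero _, ?_⟩,
    hP.dualR_interpolates k e v⟩
  simp only [hP.fac_x]
  exact mul_ne_zero (hP.th_x_div_ne_zero (oth_ne k 0)) (hP.facAt_ne_zero e (oth_ne k 0) 0)

theorem tv_dualR_pr (k : Fin 4) (e : Fin 2) (v : Fin 2 → ℂ) (d : Fin 2) (m : Fin 3) :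
    P.tv (P.dualR k e v) (pr k d m) = v d * P.facProd e k (d + 1) *
      (P.T (pr k d m) * (P.facAt e k d (oth k m) / P.facAt e k (d + 1) (oth k m))) := by
  have h := hP.facAt_ne_zero e (oth_ne k m) (d + 1)
  rw [tv, mono_pr, P.facProd_eq e k (d + 1) m]
  simp only [dualR, if_neg (oth_ne k _), if_true]
  field_simp

/-- The products over complementary pairs multiply to t₀², as do the multipliers for opposite
exponents and opposite columns; reflection of the theta function relates the two values. -/
theorem vt_xs_comp (k : Fin 4) (e d : Fin 2) (m : Fin 3) :
    P.vt (P.xs (pr k 1 m) - P.nu (P.ex (e + 1)) (d + 1)) =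
      -(P.pow (P.nu (P.ex e) d - P.xs (pr k 0 m)) * P.facAt e k d (oth k m)) := by
  rw [P.facAt_eq, ← neg_sub (P.xs _), ← P.vt_neg hP.q_pos hP.q_lt_one, P.xs_pr_one, nu, nu,
    P.ex_add_one, sg_add_one]
  congr 1; ring

theorem Wf_pr_one (k : Fin 4) (e : Fin 2) (m : Fin 3) : P.Wf (e + 1) (pr k 1 m) =
    P.pow (-(2 * P.θi)) *
      (P.T (pr k 1 m) * (P.facAt e k 1 (oth k m) / P.facAt e k 0 (oth k m))) := by
  have h0 := hP.vt_xs_comp k e 0 m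
  have h1 := hP.vt_xs_comp k e 1 m
  rw [show (1 : Fin 2) + 1 = 0 from rfl] at h1
  rw [zero_add] at h0
  have n0 := hP.facAt_ne_zero e (oth_ne k m) 0
  have n1 := hP.facAt_ne_zero e (oth_ne k m) 1
  have p0 := P.pow_ne_zero hP.q_pos (P.nu (P.ex e) 0 - P.xs (pr k 0 m))
  have e1 : P.pow (P.nu (P.ex e) 1 - P.xs (pr k 0 m)) =
      P.pow (-(2 * P.θi)) * P.pow (P.nu (P.ex e) 0 - P.xs (pr k 0 m)) := by
    rw [← P.pow_add hP.q_pos]; congr 1; simp [nu, sg]; ring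
  rw [Wf, h0, h1, e1]
  field_simp

/-- With the value ∞ at k in T(ρ) = 0 only the three pairs through k survive. -/
theorem sum_Wf (k : Fin 4) (e : Fin 2) : ∑ m, P.Wf e (pr k 0 m) = 0 := by
  have h := hP.dualR_Tpoly k e (Pi.single 0 1)
  rw [← P.sum_tv, sum_pr k 0] at h
  simp only [hP.tv_dualR_pr, zero_add, Pi.single_eq_same, one_mul,
    Pi.single_eq_of_ne (by decide : (1 : Fin 2) ≠ 0), zero_mul, Finset.sum_const_zero,
    add_zero, ← Finset.mul_sum] at h
  simp only [P.Wf_pr_zero]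
  exact (mul_eq_zero.mp h).resolve_left (hP.facProd_ne_zero e k 1)

/-- The quotients take the same value on complementary pairs. -/
theorem Wf_pr (k : Fin 4) (d e : Fin 2) (m : Fin 3) : P.Wf e (pr k d m) = P.lw e m := by
  have s := fun k => hP.sum_Wf k e
  simp only [Fin.sum_univ_three, pr] at s
  have s0 := s 0
  have s1 := s 1
  have s2 := s 2
  have s3 := s 3
  simp only [Matrix.cons_val] at s0 s1 s2 s3
  -- Six numbers on the edges of the complete graph with sum zero at each of the four vertices agree
  -- on opposite edges.
  have e0 : P.Wf e 5 = P.Wf e 0 := by linear_combination (s2 + s3 - s0 - s1) / 2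
  have e1 : P.Wf e 4 = P.Wf e 1 := by linear_combination (s1 + s3 - s0 - s2) / 2
  have e2 : P.Wf e 3 = P.Wf e 2 := by linear_combination (s1 + s2 - s0 - s3) / 2
  rw [lw]
  fin_cases k <;> fin_cases d <;> fin_cases m <;> simp [pr, e0, e1, e2]

theorem sum_lw (e : Fin 2) : ∑ m, P.lw e m = 0 := hP.sum_Wf 0 e

theorem lw_ne_zero (e : Fin 2) (m : Fin 3) : P.lw e m ≠ 0 := by
  rw [lw, P.Wf_pr_zero]
  exact mul_ne_zero (hP.T_ne_zero _) (div_ne_zero (hP.facAt_ne_zero e (oth_ne _ _) _)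
    (hP.facAt_ne_zero e (oth_ne _ _) _))

/-- The theta quotients of the two exponents cancel over complementary pairs. Hence the quadratic
equations with b₁ and b₂ are those of `SegreForm` for these weights. -/
theorem lw_mul_lw (m : Fin 3) : P.lw 0 m * P.lw 1 m =
    P.pow (-(2 * P.θi)) * (P.T (pr 0 0 m) * P.T (pr 0 1 m)) := by
  have h := hP.Wf_pr_one 0 0 m
  rw [zero_add, hP.Wf_pr] at h
  rw [h, lw, P.Wf_pr_zero]
  have n0 := hP.facAt_ne_zero 0 (oth_ne 0 m) 0
  have n1 := hP.facAt_ne_zero 0 (oth_ne 0 m) 1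
  field_simp

/-- The factors relating the parameters of `dualParam` to the value at `x_k`. -/
theorem tv_dualR (k : Fin 4) (e : Fin 2) (v : Fin 2 → ℂ) : P.tv (P.dualR k e v) =
    dualParam P.lw k e
      ![v 0 * P.facProd e k 1, v 1 * P.facProd e k 0 * P.pow (2 * P.θi)] := by
  refine ext_pr k fun d m => ?_
  rw [hP.tv_dualR_pr, dualParam_pr]
  rcases fin2_eq_or 0 d with rfl | rfl
  · rw [zero_add, add_zero, ← P.Wf_pr_zero, hP.Wf_pr]; rfl
  · rw [zero_add, show (1 : Fin 2) + 1 = 0 from rfl, ← hP.Wf_pr k 1, hP.Wf_pr_one]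
    have : P.pow (2 * P.θi) * P.pow (-(2 * P.θi)) = 1 := by
      rw [← P.pow_add hP.q_pos, add_neg_cancel, P.pow_zero]
    simp only [Matrix.cons_val_one, Matrix.cons_val_fin_one]
    linear_combination -(v 1 * P.facProd e k 0) *
      (P.T (pr k 1 m) * (P.facAt e k 1 (oth k m) / P.facAt e k 0 (oth k m))) * this

end Admissible
end Params

/-! ### Connection matrices -/

theorem cross_eq_of_interpolates {a b c d u v : ℂ} (h : u ≠ 0 ∨ v ≠ 0) (h1 : v * a = u * b)
    (h2 : v * c = u * d) : a * d - b * c = 0 := by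
  rcases h with h | h
  · apply mul_left_cancel₀ h
    linear_combination c * h1 - a * h2
  · apply mul_left_cancel₀ h
    linear_combination d * h1 - b * h2

theorem ne_zero_fin2 {v : Fin 2 → ℂ} (h : v ≠ 0) : v 0 ≠ 0 ∨ v 1 ≠ 0 := by
  by_contra! hcon
  apply h
  funext i
  fin_cases i
  · exact hcon.1
  · exact hcon.2

/-- Proportional vectors of `ℂ²`. -/
theorem exists_smul_of_cross {u v : Fin 2 → ℂ} (hu : u ≠ 0) (hv : v ≠ 0)
    (h : u 0 * v 1 = u 1 * v 0) : ∃ c : ℂ, c ≠ 0 ∧ u = c • v := by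
  rcases ne_zero_fin2 hv with h0 | h0
  · have : u = (u 0 / v 0) • v := by
      funext i
      fin_cases i
      · simp [h0]
      · simp only [Fin.mk_one, Pi.smul_apply, smul_eq_mul]; field_simp; linear_combination -h
    exact ⟨_, fun hc => hu (by rw [this, hc, zero_smul]), this⟩
  · have : u = (u 1 / v 1) • v := by
      funext i
      fin_cases i
      · simp only [Fin.zero_eta, Pi.smul_apply, smul_eq_mul]; field_simp; linear_combination h
      · simp [h0]
    exact ⟨_, fun hc => hu (by rw [this, hc, zero_smul]), this⟩

namespace Params

variable (P : Params)

/-- Rows with exponent `s`. -/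
def IsRow (s : ℂ) (f : Fin 2 → ℂ → ℂ) : Prop := ∀ d, IsTheta P.q 2 (P.mu s d) (f d)

/-- The values of the row `f` at the points `x_j` are proportional to `r j`. -/
def Interpolates (f : Fin 2 → ℂ → ℂ) (r : Fin 4 → Fin 2 → ℂ) : Prop :=
  ∀ j, r j 1 * f 0 (P.x j) = r j 0 * f 1 (P.x j)

theorem mono_smul (r r' : Fin 4 → Fin 2 → ℂ) (c : Fin 4 → ℂ) (h : ∀ j, r j = c j • r' j)
    (p : Fin 6) : mono r p = (c 0 * c 1 * c 2 * c 3) * mono r' p := by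
  fin_cases p <;> simp [mono, h] <;> ring

namespace Admissible

variable {P} (hP : P.Admissible)

include hP

theorem prod_x : ∏ i, P.x i = P.pow (2 * P.kap) := by
  rw [Fin.prod_univ_four, hP.x_eq, hP.x_eq, hP.x_eq, hP.x_eq, ← P.pow_add hP.q_pos,
    ← P.pow_add hP.q_pos, ← P.pow_add hP.q_pos, P.sum_xi]

theorem isTheta_cross {s s' : ℂ} {f g : Fin 2 → ℂ → ℂ} (hf : P.IsRow s f) (hg : P.IsRow s' g) :
    IsTheta P.q 4 (P.pow (2 * P.kap + (s + s'))) (fun z => f 0 z * g 1 z - f 1 z * g 0 z) := by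
  refine (((hf 0).mul (hg 1)).congr_const ?_).sub (((hf 1).mul (hg 0)).congr_const ?_) <;>
  · rw [mu, mu, ← P.pow_add hP.q_pos]; congr 1; simp [nu, sg]; ring

/-- The rows are parallel at each x_j, so the cross product contains all four theta factors. The
product of the x_j is q^(2κ), which leaves the multiplier q^(s+s'). -/
theorem exists_cross {s s' : ℂ} {f g : Fin 2 → ℂ → ℂ} (hf : P.IsRow s f) (hg : P.IsRow s' g)
    {r : Fin 4 → Fin 2 → ℂ} (hr : ∀ j, r j ≠ 0) (hfr : P.Interpolates f r)
    (hgr : P.Interpolates g r) :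
    ∃ h, IsTheta P.q 0 (P.pow (s + s')) h ∧ ∀ z, z ≠ 0 →
      f 0 z * g 1 z - f 1 z * g 0 z = (∏ i, qTheta P.q (z / P.x i)) * h z := by
  obtain ⟨h, hh, e⟩ := (hP.isTheta_cross hf hg).exists_prod hP.q_pos hP.q_lt_one
    (P.pow_ne_zero hP.q_pos _) P.x hP.x_ne_zero (fun i j hij => hP.th_x_div_ne_zero hij)
    (fun j => cross_eq_of_interpolates (ne_zero_fin2 (hr j)) (hfr j) (hgr j))
  refine ⟨h, hh.congr_const ?_, e⟩
  rw [hP.prod_x, P.pow_add hP.q_pos, mul_div_cancel_left₀ _ (P.pow_ne_zero hP.q_pos _)]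

theorem cross_eq_zero {s s' : ℂ} {f g : Fin 2 → ℂ → ℂ} (hf : P.IsRow s f) (hg : P.IsRow s' g)
    {r : Fin 4 → Fin 2 → ℂ} (hr : ∀ j, r j ≠ 0) (hfr : P.Interpolates f r)
    (hgr : P.Interpolates g r) (hs : P.vt (s + s') ≠ 0) {z : ℂ} (hz : z ≠ 0) :
    f 0 z * g 1 z = f 1 z * g 0 z := by
  obtain ⟨h, hh, e⟩ := hP.exists_cross hf hg hr hfr hgr
  have := e z hz
  rw [hh.eq_zero hP.q_pos hP.q_lt_one (P.pow_ne_zero hP.q_pos _) hs hz, mul_zero] at this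
  exact sub_eq_zero.mp this

theorem exists_prod_ne_zero : ∃ z, z ≠ 0 ∧ ∏ i, qTheta P.q (z / P.x i) ≠ 0 := by
  by_contra! hcon
  have ht := fun i => isTheta_qTheta hP.q_pos hP.q_lt_one (hP.x_ne_zero i)
  have hne : ∀ i, ¬ ∀ z, z ≠ 0 → qTheta P.q (z / P.x i) = 0 := by
    intro i h
    have := h (-P.x i) (neg_ne_zero.mpr (hP.x_ne_zero i))
    rw [neg_div, div_self (hP.x_ne_zero i)] at this
    exact qTheta_neg_one_ne_zero hP.q_pos hP.q_lt_one this
  simp only [Fin.prod_univ_four] at hcon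
  have h1 := ((((ht 0).mul (ht 1)).mul (ht 2)).eq_zero_or_eq_zero (ht 3) hcon).resolve_right (hne 3)
  have h2 := (((ht 0).mul (ht 1)).eq_zero_or_eq_zero (ht 2) h1).resolve_right (hne 2)
  have h3 := ((ht 0).eq_zero_or_eq_zero (ht 1) h2).resolve_right (hne 1)
  exact hne 0 h3

theorem det_factor (z : ℂ) : P.th (P.pow (-P.θt) * (z / P.t0)) * P.th (P.pow P.θt * (z / P.t0)) *
    P.th (P.pow (-P.θ1) * z) * P.th (P.pow P.θ1 * z) = ∏ i, qTheta P.q (z / P.x i) := by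
  have ht := hP.t0_ne_zero
  have n1 := P.pow_ne_zero hP.q_pos P.θt
  have n2 := P.pow_ne_zero hP.q_pos P.θ1
  rw [Fin.prod_univ_four]
  simp only [th, x, P.pow_neg, Matrix.cons_val]
  rw [show (P.pow P.θt)⁻¹ * (z / P.t0) = z / (P.pow P.θt * P.t0) by field_simp,
    show P.pow P.θt * (z / P.t0) = z / ((P.pow P.θt)⁻¹ * P.t0) by field_simp,
    show (P.pow P.θ1)⁻¹ * z = z / P.pow P.θ1 by field_simp,
    show P.pow P.θ1 * z = z / (P.pow P.θ1)⁻¹ by field_simp]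

theorem mu_ex (i d : Fin 2) : P.mu (P.ex i) d = P.t0 * ![P.pow P.θ0, P.pow (-P.θ0)] i *
    ![P.pow P.θi, P.pow (-P.θi)] d := by
  rw [mu, nu, P.pow_add hP.q_pos, P.pow_add hP.q_pos,
    P.pow_kap hP.q_pos hP.q_lt_one hP.t0_ne_zero, ex]
  congr 1
  · congr 1
    fin_cases i <;> simp [sg]
  · fin_cases d <;> simp [sg]

section Connection

variable {C : ℂ → Matrix (Fin 2) (Fin 2) ℂ} (hC : P.IsConnectionMatrix C)

include hC

theorem isRow (i : Fin 2) : P.IsRow (P.ex i) (fun d z => C z i d) := by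
  intro d
  refine ⟨hC.analytic i d, fun z hz => ?_⟩
  have := congrFun (congrFun (hC.qdiff z hz) i) d
  rw [Matrix.smul_apply, Matrix.mul_diagonal, Matrix.diagonal_mul, smul_eq_mul] at this
  show C (↑P.q * z) i d * (-z) ^ 2 = P.mu (P.ex i) d * C z i d
  rw [this, hP.mu_ex]
  field_simp

theorem exists_det : ∃ c : ℂ, c ≠ 0 ∧ ∀ z, z ≠ 0 →
    C z 0 0 * C z 1 1 - C z 0 1 * C z 1 0 = c * ∏ i, qTheta P.q (z / P.x i) := by
  obtain ⟨c, hc, h⟩ := hC.det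
  refine ⟨c, hc, fun z hz => ?_⟩
  rw [← Matrix.det_fin_two, h z hz, hP.det_factor]

theorem exists_det_ne_zero : ∃ z, z ≠ 0 ∧ C z 0 0 * C z 1 1 - C z 0 1 * C z 1 0 ≠ 0 := by
  obtain ⟨c, hc, h⟩ := hP.exists_det hC
  obtain ⟨z, hz, hz'⟩ := hP.exists_prod_ne_zero
  exact ⟨z, hz, by rw [h z hz]; exact mul_ne_zero hc hz'⟩

theorem det_x (j : Fin 4) : (C (P.x j)).det = 0 := by
  obtain ⟨c, hc, h⟩ := hP.exists_det hC
  rw [Matrix.det_fin_two, h _ (hP.x_ne_zero j), Finset.prod_eq_zero (Finset.mem_univ j), mul_zero]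
  rw [div_self (hP.x_ne_zero j), qTheta_one hP.q_pos hP.q_lt_one]

/-- A zero matrix at x_j would give the determinant a double zero there, whereas the theta product
has a simple one. -/
theorem x_value_ne_zero (j : Fin 4) : C (P.x j) ≠ 0 := by
  intro h0
  obtain ⟨c, hc, h⟩ := hP.exists_det hC
  have hxj := hP.x_ne_zero j
  have hv : ∀ i d, C (P.x j) i d = 0 := fun i d => by rw [h0]; rfl
  have hd : ∀ i d, HasDerivAt (fun z => C z i d) (deriv (fun z => C z i d) (P.x j)) (P.x j) :=
    fun i d => (hC.analytic i d _ hxj).differentiableAt.hasDerivAt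
  have d1 := ((hd 0 0).mul (hd 1 1)).sub ((hd 0 1).mul (hd 1 0))
  simp only [hv, mul_zero, zero_mul, add_zero, sub_zero] at d1
  have ht := fun i : Fin 4 => (qTheta_div_analytic hP.q_pos hP.q_lt_one (hP.x_ne_zero i)
    (P.x j) hxj).differentiableAt
  have hG : DifferentiableAt ℂ (fun z => ∏ i ∈ Finset.univ.erase j, qTheta P.q (z / P.x i))
      (P.x j) := by
    have := DifferentiableAt.finsetProd (u := Finset.univ.erase j) (fun i _ => ht i)
    have he : (fun z => ∏ i ∈ Finset.univ.erase j, qTheta P.q (z / P.x i)) =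
        ∏ i ∈ Finset.univ.erase j, fun z => qTheta P.q (z / P.x i) := by
      funext z; simp
    rw [he]; exact this
  have d2 := (((ht j).hasDerivAt.mul hG.hasDerivAt).const_mul c)
  have hev : (fun z => C z 0 0 * C z 1 1 - C z 0 1 * C z 1 0) =ᶠ[nhds (P.x j)]
      fun z => c * (qTheta P.q (z / P.x j) *
        ∏ i ∈ Finset.univ.erase j, qTheta P.q (z / P.x i)) := by
    filter_upwards [continuousAt_id.eventually_ne hxj] with z hz
    rw [h z hz, Finset.mul_prod_erase _ (fun i => qTheta P.q (z / P.x i)) (Finset.mem_univ j)]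
  have := (hev.symm.hasDerivAt_iff.mp d2).unique d1
  have hz : qTheta P.q (P.x j / P.x j) = 0 := by
    rw [div_self hxj, qTheta_one hP.q_pos hP.q_lt_one]
  rw [hz, zero_mul, add_zero] at this
  refine mul_ne_zero hc (mul_ne_zero ?_ ?_) this
  · exact deriv_qTheta_div hP.q_pos hP.q_lt_one hxj hxj hz
  · exact Finset.prod_ne_zero_iff.mpr fun i hi =>
      hP.th_x_div_ne_zero (Finset.ne_of_mem_erase hi).symm

theorem tyurin_ne_zero (j : Fin 4) : P.tyurin C j ≠ 0 :=
  (piCoord_spec _ (hP.x_value_ne_zero hC j) (hP.det_x hC j)).1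

theorem tyurin_interpolates (i : Fin 2) : P.Interpolates (fun d z => C z i d) (P.tyurin C) :=
  fun j => (piCoord_spec _ (hP.x_value_ne_zero hC j) (hP.det_x hC j)).2 i

theorem tyurin_Tpoly : P.Tpoly P.θ0 (P.tyurin C) = 0 := by
  rw [← hP.hasInterpolant_iff]
  have hr := hP.isRow hC 0
  have : P.ex 0 = P.θ0 := by simp [ex, sg]
  rw [this] at hr
  refine ⟨_, hr, ?_, hP.tyurin_interpolates hC 0⟩
  obtain ⟨z, hz, hd⟩ := hP.exists_det_ne_zero hC
  by_contra! hcon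
  exact hd (by rw [hcon z 0 hz, hcon z 1 hz]; ring)

/-- Otherwise a row g with exponent 0 interpolates the parameters. As ±θ₀ ∉ Λ_τ, it is parallel to
both rows of C, so det C · g = 0, which is impossible. In particular the denominator in η is
nonzero. -/
theorem tyurin_Tpoly_zero : P.Tpoly 0 (P.tyurin C) ≠ 0 := by
  intro h
  rw [← hP.hasInterpolant_iff] at h
  obtain ⟨g, hg, ⟨z, d, hz, hgz⟩, hgr⟩ := h
  have hr := hP.tyurin_ne_zero hC
  have key : ∀ i z, z ≠ 0 → C z i 0 * g 1 z = C z i 1 * g 0 z := fun i z hz =>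
    hP.cross_eq_zero (hP.isRow hC i) hg hr (hP.tyurin_interpolates hC i) hgr
      (by rw [add_zero]; exact hP.vt_θ0 (sg_mem_signs i)) hz
  have hdet : ∀ d, ∀ z, z ≠ 0 → (C z 0 0 * C z 1 1 - C z 0 1 * C z 1 0) * g d z = 0 := by
    intro d z hz
    rcases fin2_eq_or 0 d with rfl | rfl
    · linear_combination C z 1 0 * key 0 z hz - C z 0 0 * key 1 z hz
    · rw [zero_add]
      linear_combination C z 1 1 * key 0 z hz - C z 0 1 * key 1 z hz
  rcases (hP.isTheta_cross (hP.isRow hC 0) (hP.isRow hC 1)).eq_zero_or_eq_zero (hg d)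
    (hdet d) with h | h
  · obtain ⟨z, hz, hd⟩ := hP.exists_det_ne_zero hC
    exact hd (h z hz)
  · exact hgz (h z hz)

end Connection

/-- A pair of independent rows defines a connection matrix. -/
theorem exists_connectionMatrix {r : Fin 4 → Fin 2 → ℂ} (hr : ∀ j, r j ≠ 0)
    {h : Fin 2 → Fin 2 → ℂ → ℂ} (hh : ∀ i, P.IsRow (P.ex i) (h i))
    (hi : ∀ i, P.Interpolates (h i) r)
    (hne : ∃ z, z ≠ 0 ∧ h 0 0 z * h 1 1 z - h 0 1 z * h 1 0 z ≠ 0) :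
    P.IsConnectionMatrix (fun z => Matrix.of fun i d => h i d z) ∧
    ∃ c : Fin 4 → ℂ, (∀ j, c j ≠ 0) ∧
      ∀ j, P.tyurin (fun z => Matrix.of fun i d => h i d z) j = c j • r j := by
  have hex : P.ex 0 + P.ex 1 = 0 := by simp [ex, sg]
  -- The exponents θ₀ and -θ₀ add up to zero, so the remaining factor of the determinant is a
  -- constant.
  obtain ⟨g, hg, e⟩ := hP.exists_cross (hh 0) (hh 1) hr (hi 0) (hi 1)
  rw [hex, P.pow_zero] at hg
  obtain ⟨K, hK⟩ := hg.eq_const hP.q_pos hP.q_lt_one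
  have hC : P.IsConnectionMatrix (fun z => Matrix.of fun i d => h i d z) := by
    refine ⟨fun i d => (hh i d).analytic, fun z hz => ?_, K, ?_, fun z hz => ?_⟩
    · ext i d
      rw [Matrix.smul_apply, Matrix.mul_diagonal, Matrix.diagonal_mul, smul_eq_mul]
      have := (hh i d).qdiff z hz
      rw [hP.mu_ex] at this
      simp only [Matrix.of_apply]
      field_simp
      linear_combination this
    · rintro rfl
      obtain ⟨z, hz, hd⟩ := hne
      exact hd (by rw [e z hz, hK z hz, mul_zero])
    · rw [hP.det_factor, Matrix.det_fin_two]
      simp only [Matrix.of_apply]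
      rw [e z hz, hK z hz, mul_comm]
  refine ⟨hC, ?_⟩
  have : ∀ j, ∃ c : ℂ, c ≠ 0 ∧
      P.tyurin (fun z => Matrix.of fun i d => h i d z) j = c • r j := by
    intro j
    refine exists_smul_of_cross (hP.tyurin_ne_zero hC j) (hr j) ?_
    have hx := hP.x_value_ne_zero hC j
    obtain ⟨i, hid⟩ : ∃ i, (fun d => h i d (P.x j)) ≠ 0 := by
      by_contra! hcon
      apply hx
      ext i d
      exact congrFun (hcon i) d
    have h1 := hP.tyurin_interpolates hC i j
    have h2 := hi i j
    simp only [Matrix.of_apply] at h1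
    have := cross_eq_of_interpolates (a := P.tyurin (fun z => Matrix.of fun i d => h i d z) j 0)
      (b := P.tyurin (fun z => Matrix.of fun i d => h i d z) j 1) (c := r j 0) (d := r j 1)
      (u := h i 0 (P.x j)) (v := h i 1 (P.x j)) (ne_zero_fin2 hid) (by linear_combination -h1)
      (by linear_combination -h2)
    exact sub_eq_zero.mp this
  choose c hc using this
  exact ⟨c, fun j => (hc j).1, fun j => (hc j).2⟩

end Admissible
end Params

/-! ### Rows with special Tyurin parameters and their realization -/

theorem exists_qTheta_mul_ne_zero {q : ℝ} (h0 : 0 < q) (h1 : q < 1) {a b : ℂ} (ha : a ≠ 0)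
    (hb : b ≠ 0) : ∃ z, z ≠ 0 ∧ qTheta q (z / a) * qTheta q (z / b) ≠ 0 := by
  by_contra! h
  have nz : ∀ {b : ℂ}, b ≠ 0 → ¬ ∀ z, z ≠ 0 → qTheta q (z / b) = 0 := by
    intro b hb h
    have := h (-b) (neg_ne_zero.mpr hb)
    rw [neg_div, div_self hb] at this
    exact qTheta_neg_one_ne_zero h0 h1 this
  rcases (isTheta_qTheta h0 h1 ha).eq_zero_or_eq_zero (isTheta_qTheta h0 h1 hb) h with h | h
  · exact nz ha h
  · exact nz hb h

/-- Rows proportional to a pair of linear theta functions without common zeros. -/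
theorem exists_factor {q : ℝ} (h0 : 0 < q) (h1 : q < 1) {a c : Fin 2 → ℂ} {p : ℂ}
    (ha : ∀ d, a d ≠ 0) (hc : ∀ d, c d ≠ 0) (hp : p ≠ 0) (hac : ∀ d, c d = a d * p)
    (haa : qTheta q (a 0 / a 1) ≠ 0) {g : Fin 2 → ℂ → ℂ} (hg : ∀ d, IsTheta q 2 (c d) (g d))
    (hcross : ∀ z, z ≠ 0 → g 0 z * qTheta q (z / a 1) = g 1 z * qTheta q (z / a 0)) :
    ∃ K : ℂ, ∀ d z, z ≠ 0 → g d z = K * (qTheta q (z / a d) * qTheta q (z / p)) := by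
  have haa' := qTheta_div_ne_zero_comm h0 h1 (ha 0) (ha 1) haa
  have key : ∀ d, g d (a d) = 0 → ∃ K : ℂ, ∀ z, z ≠ 0 →
      g d z = K * (qTheta q (z / a d) * qTheta q (z / p)) := by
    intro d h
    obtain ⟨K, hK⟩ := (hg d).degree_two h0 h1 (hc d) (ha d) h
    refine ⟨K, fun z hz => ?_⟩
    rw [hK z hz, hac d, mul_comm z, mul_div_mul_left _ _ (ha d)]
  have z0 : g 0 (a 0) = 0 := by
    have := hcross _ (ha 0)
    rw [div_self (ha 0), qTheta_one h0 h1, mul_zero] at this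
    exact (mul_eq_zero.mp this).resolve_right haa
  have z1 : g 1 (a 1) = 0 := by
    have := hcross _ (ha 1)
    rw [div_self (ha 1), qTheta_one h0 h1, mul_zero] at this
    exact (mul_eq_zero.mp this.symm).resolve_right haa'
  obtain ⟨K0, hK0⟩ := key 0 z0
  obtain ⟨K1, hK1⟩ := key 1 z1
  -- Otherwise a product of three theta functions of degree one would vanish identically.
  have hKK : K0 = K1 := by
    by_contra hne
    have t := fun {b : ℂ} (hb : b ≠ 0) => isTheta_qTheta h0 h1 hb
    rcases (((t (ha 0)).mul (t (ha 1))).eq_zero_or_eq_zero (t hp)) (fun z hz => by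
      have := hcross z hz
      rw [hK0 z hz, hK1 z hz] at this
      refine (mul_eq_zero.mp (?_ : (K0 - K1) * _ = 0)).resolve_left (sub_ne_zero.mpr hne)
      linear_combination this) with h | h
    · obtain ⟨z, hz, hz'⟩ := exists_qTheta_mul_ne_zero h0 h1 (ha 0) (ha 1)
      exact hz' (h z hz)
    · obtain ⟨z, hz, hz'⟩ := exists_qTheta_mul_ne_zero h0 h1 (ha 0) hp
      exact hz' (by rw [h z hz, mul_zero])
  refine ⟨K0, fun d => ?_⟩
  rcases fin2_eq_or 0 d with rfl | rfl
  · exact hK0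
  · rw [hKK]; exact hK1

/-- The splitting in which `j` is the partner of `k`. -/
def oc : Fin 4 → Fin 4 → Fin 3 := ![![0, 0, 1, 2], ![0, 0, 2, 1], ![1, 2, 0, 0], ![2, 1, 0, 0]]

theorem oc_oth : ∀ k m, oc k (oth k m) = m := by decide

namespace Params

variable (P : Params)

/-- The Tyurin parameters of a point of `lineSub`. -/
def lineR (k : Fin 4) (d : Fin 2) (v : Fin 6 → ℂ) : Fin 4 → Fin 2 → ℂ := fun j c =>
  if j = k then (if c = d then 0 else 1)
  else if c = d then P.T (pr k (d + 1) (oc k j)) else v (pr k (d + 1) (oc k j))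

theorem fac_eq (s : ℂ) (k : Fin 4) (d : Fin 2) (z : ℂ) :
    P.fac s k d z = qTheta P.q (z / (P.mu s d / P.x k)) := by
  rw [fac, div_div_eq_mul_div]

namespace Admissible

variable {P} (hP : P.Admissible)

include hP

theorem lineR_ne_zero (k : Fin 4) (d : Fin 2) (v : Fin 6 → ℂ) (j : Fin 4) :
    P.lineR k d v j ≠ 0 := by
  have hd : ∀ d : Fin 2, d + 1 ≠ d := by decide
  by_cases h : j = k
  · intro hj
    have := congrFun hj (d + 1)
    simp [lineR, h, hd] at this
  · intro hj
    have := congrFun hj d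
    simp [lineR, h] at this
    exact hP.T_ne_zero _ this

/-- On the surviving pairs `lineR` has the ratios v / T at the partners of k, so every coordinate is
v times the same product of three T's. -/
theorem tv_lineR {k : Fin 4} {d : Fin 2} {v : Fin 6 → ℂ} (hv : v ∈ lineSub k d) :
    ∃ c : ℂ, c ≠ 0 ∧ P.tv (P.lineR k d v) = c • v := by
  have hd : ∀ d : Fin 2, d + 1 ≠ d := by decide
  refine ⟨P.T (pr k (d + 1) 0) * P.T (pr k (d + 1) 1) * P.T (pr k (d + 1) 2),
    mul_ne_zero (mul_ne_zero (hP.T_ne_zero _) (hP.T_ne_zero _)) (hP.T_ne_zero _),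
    ext_pr k fun d' m => ?_⟩
  rw [tv, mono_pr, Pi.smul_apply, smul_eq_mul]
  rcases fin2_eq_or d d' with rfl | rfl
  · rw [hv.1]; simp [lineR]
  · rw [fin2_add_one_add_one]
    simp only [lineR, oth_ne, if_false, if_true, oc_oth, hd]
    fin_cases m
    · simp only [Fin.zero_eta, zero_add]; ring
    · simp only [Fin.mk_one, Fin.reduceAdd]; ring
    · simp only [Fin.reduceFinMk, Fin.reduceAdd]; ring

theorem mu_div (s s' : ℂ) (d : Fin 2) : P.mu s d = P.mu s' d * P.pow (s - s') := by
  rw [mu, mu, ← P.pow_add hP.q_pos]; congr 1; rw [nu, nu]; ring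

theorem th_mu_ne_zero (s : ℂ) (k : Fin 4) :
    qTheta P.q (P.mu s 0 / P.x k / (P.mu s 1 / P.x k)) ≠ 0 := by
  rw [div_div_div_cancel_right₀ (hP.x_ne_zero k), mu, mu, P.th_div hP.q_pos]
  have := hP.vt_two_θi one_mem_signs
  convert this using 2
  simp [nu, sg]; ring

theorem fac_zero_left (s s' : ℂ) (k j : Fin 4) (d d' : Fin 2) :
    P.fac s' j d' (P.mu s d / P.x k) = P.vt (P.nu s d - P.nu s' d' + (P.xi j - P.xi k)) := by
  rw [fac, mu, mu, hP.x_eq, hP.x_eq, ← P.pow_sub hP.q_pos, P.th_mul_div hP.q_pos]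
  congr 1; ring

theorem exists_factor_fac {s s' : ℂ} (k : Fin 4) {g : Fin 2 → ℂ → ℂ} (hg : P.IsRow s' g)
    (hcross : ∀ z, z ≠ 0 → g 0 z * P.fac s k 1 z = g 1 z * P.fac s k 0 z) :
    ∃ K : ℂ, ∀ d z, z ≠ 0 → g d z =
      K * (P.fac s k d z * qTheta P.q (z / (P.x k * P.pow (s' - s)))) := by
  simp only [P.fac_eq] at hcross ⊢
  refine exists_factor hP.q_pos hP.q_lt_one
    (fun d => div_ne_zero (hP.mu_ne_zero s d) (hP.x_ne_zero k)) (hP.mu_ne_zero s')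
    (mul_ne_zero (hP.x_ne_zero k) (P.pow_ne_zero hP.q_pos _)) (fun d => ?_)
    (hP.th_mu_ne_zero s k) hg hcross
  rw [hP.mu_div s' s]
  have := hP.x_ne_zero k
  field_simp

/-- Cancellation of the common factor of the row which vanishes at `x_k`. -/
theorem cancel_factor {k : Fin 4} {s s' : ℂ} {g : Fin 2 → ℂ → ℂ} (hg : P.IsRow s' g)
    (h : ∀ z, z ≠ 0 → g 0 z * (qTheta P.q (z / P.x k) * P.fac s k 1 z) =
      g 1 z * (qTheta P.q (z / P.x k) * P.fac s k 0 z)) :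
    ∀ z, z ≠ 0 → g 0 z * P.fac s k 1 z = g 1 z * P.fac s k 0 z := by
  have h1 := (hg 0).mul (hP.isTheta_fac s k 1)
  have h2 := ((hg 1).mul (hP.isTheta_fac s k 0)).congr_const (d := P.mu s' 0 * (P.mu s 1 / P.x k))
    (by
      have : P.mu s' 1 * P.mu s 0 = P.mu s' 0 * P.mu s 1 := by
        simp only [mu, ← P.pow_add hP.q_pos, nu]; congr 1; ring
      rw [← mul_div_assoc, this, mul_div_assoc])
  rcases (isTheta_qTheta hP.q_pos hP.q_lt_one (hP.x_ne_zero k)).eq_zero_or_eq_zero (h1.sub h2)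
    (fun z hz => by linear_combination h z hz) with h | h
  · have := h (-P.x k) (neg_ne_zero.mpr (hP.x_ne_zero k))
    rw [neg_div, div_self (hP.x_ne_zero k)] at this
    exact absurd this (qTheta_neg_one_ne_zero hP.q_pos hP.q_lt_one)
  · exact fun z hz => sub_eq_zero.mp (h z hz)

theorem isRow_mul_fac (s : ℂ) (k : Fin 4) :
    P.IsRow s (fun d z => qTheta P.q (z / P.x k) * P.fac s k d z) :=
  hP.isTheta_mul_fac s k

theorem dualR_ne_zero (k : Fin 4) (e : Fin 2) {v : Fin 2 → ℂ} (hv : v ≠ 0) (j : Fin 4) :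
    P.dualR k e v j ≠ 0 := by
  by_cases h : j = k
  · intro hj
    apply hv
    funext d
    have := congrFun hj d
    simpa [dualR, h] using this
  · intro hj
    have := congrFun hj 0
    simp [dualR, h] at this
    exact hP.facAt_ne_zero e h 0 this

/-- If two independent rows interpolate `dualR`, one of which vanishes at `x_k`, proportionality
of the rows determines the value at `x_k`. -/
theorem eq_of_cross_dualR {k : Fin 4} {e : Fin 2} {v : Fin 2 → ℂ} {s : ℂ} {g : Fin 2 → ℂ → ℂ}
    (hg : P.IsRow s g) (hne : ∃ z d, z ≠ 0 ∧ g d z ≠ 0) (hgr : P.Interpolates g (P.dualR k e v))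
    (hs : P.vt (P.ex e - s) ≠ 0)
    (h : ∀ z, z ≠ 0 → g 0 z * P.fac (P.ex e) k 1 z = g 1 z * P.fac (P.ex e) k 0 z) :
    v 1 * P.facAt e k 0 k = v 0 * P.facAt e k 1 k := by
  obtain ⟨K, hK⟩ := hP.exists_factor_fac k hg h
  have hK0 : K ≠ 0 := by
    rintro rfl
    obtain ⟨z, d, hz, hgz⟩ := hne
    exact hgz (by rw [hK d z hz, zero_mul])
  have hx := hP.x_ne_zero k
  have hq : qTheta P.q (P.x k / (P.x k * P.pow (s - P.ex e))) ≠ 0 := by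
    rw [div_mul_cancel_left₀ hx, ← P.pow_neg, neg_sub]
    exact hs
  have := hgr k
  rw [hK 0 _ hx, hK 1 _ hx, hP.fac_x, hP.fac_x] at this
  simp only [dualR, if_true] at this
  apply mul_left_cancel₀ (mul_ne_zero hK0 hq)
  linear_combination this

/-- Replacing the factor θ_q(z / x_k) of the vanishing row by θ_q(z / p), with p = x_k q^(-s) and s
the exponent of the row, changes the exponent to 0. The ratios of the entries stay the same, and the
value at x_k is the one required by the hypothesis. -/
theorem Tpoly_zero_dualR_of_eq {k : Fin 4} {e : Fin 2} {v : Fin 2 → ℂ}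
    (h : v 1 * P.facAt e k 0 k = v 0 * P.facAt e k 1 k) : P.Tpoly 0 (P.dualR k e v) = 0 := by
  rw [← hP.hasInterpolant_iff]
  have hx := hP.x_ne_zero k
  set p := P.x k * P.pow (-P.ex e) with hp
  have hp0 : p ≠ 0 := mul_ne_zero hx (P.pow_ne_zero hP.q_pos _)
  refine ⟨fun d z => qTheta P.q (z / p) * P.fac (P.ex e) k d z, fun d => ?_,
    ?_, fun j => ?_⟩
  · refine ((isTheta_qTheta hP.q_pos hP.q_lt_one hp0).mul (hP.isTheta_fac _ k d)).congr_const ?_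
    rw [hP.mu_div 0 (P.ex e), zero_sub, hp]
    field_simp
  · obtain ⟨z, hz, h⟩ := exists_qTheta_mul_ne_zero hP.q_pos hP.q_lt_one hp0
      (div_ne_zero (hP.mu_ne_zero (P.ex e) 0) hx)
    exact ⟨z, 0, hz, by rwa [← P.fac_eq] at h⟩
  · by_cases hj : j = k
    · subst hj
      simp only [hP.fac_x, dualR, if_true]
      linear_combination qTheta P.q (P.x j / p) * h
    · simp only [hP.fac_x, dualR, if_neg hj]; ring

/-- The points at infinity of the dual lines. -/
theorem eq_of_Tpoly_zero_dualR {k : Fin 4} {e : Fin 2} {v : Fin 2 → ℂ} (hv : v ≠ 0)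
    (h : P.Tpoly 0 (P.dualR k e v) = 0) : v 1 * P.facAt e k 0 k = v 0 * P.facAt e k 1 k := by
  rw [← hP.hasInterpolant_iff] at h
  obtain ⟨g, hg, hne, hgr⟩ := h
  refine hP.eq_of_cross_dualR hg hne hgr ?_ (hP.cancel_factor hg fun z hz => ?_)
  · rw [sub_zero]; exact hP.vt_θ0 (sg_mem_signs e)
  · have := hP.cross_eq_zero hg (hP.isRow_mul_fac (P.ex e) k) (hP.dualR_ne_zero k e hv) hgr
      (hP.dualR_interpolates k e v) (by rw [zero_add]; exact hP.vt_θ0 (sg_mem_signs e)) hz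
    exact this

end Admissible
end Params

theorem eq_mul_swap (d : Fin 2) (r a : Fin 2 → ℂ) :
    r 1 * a 0 = r 0 * a 1 ↔ r (d + 1) * a d = r d * a (d + 1) := by
  fin_cases d
  · rfl
  · exact eq_comm

theorem Diamond.isValue_iff (d : Diamond) (v : Fin 2 → ℂ) : d.IsValue v ↔ v d.idx = 0 := by
  cases d <;> rfl

namespace Params

variable (P : Params)

/-- The coordinate `N_∞`, up to a constant factor. -/
def Ninf : (Fin 6 → ℂ) →ₗ[ℂ] ℂ := ∑ p, (P.T' p / P.T p) • LinearMap.proj p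

theorem Ninf_apply (v : Fin 6 → ℂ) : P.Ninf v = ∑ p, P.T' p / P.T p * v p := by
  simp [Ninf]

theorem tv_smul (r r' : Fin 4 → Fin 2 → ℂ) (c : Fin 4 → ℂ) (h : ∀ j, r j = c j • r' j) :
    P.tv r = (c 0 * c 1 * c 2 * c 3) • P.tv r' := by
  funext p
  rw [tv, mono_smul r r' c h, Pi.smul_apply, smul_eq_mul, tv]; ring

theorem tv_mem_lineSub {r : Fin 4 → Fin 2 → ℂ} {k : Fin 4} {d : Fin 2} (h : r k d = 0)
    (hT : P.Tpoly P.θ0 r = 0) : P.tv r ∈ lineSub k d := by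
  have h1 : ∀ m, P.tv r (pr k d m) = 0 := fun m => by rw [tv, mono_pr, h]; ring
  refine ⟨h1, ?_⟩
  rw [← P.sum_tv, sum_pr k d] at hT
  simpa [h1] using hT

namespace Admissible

variable {P} (hP : P.Admissible)

include hP

theorem Ninf_tv (r : Fin 4 → Fin 2 → ℂ) : P.Ninf (P.tv r) = P.Tpoly 0 r := by
  rw [P.Ninf_apply, Tpoly, Tat_zero]
  refine Finset.sum_congr rfl fun p _ => ?_
  have := hP.T_ne_zero p
  rw [tv]; field_simp

theorem vt_sub_eq_zero {X Y : ℂ} (hX : P.vt X = 0) (hY : P.vt Y = 0) : P.vt (X - Y) = 0 := by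
  rw [P.vt_eq_zero_iff hP.q_pos hP.q_lt_one] at *
  obtain ⟨m, n, rfl⟩ := hX
  obtain ⟨m', n', rfl⟩ := hY
  exact ⟨m - m', n - n', by push_cast; ring⟩

/-- Realization of Tyurin parameters. -/
theorem exists_of_Tpoly {r : Fin 4 → Fin 2 → ℂ} (hr : ∀ j, r j ≠ 0) (hT : P.Tpoly P.θ0 r = 0)
    (hT0 : P.Tpoly 0 r ≠ 0)
    (hdet : ∀ h : Fin 2 → Fin 2 → ℂ → ℂ, (∀ i, P.IsRow (P.ex i) (h i)) →
      (∀ i, ∃ z d, z ≠ 0 ∧ h i d z ≠ 0) → (∀ i, P.Interpolates (h i) r) →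
      (∀ z, z ≠ 0 → h 0 0 z * h 1 1 z = h 0 1 z * h 1 0 z) → P.Tpoly 0 r = 0) :
    ∃ C, P.IsConnectionMatrix C ∧ ∃ c : Fin 4 → ℂ, (∀ j, c j ≠ 0) ∧
      ∀ j, P.tyurin C j = c j • r j := by
  have hi : ∀ i, HasInterpolant P.q P.x (P.mu (P.ex i)) r := fun i => by
    rw [hP.hasInterpolant_iff, P.Tpoly_ex, hT]
  choose h hh hne hint using hi
  refine ⟨_, hP.exists_connectionMatrix hr hh hint ?_⟩
  by_contra! hcon
  exact hT0 (hdet h hh hne hint fun z hz => sub_eq_zero.mp (hcon z hz))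

/-- A nonzero row which takes a special value at `x_k`. -/
theorem row_eq_of_special {e : Fin 2} {f : Fin 2 → ℂ → ℂ} (hf : P.IsRow (P.ex e) f)
    (hne : ∃ z d, z ≠ 0 ∧ f d z ≠ 0) {r : Fin 4 → Fin 2 → ℂ} (hfr : P.Interpolates f r)
    {k a b : Fin 4} {d : Fin 2} (hk : r k ≠ 0) (hkd : r k d = 0) (hab : a ≠ b)
    (ha : r a d ≠ 0) (hb : r b d ≠ 0) :
    ∃ α : ℂ, α ≠ 0 ∧ ∀ z, z ≠ 0 → f d z = α * (qTheta P.q (z / P.x k) * P.fac (P.ex e) k d z) := by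
  have hfr' := fun j => (eq_mul_swap d (r j) (fun d => f d (P.x j))).mp (hfr j)
  have hk1 : r k (d + 1) ≠ 0 := by
    intro h
    apply hk
    funext c
    rcases fin2_eq_or d c with rfl | rfl
    · exact hkd
    · exact h
  have h0 : f d (P.x k) = 0 := by
    have := hfr' k
    rw [hkd, zero_mul] at this
    exact (mul_eq_zero.mp this).resolve_left hk1
  obtain ⟨α, hα⟩ := (hf d).degree_two hP.q_pos hP.q_lt_one (hP.mu_ne_zero _ _) (hP.x_ne_zero k) h0
  refine ⟨α, ?_, hα⟩
  rintro rfl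
  -- With one entry identically zero the other one vanishes at both x_a and x_b, whose product is
  -- not its multiplier modulo q^ℤ.
  have hd : ∀ z, z ≠ 0 → f d z = 0 := fun z hz => by rw [hα z hz, zero_mul]
  have hz : ∀ j, r j d ≠ 0 → f (d + 1) (P.x j) = 0 := by
    intro j hj
    have := hfr' j
    rw [hd _ (hP.x_ne_zero j), mul_zero] at this
    exact (mul_eq_zero.mp this.symm).resolve_left hj
  obtain ⟨z, c, hz0, hzc⟩ := hne
  rcases fin2_eq_or d c with rfl | rfl
  · exact hzc (hd z hz0)
  · exact hzc ((hf (d + 1)).eq_zero_of_two hP.q_pos hP.q_lt_one (hP.mu_ne_zero _ _)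
      (hP.x_ne_zero a) (hP.x_ne_zero b) (hP.th_x_div_ne_zero hab) (hz a ha) (hz b hb)
      (hP.th_x_mul_div_ne_zero e hab _) hz0)

/-- The entries of both rows in column d have the zero x_k and hence an explicit form. If the rows
were parallel, the linear factor `fac` of the first row in column d would also divide its other
entry; replacing this common factor by the one for exponent 0 gives a row that shows T'(ρ) = 0. -/
theorem det_lineR {k : Fin 4} {d : Fin 2} {v : Fin 6 → ℂ} {h : Fin 2 → Fin 2 → ℂ → ℂ}
    (hh : ∀ i, P.IsRow (P.ex i) (h i)) (hne : ∀ i, ∃ z d, z ≠ 0 ∧ h i d z ≠ 0)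
    (hi : ∀ i, P.Interpolates (h i) (P.lineR k d v))
    (hdet : ∀ z, z ≠ 0 → h 0 0 z * h 1 1 z = h 0 1 z * h 1 0 z) :
    P.Tpoly 0 (P.lineR k d v) = 0 := by
  have hkd : P.lineR k d v k d = 0 := by simp [lineR]
  have ho : ∀ m, P.lineR k d v (oth k m) d ≠ 0 := fun m => by
    simp only [lineR, oth_ne, if_false, if_true]; exact hP.T_ne_zero _
  have H := fun i => hP.row_eq_of_special (hh i) (hne i) (hi i) (hP.lineR_ne_zero k d v k) hkd
    (oth_ne_oth k 0 1 (by decide)) (ho 0) (ho 1)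
  obtain ⟨α, hα, hf⟩ := H 0
  obtain ⟨β, hβ, hg⟩ := H 1
  have hx := hP.x_ne_zero k
  have hdet' : ∀ z, z ≠ 0 → h 0 d z * h 1 (d + 1) z = h 0 (d + 1) z * h 1 d z := by
    rcases fin2_eq_or 0 d with rfl | rfl
    · exact hdet
    · intro z hz
      have := hdet z hz
      rw [zero_add, show (1 : Fin 2) + 1 = 0 from rfl]
      linear_combination -this
  have hc : ∀ z, z ≠ 0 → α * P.fac (P.ex 0) k d z * h 1 (d + 1) z =
      β * P.fac (P.ex 1) k d z * h 0 (d + 1) z := by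
    have t1 := ((hP.isTheta_fac (P.ex 0) k d).mul (hh 1 (d + 1))).const_mul α
    have t2 := ((hP.isTheta_fac (P.ex 1) k d).mul (hh 0 (d + 1))).const_mul β
    have t2 := t2.congr_const (d := P.mu (P.ex 0) d / P.x k * P.mu (P.ex 1) (d + 1)) (by
      have : P.mu (P.ex 1) d * P.mu (P.ex 0) (d + 1) = P.mu (P.ex 0) d * P.mu (P.ex 1) (d + 1) := by
        simp only [mu, ← P.pow_add hP.q_pos, nu]; congr 1; ring
      rw [div_mul_eq_mul_div, this, div_mul_eq_mul_div])
    rcases (isTheta_qTheta hP.q_pos hP.q_lt_one hx).eq_zero_or_eq_zero (t1.sub t2)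
      (fun z hz => by
        have := hdet' z hz
        rw [hf z hz, hg z hz] at this
        linear_combination this) with h | h
    · obtain ⟨z, hz, hz'⟩ := exists_qTheta_mul_ne_zero hP.q_pos hP.q_lt_one hx hx
      exact absurd (h z hz) (left_ne_zero_of_mul hz')
    · intro z hz
      linear_combination h z hz
  set z0 := P.mu (P.ex 0) d / P.x k with hz0
  have hz0' : z0 ≠ 0 := div_ne_zero (hP.mu_ne_zero _ _) hx
  -- At z0 the linear factor of the first row vanishes, but that of the second row does not, because
  -- 2θ₀ ∉ Λ_τ.
  have hzero : h 0 (d + 1) z0 = 0 := by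
    have := hc z0 hz0'
    rw [P.fac_eq (P.ex 0), div_self hz0', qTheta_one hP.q_pos hP.q_lt_one, mul_zero, zero_mul]
      at this
    refine (mul_eq_zero.mp this.symm).resolve_left (mul_ne_zero hβ ?_)
    rw [hz0, hP.fac_zero_left]
    have := hP.vt_two_θ0 one_mem_signs
    convert this using 2
    simp [nu, ex, sg]; ring
  obtain ⟨γ, hγ⟩ := (hh 0 (d + 1)).degree_two hP.q_pos hP.q_lt_one (hP.mu_ne_zero _ _) hz0' hzero
  set p := P.mu (P.ex 0) (d + 1) / z0 with hp
  have hp0 : p ≠ 0 := div_ne_zero (hP.mu_ne_zero _ _) hz0'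
  have hq : ∀ z, qTheta P.q (z * z0 / P.mu (P.ex 0) (d + 1)) = qTheta P.q (z / p) := fun z => by
    rw [hp, div_div_eq_mul_div]
  have hq' : ∀ z, qTheta P.q (z / z0) = P.fac (P.ex 0) k d z := fun z => by
    rw [P.fac_eq]
  simp only [hq, hq'] at hγ
  rw [← hP.hasInterpolant_iff]
  have hd : ∀ d : Fin 2, d + 1 ≠ d := by decide
  -- The first row with its common factor exchanged for that of exponent 0; at the points x_j with j
  -- ≠ k both factors drop out of the ratio.
  refine ⟨fun c z => if c = d then α * (qTheta P.q (z / P.x k) * P.fac 0 k d z)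
    else γ * (qTheta P.q (z / p) * P.fac 0 k d z), fun c => ?_, ?_, fun j => ?_⟩
  · rcases fin2_eq_or d c with rfl | rfl
    · simp only [if_true]
      exact (hP.isTheta_mul_fac 0 k c).const_mul α
    · simp only [hd, if_false]
      refine (((isTheta_qTheta hP.q_pos hP.q_lt_one hp0).mul
        (hP.isTheta_fac 0 k d)).congr_const ?_).const_mul γ
      have h0 := hP.mu_ne_zero (P.ex 0) d
      rw [hP.mu_div 0 (P.ex 0) (d + 1), hP.mu_div 0 (P.ex 0) d, hp, hz0]
      field_simp
  · obtain ⟨z, hz, hz'⟩ := exists_qTheta_mul_ne_zero hP.q_pos hP.q_lt_one hx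
      (div_ne_zero (hP.mu_ne_zero 0 d) hx)
    refine ⟨z, d, hz, ?_⟩
    simp only [if_true]
    rw [P.fac_eq]
    exact mul_ne_zero hα hz'
  · refine (eq_mul_swap d _ (fun c => if c = d then _ else _)).mpr ?_
    simp only [hd, if_true, if_false]
    by_cases hj : j = k
    · subst hj
      rw [hkd, div_self hx, qTheta_one hP.q_pos hP.q_lt_one]; ring
    · have hA : P.fac (P.ex 0) k d (P.x j) ≠ 0 := by
        rw [hP.fac_x]; exact hP.facAt_ne_zero 0 hj d
      have := (eq_mul_swap d (P.lineR k d v j) (fun c => h 0 c (P.x j))).mp (hi 0 j)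
      rw [hf _ (hP.x_ne_zero j), hγ _ (hP.x_ne_zero j)] at this
      apply mul_left_cancel₀ hA
      linear_combination P.fac 0 k d (P.x j) * this

/-- Both f and the row with a zero at x_k have the same exponent ±θ₀, and ±2θ₀ ∉ Λ_τ makes them
parallel. -/
theorem row_dualR {k : Fin 4} {e : Fin 2} {v : Fin 2 → ℂ} (hv : v ≠ 0) {f : Fin 2 → ℂ → ℂ}
    (hf : P.IsRow (P.ex e) f) (hfr : P.Interpolates f (P.dualR k e v)) :
    ∃ K : ℂ, ∀ d z, z ≠ 0 → f d z = K * (qTheta P.q (z / P.x k) * P.fac (P.ex e) k d z) := by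
  obtain ⟨K, hK⟩ := hP.exists_factor_fac k hf (hP.cancel_factor (s := P.ex e) hf fun z hz =>
    hP.cross_eq_zero hf (hP.isRow_mul_fac (P.ex e) k) (hP.dualR_ne_zero k e hv) hfr
      (hP.dualR_interpolates k e v) (by
        have := hP.vt_two_θ0 (sg_mem_signs e)
        convert this using 2; rw [ex]; ring) hz)
  refine ⟨K, fun d z hz => ?_⟩
  rw [hK d z hz, sub_self, P.pow_zero, mul_one]; ring

/-- Row e is a multiple of the row that vanishes at x_k. A second row parallel to it would fix the
value at x_k, and that value is the one at infinity. -/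
theorem det_dualR {k : Fin 4} {e : Fin 2} {v : Fin 2 → ℂ} (hv : v ≠ 0)
    {h : Fin 2 → Fin 2 → ℂ → ℂ}
    (hh : ∀ i, P.IsRow (P.ex i) (h i)) (hne : ∀ i, ∃ z d, z ≠ 0 ∧ h i d z ≠ 0)
    (hi : ∀ i, P.Interpolates (h i) (P.dualR k e v))
    (hdet : ∀ z, z ≠ 0 → h 0 0 z * h 1 1 z = h 0 1 z * h 1 0 z) :
    P.Tpoly 0 (P.dualR k e v) = 0 := by
  obtain ⟨K, hK⟩ := hP.row_dualR hv (hh e) (hi e)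
  have hK0 : K ≠ 0 := by
    rintro rfl
    obtain ⟨z, d, hz, hd⟩ := hne e
    exact hd (by rw [hK d z hz, zero_mul])
  refine hP.Tpoly_zero_dualR_of_eq (hP.eq_of_cross_dualR (hh (e + 1)) (hne (e + 1)) (hi (e + 1))
    ?_ (hP.cancel_factor (hh (e + 1)) fun z hz => ?_))
  · have := hP.vt_two_θ0 (sg_mem_signs e)
    convert this using 2; rw [ex_add_one, ex]; ring
  · apply mul_left_cancel₀ hK0
    have hdet' : h e 0 z * h (e + 1) 1 z = h e 1 z * h (e + 1) 0 z := by
      rcases fin2_eq_or 0 e with rfl | rfl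
      · exact hdet z hz
      · have := hdet z hz
        rw [zero_add, show (1 : Fin 2) + 1 = 0 from rfl]
        linear_combination -this
    rw [hK 0 z hz, hK 1 z hz] at hdet'
    linear_combination -hdet'

theorem exists_tv_dualR {k : Fin 4} {e : Fin 2} {v : Fin 6 → ℂ} (hv : v ∈ dualSub P.lw k e) :
    ∃ s : Fin 2 → ℂ, P.tv (P.dualR k e s) = v ∧ (v ≠ 0 → s ≠ 0) := by
  rw [← range_dualParam] at hv
  obtain ⟨s, rfl⟩ := hv
  have n0 := hP.facProd_ne_zero e k 0
  have n1 := hP.facProd_ne_zero e k 1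
  have n2 := P.pow_ne_zero hP.q_pos (2 * P.θi)
  refine ⟨![s 0 / P.facProd e k 1, s 1 / (P.facProd e k 0 * P.pow (2 * P.θi))], ?_, ?_⟩
  · rw [hP.tv_dualR]
    congr 1
    funext d
    fin_cases d
    · simp [n1]
    · simp; field_simp
  · intro h h0
    apply h
    have e0 := congrFun h0 0
    have e1 := congrFun h0 1
    have : s = 0 := by
      funext d
      fin_cases d
      · simpa [n1] using e0
      · simpa [n0, n2] using e1
    rw [this, map_zero]

/-- Every finite point of a line comes from a connection matrix. -/
theorem exists_realization (l : LineName) {v : Fin 6 → ℂ} (hv : v ∈ linSub P.lw l)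
    (h : P.Ninf v ≠ 0) : ∃ C, P.IsConnectionMatrix C ∧ P.LineCondition C l ∧
      ∃ c : ℂ, c ≠ 0 ∧ P.tv (P.tyurin C) = c • v := by
  rcases l with ⟨k, d⟩ | ⟨k, d⟩
  · obtain ⟨a, ha, hav⟩ := hP.tv_lineR hv
    have hT0 : P.Tpoly 0 (P.lineR k d.idx v) ≠ 0 := by
      rw [← hP.Ninf_tv, hav, map_smul]; exact mul_ne_zero ha h
    have hT : P.Tpoly P.θ0 (P.lineR k d.idx v) = 0 := by
      rw [← P.sum_tv, hav]
      simp only [Pi.smul_apply, ← Finset.smul_sum]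
      rw [(linSub_segreForm hP.sum_lw (.line k d) hv).1, smul_zero]
    obtain ⟨C, hC, c, hc, hcr⟩ := hP.exists_of_Tpoly (hP.lineR_ne_zero k d.idx v) hT hT0
      (fun _ h1 h2 h3 h4 => hP.det_lineR h1 h2 h3 h4)
    refine ⟨C, hC, ?_, c 0 * c 1 * c 2 * c 3 * a, ?_, ?_⟩
    · refine (d.isValue_iff _).mpr ?_
      rw [hcr]; simp [lineR]
    · simp [hc, ha]
    · rw [P.tv_smul _ _ c hcr, hav, smul_smul]
  · obtain ⟨s, rfl, hs⟩ := hP.exists_tv_dualR hv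
    have hs := hs (fun h0 => h (by rw [h0, map_zero]))
    rw [hP.Ninf_tv] at h
    obtain ⟨C, hC, c, hc, hcr⟩ := hP.exists_of_Tpoly (hP.dualR_ne_zero k d.idx hs)
      (hP.dualR_Tpoly k d.idx s) h (fun _ h1 h2 h3 h4 => hP.det_dualR hs h1 h2 h3 h4)
    refine ⟨C, hC, ?_, c 0 * c 1 * c 2 * c 3, ?_, P.tv_smul _ _ c hcr⟩
    -- The row `d.idx` of the constructed matrix is forced to vanish at x_k, which is the dual
    -- condition.
    · obtain ⟨K, hK⟩ := hP.row_dualR hs (hP.isRow hC d.idx) (fun j => by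
        have := hP.tyurin_interpolates hC d.idx j
        rw [hcr] at this
        apply mul_left_cancel₀ (hc j)
        simp only [Pi.smul_apply, smul_eq_mul] at this
        linear_combination this)
      have hrow : ∀ i, C (P.x k) d.idx i = 0 := fun i => by
        rw [hK i _ (hP.x_ne_zero k), div_self (hP.x_ne_zero k), qTheta_one hP.q_pos hP.q_lt_one]
        ring
      have hne := hP.x_value_ne_zero hC k
      have hspec := (piCoord_spec (C (P.x k)).transpose
        (fun h => hne (by rw [← Matrix.transpose_transpose (C (P.x k)), h]; rfl))
        (by rw [Matrix.det_transpose]; exact hP.det_x hC k)).2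
      refine (d.isValue_iff _).mpr ?_
      obtain ⟨i, hi⟩ : ∃ i, C (P.x k) (d.idx + 1) i ≠ 0 := by
        by_contra! hcon
        apply hne
        ext j i
        rcases fin2_eq_or d.idx j with rfl | rfl
        · exact hrow i
        · exact hcon i
      have := (eq_mul_swap d.idx (P.dualTyurin C k) (fun j => C (P.x k) j i)).mp (hspec i)
      rw [hrow, mul_zero] at this
      exact (mul_eq_zero.mp this.symm).resolve_right hi
    · simp [hc]

end Admissible
end Params

/-! ### The points of connection matrices and the hyperplane at infinity -/

theorem fin3_shift₁ : ∀ m : Fin 3, m + 2 + 1 = m := by decide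

theorem fin3_shift₂ : ∀ m : Fin 3, m + 2 + 2 = m + 1 := by decide

namespace Params

variable (P : Params)

/-- Rescaling all Tyurin parameters by the same factors. -/
theorem tv_rescale (r : Fin 4 → Fin 2 → ℂ) (K : Fin 2 → ℂ) :
    P.tv (fun j d => K d * r j d) = (K 0 ^ 2 * K 1 ^ 2) • P.tv r := by
  funext p
  rw [tv, Pi.smul_apply, smul_eq_mul, tv]
  fin_cases p <;> simp [mono] <;> ring

/-- Every monomial contains two coordinates of each index, and at most one of the two belongs to k.
-/
theorem mono_eq_zero {r : Fin 4 → Fin 2 → ℂ} {k : Fin 4} {d : Fin 2}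
    (h : ∀ j, j ≠ k → r j d = 0) (p : Fin 6) : mono r p = 0 := by
  rw [← pr_sd_cl k p, mono_pr]
  generalize sd k p = d'
  rcases fin2_eq_or d d' with rfl | rfl
  · rw [h _ (oth_ne k _)]; ring
  · rw [fin2_add_one_add_one, h _ (oth_ne k _)]; ring

theorem sum_xi_oth (k : Fin 4) (m : Fin 3) : P.xi (oth k m) + P.xi (oth k (m + 1)) + P.xi k +
    P.xi (oth k (m + 2)) = 2 * P.kap := by
  rw [← P.sum_xi]
  fin_cases k <;> fin_cases m <;> simp [oth] <;> ring

namespace Admissible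

variable {P} (hP : P.Admissible)

include hP

theorem tv_tyurin_ne_zero {C : ℂ → Matrix (Fin 2) (Fin 2) ℂ} (hC : P.IsConnectionMatrix C) :
    P.Ninf (P.tv (P.tyurin C)) ≠ 0 := by
  rw [hP.Ninf_tv]; exact hP.tyurin_Tpoly_zero hC

theorem row_eq_zero {C : ℂ → Matrix (Fin 2) (Fin 2) ℂ} (hC : P.IsConnectionMatrix C) {k : Fin 4}
    {e : Fin 2} (h : P.dualTyurin C k e = 0) (i : Fin 2) : C (P.x k) e i = 0 := by
  have hne := hP.x_value_ne_zero hC k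
  obtain ⟨h0, hspec⟩ := piCoord_spec (C (P.x k)).transpose
    (fun h => hne (by rw [← Matrix.transpose_transpose (C (P.x k)), h]; rfl))
    (by rw [Matrix.det_transpose]; exact hP.det_x hC k)
  have := (eq_mul_swap e (P.dualTyurin C k) (fun j => C (P.x k) j i)).mp (hspec i)
  rw [h, zero_mul] at this
  refine (mul_eq_zero.mp this).resolve_left fun h1 => h0 ?_
  funext c
  rcases fin2_eq_or e c with rfl | rfl
  · exact h
  · exact h1

/-- Row e vanishes at x_k, so its entries are K_d θ_q(z / x_k) times the factors `fac`. After
rescaling the two homogeneous coordinates by K₀ and K₁ the Tyurin parameters are of the form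
`dualR`. -/
theorem tv_tyurin_mem_dualSub {C : ℂ → Matrix (Fin 2) (Fin 2) ℂ} (hC : P.IsConnectionMatrix C)
    {k : Fin 4} {e : Fin 2} (h : P.dualTyurin C k e = 0) :
    P.tv (P.tyurin C) ∈ dualSub P.lw k e := by
  have hx := hP.x_ne_zero
  have hdeg := fun d => (hP.isRow hC e d).degree_two hP.q_pos hP.q_lt_one (hP.mu_ne_zero _ _) (hx k)
    (hP.row_eq_zero hC h d)
  choose K hK using hdeg
  have hrel : ∀ j, j ≠ k → P.tyurin C j 1 * (K 0 * P.facAt e k 0 j) =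
      P.tyurin C j 0 * (K 1 * P.facAt e k 1 j) := by
    intro j hj
    have := hP.tyurin_interpolates hC e j
    rw [hK _ _ (hx j), hK _ _ (hx j)] at this
    have e0 := hP.fac_x e k 0 j
    have e1 := hP.fac_x e k 1 j
    rw [fac] at e0 e1
    rw [e0, e1] at this
    apply mul_left_cancel₀ (hP.th_x_div_ne_zero hj)
    linear_combination this
  have hmono : ∀ d, (∃ p, mono (P.tyurin C) p ≠ 0) → ¬ ∀ j, j ≠ k → P.tyurin C j d = 0 :=
    fun d ⟨p, hp⟩ h => hp (mono_eq_zero h p)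
  have hmono := fun d => hmono d (by
    by_contra! hcon
    exact hP.tyurin_Tpoly_zero hC (by simp [Tpoly, hcon]))
  -- If one K_d were zero, three Tyurin parameters would be equal to the same special value and all
  -- monomials would vanish, contrary to T'(ρ) ≠ 0.
  have hK0 : ∀ d, K d ≠ 0 := by
    have hnot : ¬ (K 0 = 0 ∧ K 1 = 0) := by
      rintro ⟨h0, h1⟩
      obtain ⟨z, hz, hd⟩ := hP.exists_det_ne_zero hC
      have hr : ∀ d, C z e d = 0 := by
        intro d
        refine (hK d z hz).trans ?_
        rcases fin2_eq_or 0 d with rfl | rfl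
        · rw [h0, zero_mul]
        · rw [zero_add, h1, zero_mul]
      apply hd
      rcases fin2_eq_or 0 e with rfl | rfl
      · rw [hr, hr]; ring
      · rw [zero_add] at hr
        rw [hr, hr]; ring
    intro d hd
    rcases fin2_eq_or 0 d with rfl | rfl
    · refine hmono 0 fun j hj => ?_
      have := hrel j hj
      rw [hd, zero_mul, mul_zero] at this
      exact (mul_eq_zero.mp this.symm).resolve_right
        (mul_ne_zero (fun h => hnot ⟨hd, h⟩) (hP.facAt_ne_zero e hj _))
    · rw [zero_add] at hd
      refine hmono 1 fun j hj => ?_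
      have := hrel j hj
      rw [hd, zero_mul, mul_zero] at this
      exact (mul_eq_zero.mp this).resolve_right
        (mul_ne_zero (fun h => hnot ⟨h, hd⟩) (hP.facAt_ne_zero e hj _))
  -- All monomials have degree two in the coordinates of each index 0 and 1, so this rescaling
  -- changes the point only by a scalar.
  set r : Fin 4 → Fin 2 → ℂ := fun j d => (K d)⁻¹ * P.tyurin C j d with hr
  have hres : P.tyurin C = fun j d => K d * r j d := by
    funext j d
    rw [hr]
    field_simp [hK0 d]
  have hrne : ∀ j, r j ≠ 0 := by
    intro j h
    apply hP.tyurin_ne_zero hC j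
    funext d
    rw [hres]
    simp only [h, Pi.zero_apply, mul_zero]
  have hc : ∀ j, ∃ c : ℂ, r j = c • P.dualR k e (r k) j := by
    intro j
    by_cases hj : j = k
    · subst hj
      exact ⟨1, by funext d; simp [dualR]⟩
    · obtain ⟨c, -, hc⟩ := exists_smul_of_cross (hrne j)
        (hP.dualR_ne_zero k e (hrne k) j) (by
          simp only [dualR, if_neg hj, hr]
          have := hrel j hj
          have n0 := hK0 0
          have n1 := hK0 1
          field_simp
          linear_combination -this)
      exact ⟨c, hc⟩
  choose c hc using hc
  rw [hres, P.tv_rescale, P.tv_smul _ _ c hc, hP.tv_dualR, ← range_dualParam]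
  exact Submodule.smul_mem _ _ (Submodule.smul_mem _ _ (LinearMap.mem_range_self _ _))

/-- The points of the connection matrices in the definition of a line. -/
theorem tv_tyurin_mem {C : ℂ → Matrix (Fin 2) (Fin 2) ℂ} (hC : P.IsConnectionMatrix C)
    (l : LineName) (h : P.LineCondition C l) : P.tv (P.tyurin C) ∈ linSub P.lw l := by
  rcases l with ⟨k, d⟩ | ⟨k, d⟩
  · exact P.tv_mem_lineSub ((d.isValue_iff _).mp h) (hP.tyurin_Tpoly hC)
  · exact hP.tv_tyurin_mem_dualSub hC ((d.isValue_iff _).mp h)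

theorem nu_sub (s : ℂ) (d : Fin 2) : P.vt (P.nu s d - P.nu s (d + 1)) ≠ 0 := by
  have := hP.vt_two_θi (sg_mem_signs d)
  convert this using 2
  rw [nu, nu, sg_add_one]; ring

/-- The two exponents differ by 2θ_∞ up to sign, which is not in Λ_τ. -/
theorem exists_facAt_ne_zero (e : Fin 2) (k : Fin 4) : ∃ d, P.facAt e k d k ≠ 0 := by
  by_contra! hcon
  refine hP.nu_sub (P.ex e) 1 ?_
  have := hP.vt_sub_eq_zero (hcon 0) (hcon 1)
  convert this using 2
  simp

/-- The two exponents differ by 2θ₀ up to sign, which is not in Λ_τ. -/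
theorem exists_facAt_ne_zero' (k : Fin 4) (d : Fin 2) : ∃ e, P.facAt e k d k ≠ 0 := by
  by_contra! hcon
  refine hP.vt_two_θ0 neg_one_mem_signs ?_
  have := hP.vt_sub_eq_zero (hcon 0) (hcon 1)
  convert this using 2
  simp [nu, ex, sg]; ring

theorem Ninf_dualR_ne_zero {k : Fin 4} {e d : Fin 2} (h : P.facAt e k d k ≠ 0) :
    P.Ninf (P.tv (P.dualR k e (Pi.single (d + 1) 1))) ≠ 0 := by
  rw [hP.Ninf_tv]
  intro h0
  have := hP.eq_of_Tpoly_zero_dualR (by simp) h0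
  have := (eq_mul_swap d (Pi.single (d + 1) (1 : ℂ)) (fun d => P.facAt e k d k)).mp this
  have hd : ∀ d : Fin 2, d ≠ d + 1 := by decide
  rw [Pi.single_eq_same, Pi.single_eq_of_ne (hd d), one_mul, zero_mul] at this
  exact h this

/-- Every line has finite points. -/
theorem exists_Ninf_ne_zero (l : LineName) : ∃ v ∈ linSub P.lw l, P.Ninf v ≠ 0 := by
  rcases l with ⟨k, d⟩ | ⟨k, d⟩
  -- The finite point is the intersection with a dual line of the same index k; at least one of the
  -- two dual lines works.
  · obtain ⟨e, he⟩ := hP.exists_facAt_ne_zero' k d.idx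
    refine ⟨_, P.tv_mem_lineSub (d := d.idx) ?_ (hP.dualR_Tpoly k e _), hP.Ninf_dualR_ne_zero he⟩
    have hd : ∀ d : Fin 2, d ≠ d + 1 := by decide
    simp [dualR, hd]
  · obtain ⟨c, hc⟩ := hP.exists_facAt_ne_zero d.idx k
    refine ⟨_, ?_, hP.Ninf_dualR_ne_zero hc⟩
    rw [hP.tv_dualR, linSub, ← range_dualParam]
    exact LinearMap.mem_range_self _ _

/-- The hypothesis `hcross` says that a quotient of products of two linear theta factors takes the
same value l at x_a and x_b. The numerator minus l times the denominator has degree two, and `hc`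
keeps x_a x_b away from its multiplier, so it vanishes identically. At the zero of the first factor
of the numerator the denominator is nonzero, hence l = 0, a contradiction. -/
theorem false_of_cross {i j a b c : Fin 4} {e : Fin 2} (hab : a ≠ b)
    (hc : P.xi a + P.xi b + P.xi i + P.xi j - 2 * P.kap = P.xi i - P.xi c) (hic : i ≠ c)
    (hij : P.vt (P.xi j - P.xi i + 2 * P.ex e) ≠ 0)
    (h0 : P.facAt e i 1 a * P.facAt (e + 1) j 0 a ≠ 0)
    (h1 : P.facAt e i 0 a * P.facAt (e + 1) j 1 a ≠ 0)
    (hcross : P.facAt e i 0 a * P.facAt (e + 1) j 1 a * (P.facAt e i 1 b * P.facAt (e + 1) j 0 b) =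
      P.facAt e i 1 a * P.facAt (e + 1) j 0 a * (P.facAt e i 0 b * P.facAt (e + 1) j 1 b)) :
    False := by
  have hx := hP.x_ne_zero
  set l := P.facAt e i 0 a * P.facAt (e + 1) j 1 a / (P.facAt e i 1 a * P.facAt (e + 1) j 0 a)
    with hl
  have t := fun s k d => hP.isTheta_fac s k d
  have hmu : P.mu (P.ex e) 1 * P.mu (P.ex (e + 1)) 0 = P.mu (P.ex e) 0 * P.mu (P.ex (e + 1)) 1 := by
    simp only [mu, ← P.pow_add hP.q_pos, nu]; congr 1; ring
  have hF := ((t (P.ex e) i 0).mul (t (P.ex (e + 1)) j 1)).sub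
    ((((t (P.ex e) i 1).mul (t (P.ex (e + 1)) j 0)).const_mul l).congr_const
      (d := P.mu (P.ex e) 0 / P.x i * (P.mu (P.ex (e + 1)) 1 / P.x j))
      (by rw [div_mul_div_comm, hmu, div_mul_div_comm]))
  have hmu' : P.mu (P.ex e) 0 / P.x i * (P.mu (P.ex (e + 1)) 1 / P.x j) =
      P.pow (2 * P.kap - P.xi i - P.xi j) := by
    rw [hP.x_eq, hP.x_eq, mu, mu, ← P.pow_sub hP.q_pos, ← P.pow_sub hP.q_pos,
      ← P.pow_add hP.q_pos]
    congr 1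
    simp only [nu, P.ex_add_one, sg]
    simp; ring
  rw [hmu'] at hF
  have hzero : ∀ z, z ≠ 0 → P.fac (P.ex e) i 0 z * P.fac (P.ex (e + 1)) j 1 z -
      l * (P.fac (P.ex e) i 1 z * P.fac (P.ex (e + 1)) j 0 z) = 0 := fun z hz => by
    refine hF.eq_zero_of_two hP.q_pos hP.q_lt_one (P.pow_ne_zero hP.q_pos _) (hx a) (hx b)
      (hP.th_x_div_ne_zero hab) ?_ ?_ ?_ hz
    · simp only [hP.fac_x]
      rw [hl, div_mul_cancel₀ _ h0, sub_self]
    · simp only [hP.fac_x]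
      rw [hl, div_mul_eq_mul_div, sub_eq_zero, eq_div_iff h0]
      linear_combination -hcross
    · rw [hP.x_eq, hP.x_eq, P.th_mul_div hP.q_pos]
      rw [show P.xi a + P.xi b - (2 * P.kap - P.xi i - P.xi j) = P.xi i - P.xi c by
        linear_combination hc]
      exact hP.vt_xi_sub hic
  have hl0 : l = 0 := by
    have hz0 : P.mu (P.ex e) 0 / P.x i ≠ 0 := div_ne_zero (hP.mu_ne_zero _ _) (hx i)
    have := hzero _ hz0
    rw [P.fac_eq (P.ex e) i 0, div_self hz0, qTheta_one hP.q_pos hP.q_lt_one, zero_mul, zero_sub,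
      neg_eq_zero, hP.fac_zero_left, hP.fac_zero_left] at this
    refine (mul_eq_zero.mp this).resolve_right (mul_ne_zero ?_ ?_)
    · have := hP.nu_sub (P.ex e) 0
      rwa [sub_self, add_zero]
    · convert hij using 2
      simp only [nu, P.ex_add_one]; ring
  exact div_ne_zero h1 h0 hl0

/-- Proportionality in two splittings is an equality of theta quotients at two points, excluded by
`false_of_cross` with i = j. Up to cyclic shifts only neighbouring splittings occur. -/
theorem lw_not_proportional (m n : Fin 3) (hmn : m ≠ n) :
    P.lw 0 m * P.lw 1 n ≠ P.lw 0 n * P.lw 1 m := by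
  have main : ∀ m : Fin 3, P.lw 0 m * P.lw 1 (m + 1) ≠ P.lw 0 (m + 1) * P.lw 1 m := by
    intro m h
    have hf := fun e n d => hP.facAt_ne_zero e (oth_ne 0 n) d
    refine hP.false_of_cross (i := 0) (j := 0) (a := oth 0 m) (b := oth 0 (m + 1))
      (c := oth 0 (m + 2)) (e := 0) (oth_ne_oth _ _ _ (by simp)) ?_ (oth_ne _ _).symm ?_
      (mul_ne_zero (hf _ _ _) (hf _ _ _)) (mul_ne_zero (hf _ _ _) (hf _ _ _)) ?_
    · linear_combination P.sum_xi_oth 0 m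
    · have := hP.vt_two_θ0 one_mem_signs
      convert this using 2
      simp [ex, sg]
    · simp only [lw, P.Wf_pr_zero] at h
      have t0 := hP.T_ne_zero (pr 0 0 m)
      have t1 := hP.T_ne_zero (pr 0 0 (m + 1))
      rw [zero_add]
      have h01 := hf 0 m 1
      have h02 := hf 0 (m + 1) 1
      have h03 := hf 1 m 1
      have h04 := hf 1 (m + 1) 1
      field_simp at h
      linear_combination h
  rcases fin3_cases m n with rfl | rfl | rfl
  · exact absurd rfl hmn
  · exact main m
  · have := main (m + 2)
    rw [fin3_shift₁] at this
    exact fun h => this h.symm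

/-! ### Finiteness of the intersection points -/

section Finiteness

variable (hF : P.FinitenessConditions)

include hF

theorem facAt_ne_zero_of_finiteness (e : Fin 2) (k : Fin 4) (d : Fin 2) (j : Fin 4) :
    P.facAt e k d j ≠ 0 := by
  by_cases h : j = k
  · subst h
    exact hF.vt_two_xi hP j (sg_mem_signs e) (sg_mem_signs d)
  · exact hP.facAt_ne_zero e h d

/-- The line makes one coordinate of the parameter s vanish. At infinity s is proportional to the
values of `facAt` at x_k, neither of which is zero. -/
theorem Ninf_line_dual {k : Fin 4} {d e : Fin 2} {v : Fin 6 → ℂ} (hv : v ≠ 0)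
    (h : v ∈ lineSub k d) (h' : v ∈ dualSub P.lw k e) : P.Ninf v ≠ 0 := by
  obtain ⟨s, rfl, hs⟩ := hP.exists_tv_dualR h'
  have hs := hs hv
  intro h0
  rw [hP.Ninf_tv] at h0
  have h1 := (eq_mul_swap d s (fun d => P.facAt e k d k)).mp (hP.eq_of_Tpoly_zero_dualR hs h0)
  have h2 : s d = 0 := by
    have := h.1 0
    rw [hP.tv_dualR_pr] at this
    refine (mul_eq_zero.mp ((mul_eq_zero.mp this).resolve_right ?_)).resolve_right
      (hP.facProd_ne_zero _ _ _)
    exact mul_ne_zero (hP.T_ne_zero _) (div_ne_zero (hP.facAt_ne_zero e (oth_ne _ _) _)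
      (hP.facAt_ne_zero e (oth_ne _ _) _))
  rw [h2, zero_mul] at h1
  have h3 := (mul_eq_zero.mp h1).resolve_right (hP.facAt_ne_zero_of_finiteness hF e k d k)
  apply hs
  funext c
  rcases fin2_eq_or d c with rfl | rfl
  · exact h2
  · exact h3

/-- Here ρ_i and ρ_j take opposite special values. If the point were at infinity, rows f and w with
exponents θ₀ and 0 would both interpolate, with entries of known zeros x_i and x_j. They are
parallel since θ₀ ∉ Λ_τ, and the remaining identity of theta functions forces w = 0. -/
theorem Ninf_diffVec (i : Fin 4) (d : Fin 2) (m : Fin 3) : P.Ninf (diffVec i d m) ≠ 0 := by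
  have hd : ∀ d : Fin 2, d + 1 ≠ d := by decide
  obtain ⟨c1, c2, c3⟩ := diffVec_other i d m
  have hmem : diffVec i d m ∈ lineSub i d := by
    refine ⟨diffVec_self i d m, ?_⟩
    rw [sum_shift m, c1, c2, c3]; ring
  set v := diffVec i d m with hv
  obtain ⟨a, ha, hav⟩ := hP.tv_lineR hmem
  intro h0
  have hT : P.Tpoly P.θ0 (P.lineR i d v) = 0 := by
    rw [← P.sum_tv, hav]
    simp only [Pi.smul_apply, ← Finset.smul_sum]
    rw [(linSub_segreForm (w := P.lw) hP.sum_lw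
      (.line i (if d = 0 then .zero else .infty)) (by
        rcases fin2_eq_or 0 d with rfl | rfl
        · exact hmem
        · exact hmem)).1, smul_zero]
  have hT0 : P.Tpoly 0 (P.lineR i d v) = 0 := by
    rw [← hP.Ninf_tv, hav, map_smul, h0, smul_zero]
  set r := P.lineR i d v with hr
  set j := oth i m with hj
  have hji : j ≠ i := oth_ne i m
  have hrne : ∀ k, r k ≠ 0 := hP.lineR_ne_zero i d v
  have hri : r i d = 0 := by simp [hr, lineR]
  have hrd : ∀ n, r (oth i n) d ≠ 0 := fun n => by
    simp only [hr, lineR, oth_ne, if_false, if_true]; exact hP.T_ne_zero _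
  have hrd1 : ∀ n, r (oth i n) (d + 1) = v (pr i (d + 1) n) := fun n => by
    simp only [hr, lineR, oth_ne, if_false, hd, oc_oth]
  have hrj : r j (d + 1) = 0 := by rw [hj, hrd1, c1]
  rw [← P.Tpoly_ex 0, ← hP.hasInterpolant_iff] at hT
  rw [← hP.hasInterpolant_iff] at hT0
  obtain ⟨f, hf, hfne, hfr⟩ := hT
  obtain ⟨w, hw, hwne, hwr⟩ := hT0
  obtain ⟨α, hα, hfα⟩ := hP.row_eq_of_special hf hfne hfr (hrne i) hri
    (oth_ne_oth i 0 1 (by decide)) (hrd 0) (hrd 1)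
  obtain ⟨β, hβ, hfβ⟩ := hP.row_eq_of_special hf hfne hfr (hrne j) hrj
    (oth_ne_oth i (m + 1) (m + 2) (by simp)) (by rw [hrd1, c2]; exact one_ne_zero)
    (by rw [hrd1, c3]; exact neg_ne_zero.mpr one_ne_zero)
  have hx := hP.x_ne_zero
  have hspec : ∀ k c, r k c = 0 → w c (P.x k) = 0 := by
    intro k c hc
    have := (eq_mul_swap c (r k) (fun d => w d (P.x k))).mp (hwr k)
    rw [hc, zero_mul] at this
    refine (mul_eq_zero.mp this).resolve_left fun h1 => hrne k ?_
    funext b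
    rcases fin2_eq_or c b with rfl | rfl
    · exact hc
    · exact h1
  obtain ⟨K, hK⟩ := (hw d).degree_two hP.q_pos hP.q_lt_one (hP.mu_ne_zero _ _) (hx i)
    (hspec i d hri)
  obtain ⟨K', hK'⟩ := (hw (d + 1)).degree_two hP.q_pos hP.q_lt_one (hP.mu_ne_zero _ _) (hx j)
    (hspec j (d + 1) hrj)
  have hcr : ∀ z, z ≠ 0 → f d z * w (d + 1) z = f (d + 1) z * w d z := by
    intro z hz
    have := hP.cross_eq_zero hf hw hrne hfr hwr
      (by rw [add_zero]; exact hP.vt_θ0 (sg_mem_signs 0)) hz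
    rcases fin2_eq_or 0 d with h | h
    · rw [h]; exact this
    · rw [h, zero_add, show (1 : Fin 2) + 1 = 0 from rfl]; exact this.symm
  have t := fun s k d => hP.isTheta_fac s k d
  have hc : ∀ z, z ≠ 0 → α * K' * (P.fac (P.ex 0) i d z * P.fac 0 j (d + 1) z) =
      β * K * (P.fac (P.ex 0) j (d + 1) z * P.fac 0 i d z) := by
    have t1 := ((t (P.ex 0) i d).mul (t 0 j (d + 1))).const_mul (α * K')
    have t2 := (((t (P.ex 0) j (d + 1)).mul (t 0 i d)).const_mul (β * K)).congr_const
      (d := P.mu (P.ex 0) d / P.x i * (P.mu 0 (d + 1) / P.x j)) (by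
        rw [hP.mu_div (P.ex 0) 0 d, hP.mu_div (P.ex 0) 0 (d + 1)]; ring)
    have hh := (isTheta_qTheta hP.q_pos hP.q_lt_one (hx i)).mul
      (isTheta_qTheta hP.q_pos hP.q_lt_one (hx j))
    rcases hh.eq_zero_or_eq_zero (t1.sub t2)
      (fun z hz => by
        have := hcr z hz
        rw [hfα z hz, hfβ z hz, hK z hz, hK' z hz] at this
        simp only [fac] at this ⊢
        linear_combination this) with h | h
    · obtain ⟨z, hz, hz'⟩ := exists_qTheta_mul_ne_zero hP.q_pos hP.q_lt_one (hx i) (hx j)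
      exact absurd (h z hz) hz'
    · exact fun z hz => sub_eq_zero.mp (h z hz)
  have hij : ∀ s s', s = s' → P.vt (P.nu s d - P.nu s' (d + 1) + (P.xi j - P.xi i)) ≠ 0 := by
    rintro s _ rfl
    have := hF.vt_xi_sub_θi hP hji (sg_mem_signs d)
    convert this using 2
    rw [nu, nu, sg_add_one]; ring
  have hs : ∀ s s', P.vt (s - s') ≠ 0 →
      P.vt (P.nu s d - P.nu s' d + (P.xi i - P.xi i)) ≠ 0 := by
    intro s s' h
    convert h using 2
    rw [nu, nu]; ring
  have hone : qTheta P.q 1 = 0 := qTheta_one hP.q_pos hP.q_lt_one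
  -- Evaluation at the zero of the linear factor with exponent 0 isolates K'; the zero of the one
  -- with exponent θ₀ isolates K below. The other factors are nonzero as θ₀ ∉ Λ_τ and by the
  -- finiteness condition on ξ_j - ξ_i ± 2θ_∞.
  have hK'0 : K' = 0 := by
    have hz0 : P.mu 0 d / P.x i ≠ 0 := div_ne_zero (hP.mu_ne_zero _ _) (hx i)
    have := hc _ hz0
    rw [P.fac_eq 0 i d, div_self hz0, hone, mul_zero, mul_zero, hP.fac_zero_left,
      hP.fac_zero_left] at this
    have := (mul_eq_zero.mp this).resolve_right (mul_ne_zero (hs _ _ ?_) (hij _ _ rfl))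
    · exact (mul_eq_zero.mp this).resolve_left hα
    · rw [zero_sub, ← P.ex_add_one]; exact hP.vt_θ0 (sg_mem_signs _)
  have hK0 : K = 0 := by
    have hz0 : P.mu (P.ex 0) d / P.x i ≠ 0 := div_ne_zero (hP.mu_ne_zero _ _) (hx i)
    have := hc _ hz0
    rw [P.fac_eq (P.ex 0) i d, div_self hz0, hone, zero_mul, mul_zero, hP.fac_zero_left,
      hP.fac_zero_left] at this
    have := (mul_eq_zero.mp this.symm).resolve_right (mul_ne_zero (hij _ _ rfl) (hs _ _ ?_))
    · exact (mul_eq_zero.mp this).resolve_left hβ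
    · rw [sub_zero]; exact hP.vt_θ0 (sg_mem_signs _)
  obtain ⟨z, c, hz, hwz⟩ := hwne
  apply hwz
  rcases fin2_eq_or d c with rfl | rfl
  · rw [hK z hz, hK0, zero_mul]
  · rw [hK' z hz, hK'0, zero_mul]

/-- At infinity the value at x_k also follows the linear factors, so the Tyurin parameters are the
values of `facAt` at all four points, for either line. Equality of the two points is then an
equality of theta quotients excluded by `false_of_cross`. -/
theorem Ninf_dual_dual {i j : Fin 4} (hij : i ≠ j) {e : Fin 2} {v : Fin 6 → ℂ} (hv : v ≠ 0)
    (h : v ∈ dualSub P.lw i e) (h' : v ∈ dualSub P.lw j (e + 1)) : P.Ninf v ≠ 0 := by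
  obtain ⟨n, rfl⟩ := exists_oth i j hij.symm
  have hA := hP.facAt_ne_zero_of_finiteness hF
  obtain ⟨s, rfl, hs⟩ := hP.exists_tv_dualR h
  obtain ⟨s', hss, hs'⟩ := hP.exists_tv_dualR h'
  have hs := hs hv
  have hs' := hs' hv
  intro h0
  have r1 := hP.eq_of_Tpoly_zero_dualR hs (by rw [← hP.Ninf_tv, h0])
  have r2 := hP.eq_of_Tpoly_zero_dualR hs' (by rw [← hP.Ninf_tv, hss, h0])
  have cst : ∀ {k : Fin 4} {e : Fin 2} {s : Fin 2 → ℂ}, s ≠ 0 →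
      s 1 * P.facAt e k 0 k = s 0 * P.facAt e k 1 k →
      ∃ c : ℂ, c ≠ 0 ∧ ∀ j, P.dualR k e s j = (if j = k then c else 1) •
        fun d => P.facAt e k d j := by
    intro k e s hs hr
    obtain ⟨c, hc, hsc⟩ := exists_smul_of_cross (v := fun d => P.facAt e k d k) hs
      (fun h => hA e k 0 k (congrFun h 0)) (by linear_combination -hr)
    refine ⟨c, hc, fun j => ?_⟩
    by_cases hj : j = k
    · subst hj
      funext d
      simp only [dualR, if_true]
      exact congrFun hsc d
    · funext d
      simp [dualR, hj]
  obtain ⟨c, hc, hr⟩ := cst hs r1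
  obtain ⟨c', hc', hr'⟩ := cst hs' r2
  rw [P.tv_smul _ _ _ hr, P.tv_smul _ _ _ hr'] at hss
  have hne : ∀ (k : Fin 4) (c : ℂ), c ≠ 0 → ∀ j : Fin 4, (if j = k then c else 1) ≠ 0 := by
    intro k c hc j
    split_ifs
    · exact hc
    · exact one_ne_zero
  have n1 := mul_ne_zero (mul_ne_zero (mul_ne_zero (hne i c hc 0) (hne i c hc 1)) (hne i c hc 2))
    (hne i c hc 3)
  set k1 := (if (0 : Fin 4) = i then c else 1) * (if (1 : Fin 4) = i then c else 1) *
    (if (2 : Fin 4) = i then c else 1) * (if (3 : Fin 4) = i then c else 1)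
  have n2 := mul_ne_zero (mul_ne_zero (mul_ne_zero (hne (oth i n) c' hc' 0)
    (hne (oth i n) c' hc' 1)) (hne (oth i n) c' hc' 2)) (hne (oth i n) c' hc' 3)
  set k2 := (if (0 : Fin 4) = oth i n then c' else 1) * (if (1 : Fin 4) = oth i n then c' else 1) *
    (if (2 : Fin 4) = oth i n then c' else 1) * (if (3 : Fin 4) = oth i n then c' else 1)
  have hm : ∀ p, k2 * mono (fun j d => P.facAt (e + 1) (oth i n) d j) p =
      k1 * mono (fun j d => P.facAt e i d j) p := by
    intro p
    have := congrFun hss p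
    simp only [tv, Pi.smul_apply, smul_eq_mul] at this
    apply mul_left_cancel₀ (hP.T_ne_zero p)
    linear_combination this
  -- The quotient of these two monomials is the ratio of ρ_i to ρ_b, where b = `oth i (n + 1)`; the
  -- other parameters cancel.
  have m1 := hm (pr i 0 (n + 2))
  have m2 := hm (pr i 1 n)
  rw [mono_pr, mono_pr, fin3_shift₁, fin3_shift₂, zero_add] at m1
  rw [mono_pr, mono_pr, show (1 : Fin 2) + 1 = 0 from rfl] at m2
  refine hP.false_of_cross (i := i) (j := oth i n) (a := i) (b := oth i (n + 1))
    (c := oth i (n + 2)) (e := e) (oth_ne _ _).symm ?_ (oth_ne _ _).symm ?_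
    (mul_ne_zero (hA _ _ _ _) (hA _ _ _ _)) (mul_ne_zero (hA _ _ _ _) (hA _ _ _ _)) ?_
  · linear_combination P.sum_xi_oth i n
  · have := hF.vt_xi_sub_θ0 hP hij.symm (sg_mem_signs e)
    convert this using 2
    rw [ex]; ring
  · have key := congrArg₂ (· * ·) m1 m2.symm
    have c1 := hA e i 0 (oth i (n + 2))
    have c2 := hA e i 1 (oth i n)
    have c3 := hA (e + 1) (oth i n) 0 (oth i (n + 2))
    have c4 := hA (e + 1) (oth i n) 1 (oth i n)
    apply mul_left_cancel₀ (mul_ne_zero (mul_ne_zero n1 n2)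
      (mul_ne_zero (mul_ne_zero c1 c2) (mul_ne_zero c3 c4)))
    linear_combination -key

/-- Finiteness of the intersection points. -/
theorem Ninf_ne_zero_of_meets {l m : LineName} (h : l.Meets m) {v : Fin 6 → ℂ} (hv : v ≠ 0)
    (hl : v ∈ linSub P.lw l) (hm : v ∈ linSub P.lw m) : P.Ninf v ≠ 0 := by
  rcases l with ⟨i, d⟩ | ⟨i, d⟩ <;> rcases m with ⟨j, e⟩ | ⟨j, e⟩
  · obtain ⟨hij, hde⟩ := h
    obtain ⟨m, h1, h2, h3⟩ := exists_common_shift hij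
    rw [linSub, Diamond.idx_ne hde] at hm
    obtain ⟨c, rfl⟩ := (lineSub_inter_line h1 h2 h3 v).mp ⟨hl, hm⟩
    rw [map_smul, smul_eq_mul]
    exact mul_ne_zero (fun h => hv (by rw [h, zero_smul])) (hP.Ninf_diffVec hF i d.idx m)
  · obtain rfl : i = j := h
    exact hP.Ninf_line_dual hF hv hl hm
  · obtain rfl : i = j := h
    exact hP.Ninf_line_dual hF hv hm hl
  · obtain ⟨hij, hde⟩ := h
    rw [linSub, Diamond.idx_ne hde] at hm
    exact hP.Ninf_dual_dual hF hij hv hl hm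

end Finiteness

end Admissible
end Params

/-! ### The Segre surface -/

theorem affineVec_eq (η : Fin 6 → ℂ) : affineVec η = ![η 0, η 1, η 2, η 3, η 4, η 5, 1] := by
  funext i
  fin_cases i <;> rfl

/-- The number τ is purely imaginary, so real parts of lattice points are integers. -/
theorem half_notMem_lattice (q : ℝ) : (1 / 2 : ℂ) ∉ lattice q := by
  rintro ⟨m, n, h⟩
  have e : tau q = ((-(2 * Real.pi) / Real.log q : ℝ) : ℂ) * Complex.I := by
    rw [tau]; push_cast; ring
  have := congrArg Complex.re h
  rw [e] at this
  simp at this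
  have h2 : (1 : ℝ) = 2 * m := by linarith
  have h3 : (1 : ℤ) = 2 * m := by exact_mod_cast h2
  omega

namespace Params

variable (P : Params)

theorem SegreEquations.smul {P : Params} {N : Fin 7 → ℂ} (h : P.SegreEquations N) (c : ℂ) :
    P.SegreEquations (c • N) := by
  obtain ⟨h1, h2, h3, h4⟩ := h
  refine ⟨?_, ?_, ?_, ?_⟩
  · simp only [Pi.smul_apply, smul_eq_mul]; linear_combination c * h1
  · simp only [Pi.smul_apply, smul_eq_mul, mul_left_comm _ c, ← Finset.mul_sum]
    rw [h2, mul_zero]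
  · simp only [Pi.smul_apply, smul_eq_mul]; linear_combination c ^ 2 * h3
  · simp only [Pi.smul_apply, smul_eq_mul]; linear_combination c ^ 2 * h4

/-- The coordinate `N_∞` as a function of the other coordinates. -/
def liftN : (Fin 6 → ℂ) →ₗ[ℂ] (Fin 7 → ℂ) where
  toFun v := ![v 0, v 1, v 2, v 3, v 4, v 5, P.Ninf v / P.etaConst]
  map_add' v w := by
    funext i
    fin_cases i <;> simp [add_div]
  map_smul' c v := by
    funext i
    fin_cases i <;> simp [mul_div_assoc]

theorem liftN_apply (v : Fin 6 → ℂ) :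
    P.liftN v = ![v 0, v 1, v 2, v 3, v 4, v 5, P.Ninf v / P.etaConst] := rfl

theorem liftN_injective : Function.Injective P.liftN := by
  intro v w h
  funext p
  have := congrFun h p.castSucc
  fin_cases p <;> exact this

/-- The cones over the sixteen lines. -/
def cone (l : LineName) : Submodule ℂ (Fin 7 → ℂ) := (linSub P.lw l).map P.liftN

theorem liftN_mem_cone {l : LineName} {v : Fin 6 → ℂ} :
    P.liftN v ∈ P.cone l ↔ v ∈ linSub P.lw l :=
  by
  rw [cone, Submodule.mem_map]
  exact ⟨fun ⟨w, hw, h⟩ => P.liftN_injective h ▸ hw, fun h => ⟨v, h, rfl⟩⟩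

namespace Admissible

variable {P} (hP : P.Admissible)

include hP

theorem etaConst_ne_zero : P.etaConst ≠ 0 := by
  have h : P.vt (1 / 2) ≠ 0 :=
    P.vt_ne_zero_of_eq hP.q_pos hP.q_lt_one _ (half_notMem_lattice P.q) rfl
  have h' : P.vt P.θ0 ≠ 0 := by simpa using hP.vt_θ0 one_mem_signs
  exact div_ne_zero (mul_ne_zero h (P.vt_neg_ne_zero hP.q_pos hP.q_lt_one h))
    (mul_ne_zero h' (P.vt_neg_ne_zero hP.q_pos hP.q_lt_one h'))

/-- The equation of the surface involving N_∞ thus reads c N_∞ = ∑ (T'_ij / T_ij) N_ij, which is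
T'(ρ) for N_ij = T_ij ρ_i ρ_j. -/
theorem a_castSucc (p : Fin 6) : P.a p.castSucc = P.T' p / P.T p := by
  have h := hP.T_ne_zero p
  rw [← Tat_zero, Tat_eq]
  rw [← Tat_θ0, Tat_eq] at h ⊢
  fin_cases p <;>
    simp only [Fin.reduceFinMk, Fin.zero_eta, Fin.mk_one, Matrix.cons_val, zero_add, neg_zero,
      sub_eq_add_neg] at h ⊢
  · rw [mul_div_mul_right _ _ (right_ne_zero_of_mul h), ← div_mul_div_comm]
    rfl
  · rw [neg_div_neg_eq, mul_div_mul_left _ _ (left_ne_zero_of_mul (neg_ne_zero.mp h)),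
      ← div_mul_div_comm]
    change P.aQuot (P.θt + P.θ1 + P.θi) = _
    simp only [aQuot, add_assoc]
  · rw [mul_div_mul_right _ _ (right_ne_zero_of_mul h),
      mul_div_mul_left _ _ (left_ne_zero_of_mul (left_ne_zero_of_mul h)), ← div_mul_div_comm]
    change P.aQuot (P.θt - P.θ1 + P.θi) = _
    simp only [aQuot, sub_eq_add_neg, add_assoc]
  · rw [mul_div_mul_right _ _ (right_ne_zero_of_mul h),
      mul_div_mul_left _ _ (left_ne_zero_of_mul (left_ne_zero_of_mul h)), ← div_mul_div_comm]
    change P.aQuot (-P.θt + P.θ1 + P.θi) = _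
    simp only [aQuot, add_assoc]
  · rw [neg_div_neg_eq, mul_div_mul_right _ _ (right_ne_zero_of_mul (neg_ne_zero.mp h)),
      mul_div_mul_left _ _ (left_ne_zero_of_mul (left_ne_zero_of_mul (neg_ne_zero.mp h))),
      ← div_mul_div_comm]
    change P.aQuot (-P.θt - P.θ1 + P.θi) = _
    simp only [aQuot, sub_eq_add_neg, add_assoc]
  · rw [mul_div_mul_right _ _ (right_ne_zero_of_mul h),
      mul_div_mul_right _ _ (right_ne_zero_of_mul (left_ne_zero_of_mul h)), ← div_mul_div_comm]
    rfl

/-- The Segre equations in terms of the six coordinates `N_{ij}`. -/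
theorem segreEquations_liftN (v : Fin 6 → ℂ) :
    P.SegreEquations (P.liftN v) ↔ SegreForm P.lw v := by
  have hT := hP.T_ne_zero
  have hpw := P.pow_ne_zero hP.q_pos (-(2 * P.θi))
  have hlin : ∑ i, P.a i * P.liftN v i = 0 := by
    rw [Fin.sum_univ_castSucc]
    have : ∀ p : Fin 6, P.a p.castSucc * P.liftN v p.castSucc = P.T' p / P.T p * v p := by
      intro p
      rw [hP.a_castSucc]
      congr 1
      fin_cases p <;> rfl
    simp only [this]
    rw [← P.Ninf_apply]
    change _ + -P.etaConst * (P.Ninf v / P.etaConst) = 0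
    have := hP.etaConst_ne_zero
    field_simp
    ring
  have hT05 := mul_ne_zero (hT 0) (hT 5)
  constructor
  · rintro ⟨h1, -, h3, h4⟩
    refine ⟨by rw [Fin.sum_univ_six]; exact h1, ?_⟩
    have h3 : v 1 * v 4 - P.b₁ * (v 0 * v 5) = 0 := h3
    have h4 : v 2 * v 3 - P.b₂ * (v 0 * v 5) = 0 := h4
    have key : ∀ m, v (pr 0 0 m) * v (pr 0 1 m) * (P.T 0 * P.T 5) =
        P.T (pr 0 0 m) * P.T (pr 0 1 m) * (v 0 * v 5) := by
      intro m
      fin_cases m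
      · exact mul_comm _ _
      · change v 1 * v 4 * (P.T 0 * P.T 5) = P.T 1 * P.T 4 * (v 0 * v 5)
        rw [sub_eq_zero.mp h3, b₁, mul_right_comm, div_mul_cancel₀ _ hT05]
      · change v 2 * v 3 * (P.T 0 * P.T 5) = P.T 2 * P.T 3 * (v 0 * v 5)
        rw [sub_eq_zero.mp h4, b₂, mul_right_comm, div_mul_cancel₀ _ hT05]
    intro m n
    rw [hP.lw_mul_lw, hP.lw_mul_lw]
    apply mul_right_cancel₀ hT05
    linear_combination P.pow (-(2 * P.θi)) * (P.T (pr 0 0 n) * P.T (pr 0 1 n)) * key m -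
      P.pow (-(2 * P.θi)) * (P.T (pr 0 0 m) * P.T (pr 0 1 m)) * key n
  · rintro ⟨h1, h2⟩
    rw [Fin.sum_univ_six] at h1
    have key : ∀ m, v (pr 0 0 m) * v (pr 0 1 m) * (P.T 0 * P.T 5) =
        v 0 * v 5 * (P.T (pr 0 0 m) * P.T (pr 0 1 m)) := by
      intro m
      have := h2 m 0
      rw [hP.lw_mul_lw, hP.lw_mul_lw] at this
      apply mul_left_cancel₀ hpw
      exact (mul_left_comm _ _ _).trans (this.trans (mul_left_comm _ _ _))
    refine ⟨h1, hlin, ?_, ?_⟩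
    · change v 1 * v 4 - P.b₁ * (v 0 * v 5) = 0
      have : v 1 * v 4 * (P.T 0 * P.T 5) = v 0 * v 5 * (P.T 1 * P.T 4) := key 1
      rw [b₁]
      apply mul_right_cancel₀ hT05
      have e := div_mul_cancel₀ (P.T 1 * P.T 4) hT05
      linear_combination this - v 0 * v 5 * e
    · change v 2 * v 3 - P.b₂ * (v 0 * v 5) = 0
      have : v 2 * v 3 * (P.T 0 * P.T 5) = v 0 * v 5 * (P.T 2 * P.T 3) := key 2
      rw [b₂]
      apply mul_right_cancel₀ hT05
      have e := div_mul_cancel₀ (P.T 2 * P.T 3) hT05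
      linear_combination this - v 0 * v 5 * e

/-- The coefficient of N_∞ in the second linear equation is nonzero. -/
theorem exists_eq_liftN {N : Fin 7 → ℂ} (h : P.SegreEquations N) : ∃ v, N = P.liftN v := by
  refine ⟨fun p => N p.castSucc, ?_⟩
  have h2 := h.2.1
  rw [Fin.sum_univ_castSucc] at h2
  simp only [hP.a_castSucc] at h2
  have h3 : P.Ninf (fun p => N p.castSucc) - P.etaConst * N 6 = 0 := by
    rw [P.Ninf_apply, ← h2, sub_eq_add_neg, ← neg_mul]; rfl
  have hc := hP.etaConst_ne_zero
  funext i
  rw [liftN_apply]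
  fin_cases i <;> try rfl
  change N 6 = P.Ninf (fun p => N p.castSucc) / P.etaConst
  rw [sub_eq_zero.mp h3, mul_div_cancel_left₀ _ hc]

theorem affineVec_smul {v : Fin 6 → ℂ} (h : P.Ninf v ≠ 0) :
    affineVec ((P.etaConst / P.Ninf v) • v) = (P.etaConst / P.Ninf v) • P.liftN v := by
  have hc := hP.etaConst_ne_zero
  rw [affineVec_eq, liftN_apply]
  funext i
  fin_cases i <;> try rfl
  simp only [Fin.reduceFinMk, Matrix.cons_val, Pi.smul_apply, smul_eq_mul]
  field_simp

theorem eta_eq (C : ℂ → Matrix (Fin 2) (Fin 2) ℂ) :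
    P.eta C = (P.etaConst / P.Ninf (P.tv (P.tyurin C))) • P.tv (P.tyurin C) := by
  funext p
  rw [hP.Ninf_tv, Pi.smul_apply, smul_eq_mul, eta]
  change P.etaConst * (P.tv (P.tyurin C) p / P.Tpoly 0 (P.tyurin C)) = _
  ring

theorem finrank_linSub (l : LineName) : Module.finrank ℂ (linSub P.lw l) = 2 := by
  rcases l with ⟨k, d⟩ | ⟨k, d⟩
  · exact finrank_lineSub k d.idx
  · exact finrank_dualSub hP.lw_ne_zero k d.idx

theorem finrank_cone (l : LineName) : Module.finrank ℂ (P.cone l) = 2 := by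
  rw [cone, ← (Submodule.equivMapOfInjective P.liftN P.liftN_injective _).finrank_eq,
    hP.finrank_linSub]

/-- The points of a line at finite distance. -/
theorem cone_realized (l : LineName) :
    {v : Fin 7 → ℂ | ∃ hv : v ≠ 0, Projectivization.mk ℂ v hv ∈
      {p | ∃ C, P.IsConnectionMatrix C ∧ P.LineCondition C l ∧ p = affineEmb (P.eta C)}} =
    P.liftN '' {v | v ∈ linSub P.lw l ∧ P.Ninf v ≠ 0} := by
  have hc := hP.etaConst_ne_zero
  ext u
  constructor
  · rintro ⟨hu, C, hC, hl, h⟩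
    have hN := hP.tv_tyurin_ne_zero hC
    rw [affineEmb, Projectivization.mk_eq_mk_iff'] at h
    obtain ⟨a, rfl⟩ := h
    rw [hP.eta_eq, hP.affineVec_smul hN, smul_smul, ← map_smul] at hu ⊢
    refine ⟨_, ⟨Submodule.smul_mem _ _ (hP.tv_tyurin_mem hC l hl), ?_⟩, rfl⟩
    rw [map_smul, smul_eq_mul]
    refine mul_ne_zero (fun h => hu ?_) hN
    rw [h, zero_smul, map_zero]
  · rintro ⟨v, ⟨hv, hN⟩, rfl⟩
    obtain ⟨C, hC, hl, c, hc0, hcv⟩ := hP.exists_realization l hv hN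
    have hv0 : P.liftN v ≠ 0 := by
      intro h
      rw [← map_zero P.liftN] at h
      exact hN (by rw [P.liftN_injective h, map_zero])
    refine ⟨hv0, C, hC, hl, ?_⟩
    have hN' := hP.tv_tyurin_ne_zero hC
    rw [affineEmb, Projectivization.mk_eq_mk_iff']
    refine ⟨(P.etaConst / P.Ninf (P.tv (P.tyurin C)) * c)⁻¹, ?_⟩
    rw [hP.eta_eq, hP.affineVec_smul hN', hcv, map_smul P.liftN, smul_smul, smul_smul,
      mul_assoc, inv_mul_cancel₀, one_smul]
    rw [← hcv]
    exact mul_ne_zero (div_ne_zero hc hN') hc0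

/-- The points of connection matrices are those of the linear space with N_∞ ≠ 0. A linear subspace
is closed, and this part is dense in it because N_∞ does not vanish identically there. -/
theorem lineSet_eq (l : LineName) : P.lineSet l = {p | p.rep ∈ P.cone l} := by
  rw [lineSet, projClosure, hP.cone_realized]
  ext p
  constructor
  · intro h
    have hcl : IsClosed (P.cone l : Set (Fin 7 → ℂ)) := Submodule.closed_of_finiteDimensional _
    refine closure_minimal ?_ hcl h
    rintro _ ⟨v, ⟨hv, -⟩, rfl⟩
    exact P.liftN_mem_cone.mpr hv
  · rintro ⟨v, hv, hp⟩
    obtain ⟨u, hu, hu0⟩ := hP.exists_Ninf_ne_zero l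
    change p.rep ∈ closure _
    rw [← hp]
    -- A point v is approached by v + t u with u a finite point; N_∞ is nonzero for small t ≠ 0.
    have hcont : Continuous fun t : ℂ => P.liftN (v + t • u) :=
      (LinearMap.continuous_of_finiteDimensional P.liftN).comp (by fun_prop)
    have hlim : Filter.Tendsto (fun t : ℂ => P.liftN (v + t • u)) (nhdsWithin 0 {0}ᶜ)
        (nhds (P.liftN v)) := by
      have := hcont.tendsto 0
      simp only [zero_smul, add_zero] at this
      exact this.mono_left nhdsWithin_le_nhds
    have hne : ∀ᶠ t : ℂ in nhdsWithin 0 {0}ᶜ, P.Ninf (v + t • u) ≠ 0 := by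
      by_cases hN : P.Ninf v = 0
      · filter_upwards [self_mem_nhdsWithin] with t ht
        rw [map_add, map_smul, hN, zero_add]
        exact mul_ne_zero ht hu0
      · have hcN : Continuous fun t : ℂ => P.Ninf (v + t • u) :=
          (LinearMap.continuous_of_finiteDimensional P.Ninf).comp (by fun_prop)
        have : ∀ᶠ t : ℂ in nhds 0, P.Ninf (v + t • u) ≠ 0 :=
          hcN.continuousAt.eventually_ne (by simpa using hN)
        exact this.filter_mono nhdsWithin_le_nhds
    refine mem_closure_of_tendsto hlim ?_
    filter_upwards [hne] with t ht
    exact ⟨_, ⟨Submodule.add_mem _ hv (Submodule.smul_mem _ _ hu), ht⟩, rfl⟩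

end Admissible
end Params

/-! ### The configuration of lines -/

/-- The five neighbours of a vertex of the graph of lines. -/
def LineName.nbr : LineName → Fin 3 ⊕ Diamond → LineName
  | .line k d, .inl m => .line (oth k m) (match d with | .zero => .infty | .infty => .zero)
  | .line k _, .inr e => .dual k e
  | .dual k d, .inl m => .dual (oth k m) (match d with | .zero => .infty | .infty => .zero)
  | .dual k _, .inr e => .line k e

theorem LineName.meets_iff (l m : LineName) : l.Meets m ↔ ∃ x, l.nbr x = m := by
  have hinj := oth_ne_oth
  have hex := exists_oth
  have hne := oth_ne
  constructor
  · rcases l with ⟨i, d⟩ | ⟨i, d⟩ <;> rcases m with ⟨j, e⟩ | ⟨j, e⟩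
    · rintro ⟨h1, h2⟩
      obtain ⟨m, rfl⟩ := hex i j h1.symm
      refine ⟨.inl m, ?_⟩
      cases d <;> cases e <;> simp_all [nbr]
    · rintro rfl
      exact ⟨.inr e, rfl⟩
    · rintro rfl
      exact ⟨.inr e, rfl⟩
    · rintro ⟨h1, h2⟩
      obtain ⟨m, rfl⟩ := hex i j h1.symm
      refine ⟨.inl m, ?_⟩
      cases d <;> cases e <;> simp_all [nbr]
  · rintro ⟨m | e, rfl⟩
    · rcases l with ⟨i, d⟩ | ⟨i, d⟩
      · exact ⟨(hne i m).symm, by cases d <;> simp⟩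
      · exact ⟨(hne i m).symm, by cases d <;> simp⟩
    · rcases l with ⟨i, d⟩ | ⟨i, d⟩
      · exact rfl
      · exact rfl

theorem LineName.nbr_injective (l : LineName) : Function.Injective l.nbr := by
  rintro (m | e) (m' | e') h
  · have hm : m = m' := by
      by_contra hm
      rcases l with ⟨i, d⟩ | ⟨i, d⟩
      · exact oth_ne_oth i m m' hm (by simpa [nbr] using h)
      · exact oth_ne_oth i m m' hm (by simpa [nbr] using h)
    rw [hm]
  · rcases l with ⟨i, d⟩ | ⟨i, d⟩ <;> simp [nbr] at h
  · rcases l with ⟨i, d⟩ | ⟨i, d⟩ <;> simp [nbr] at h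
  · rcases l with ⟨i, d⟩ | ⟨i, d⟩ <;> simp_all [nbr]

/-- The two special values are indexed by `Fin 2`. -/
def Diamond.equiv : Diamond ≃ Fin 2 where
  toFun := Diamond.idx
  invFun := ![.zero, .infty]
  left_inv d := by cases d <;> rfl
  right_inv d := by fin_cases d <;> rfl

/-- The lines are indexed by pairs `(k, d)` and a family. -/
def LineName.equiv : LineName ≃ (Fin 4 × Diamond) ⊕ (Fin 4 × Diamond) where
  toFun l := match l with
    | .line k d => .inl (k, d)
    | .dual k d => .inr (k, d)
  invFun x := match x with
    | .inl (k, d) => .line k d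
    | .inr (k, d) => .dual k d
  left_inv l := by cases l <;> rfl
  right_inv x := by rcases x with ⟨k, d⟩ | ⟨k, d⟩ <;> rfl

theorem card_diamond : Nat.card Diamond = 2 := by
  rw [Nat.card_congr Diamond.equiv, Nat.card_fin]

instance : Finite Diamond := Finite.of_equiv _ Diamond.equiv.symm

theorem card_lineName : Nat.card LineName = 16 := by
  rw [Nat.card_congr LineName.equiv, Nat.card_sum, Nat.card_prod, card_diamond, Nat.card_fin]

theorem LineName.ncard_meets (l : LineName) : {m | l.Meets m}.ncard = 5 := by
  have : {m | l.Meets m} = l.nbr '' Set.univ := by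
    ext m
    simp [meets_iff]
  rw [this, Set.ncard_image_of_injective _ l.nbr_injective, Set.ncard_univ, Nat.card_sum,
    card_diamond, Nat.card_fin]

theorem LineName.ne_of_meets {l m : LineName} (h : l.Meets m) : l ≠ m := by
  rintro rfl
  exact lineGraph.loopless.irrefl _ h

/-- Adjacent lines of one family have opposite values, of which there are only two, and different
indices, whereas adjacent lines of different families share the index. Consequently no point lies on
three lines. -/
theorem LineName.triangle_free {l m n : LineName} (h1 : l.Meets m) (h2 : l.Meets n)
    (h3 : m.Meets n) : False := by
  rcases l with ⟨i, a⟩ | ⟨i, a⟩ <;> rcases m with ⟨j, b⟩ | ⟨j, b⟩ <;>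
    rcases n with ⟨k, c⟩ | ⟨k, c⟩ <;> simp only [Meets] at h1 h2 h3 <;>
    cases a <;> cases b <;> cases c <;> simp_all

/-- Number of edges of the graph, counted with orientation. -/
theorem LineName.ncard_edges : {x : LineName × LineName | x.1.Meets x.2}.ncard = 80 := by
  have hinj : Function.Injective fun x : LineName × (Fin 3 ⊕ Diamond) => (x.1, x.1.nbr x.2) := by
    rintro ⟨l, x⟩ ⟨m, y⟩ h
    obtain rfl : l = m := congrArg Prod.fst h
    have h2 : l.nbr x = l.nbr y := congrArg Prod.snd h
    rw [l.nbr_injective h2]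
  have : {x : LineName × LineName | x.1.Meets x.2} =
      (fun x : LineName × (Fin 3 ⊕ Diamond) => (x.1, x.1.nbr x.2)) '' Set.univ := by
    ext ⟨l, m⟩
    simp [meets_iff]
  rw [this, Set.ncard_image_of_injective _ hinj, Set.ncard_univ, Nat.card_prod, Nat.card_sum,
    card_diamond, card_lineName, Nat.card_fin]

theorem LineName.finite : Finite LineName := Finite.of_equiv _ LineName.equiv.symm

theorem ncard_edgeSet : lineGraph.edgeSet.ncard = 40 := by
  classical
  have := LineName.finite
  have := Fintype.ofFinite LineName
  have h := lineGraph.two_mul_card_edgeFinset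
  have h2 : (Finset.univ.filter fun x : LineName × LineName => lineGraph.Adj x.1 x.2).card = 80 := by
    rw [← LineName.ncard_edges, Set.ncard_eq_toFinset_card']
    congr 1
    ext x
    rw [Finset.mem_filter, Set.mem_toFinset]
    exact and_iff_right (Finset.mem_univ _)
  have h3 : 2 * lineGraph.edgeFinset.card = 80 := h.trans h2
  rw [Set.ncard_eq_toFinset_card', ← SimpleGraph.edgeFinset]
  omega

/-- Sets which meet according to the graph of lines have `40` points of intersection. -/
theorem ncard_intersections {X : Type*} (L : LineName → Set X)
    (h : ∀ l m, l ≠ m → ((L l ∩ L m).Nonempty ↔ l.Meets m))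
    (h' : ∀ l m, l.Meets m → ∃! p, p ∈ L l ∩ L m) :
    {p | ∃ l m, l ≠ m ∧ p ∈ L l ∩ L m}.ncard = 40 := by
  rw [← ncard_edgeSet]
  have hmeet : ∀ {p l m}, l ≠ m → p ∈ L l → p ∈ L m → l.Meets m := fun hlm hl hm =>
    (h _ _ hlm).mp ⟨_, hl, hm⟩
  have hthird : ∀ {p l m n}, l ≠ m → p ∈ L l → p ∈ L m → p ∈ L n → n = l ∨ n = m := by
    intro p l m n hlm hl hm hn
    by_contra! hcon
    exact LineName.triangle_free (hmeet hlm hl hm) (hmeet hcon.1.symm hl hn)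
      (hmeet hcon.2.symm hm hn)
  have : Nonempty LineName := ⟨.line 0 .zero⟩
  choose! l m hlm hp using fun p (hp : ∃ l m, l ≠ m ∧ p ∈ L l ∩ L m) => hp
  -- Each intersection point corresponds to the edge formed by the two lines through it; the absence
  -- of a third line makes this well defined and bijective.
  refine Set.ncard_congr (fun p _ => s(l p, m p)) (fun p hpp => ?_) (fun p p' hpp hpp' he => ?_)
    (fun e => ?_)
  · exact hmeet (hlm p hpp) (hp p hpp).1 (hp p hpp).2
  · refine (h' _ _ (hmeet (hlm p hpp) (hp p hpp).1 (hp p hpp).2)).unique (hp p hpp) ?_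
    have hq := hp p' hpp'
    rcases Sym2.eq_iff.mp he with ⟨e1, e2⟩ | ⟨e1, e2⟩
    · rw [e1, e2]; exact hq
    · rw [e1, e2]; exact hq.symm
  · induction e with | _ a b =>
    intro hab
    have hab : a.Meets b := hab
    have hne := LineName.ne_of_meets hab
    obtain ⟨p, hpab, -⟩ := h' a b hab
    have hpp : ∃ l m, l ≠ m ∧ p ∈ L l ∩ L m := ⟨a, b, hne, hpab⟩
    refine ⟨p, hpp, ?_⟩
    have hl := hthird hne hpab.1 hpab.2 (hp p hpp).1
    have hm := hthird hne hpab.1 hpab.2 (hp p hpp).2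
    have := hlm p hpp
    rcases hl with hl | hl <;> rcases hm with hm | hm
    · exact absurd (hl.trans hm.symm) this
    · rw [hl, hm]
    · rw [hl, hm, Sym2.eq_swap]
    · exact absurd (hl.trans hm.symm) this

/-! ### Projective lines on the surface and their incidences -/

namespace Params

variable {P : Params}

theorem mk_mem_iff {W : Submodule ℂ (Fin 7 → ℂ)} {v : Fin 7 → ℂ} (hv : v ≠ 0) :
    (Projectivization.mk ℂ v hv).rep ∈ W ↔ v ∈ W := by
  obtain ⟨a, ha⟩ := Projectivization.exists_smul_eq_mk_rep ℂ v hv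
  rw [← ha]
  exact Submodule.smul_mem_iff W a.ne_zero

namespace Admissible

variable (hP : P.Admissible)

include hP

theorem lineSet_isProjLine (l : LineName) : IsProjLine (P.lineSet l) := by
  refine ⟨P.cone l, hP.finrank_cone l, ?_⟩
  rw [hP.lineSet_eq]
  ext p
  rw [Set.mem_ofPred_eq, Set.mem_ofPred_eq, Projectivization.submodule_eq,
    Submodule.span_singleton_le_iff_mem]

theorem lineSet_subset (l : LineName) : P.lineSet l ⊆ P.segreSurface := by
  rw [hP.lineSet_eq]
  rintro p ⟨v, hv, hvp⟩
  change P.SegreEquations p.rep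
  rw [← hvp, hP.segreEquations_liftN]
  exact linSub_segreForm hP.sum_lw l hv

theorem linSub_inter_eq_zero {l m : LineName} (hlm : l ≠ m) (h : ¬ l.Meets m) {v : Fin 6 → ℂ}
    (hl : v ∈ linSub P.lw l) (hm : v ∈ linSub P.lw m) : v = 0 :=
  QPVI.linSub_inter_eq_zero hP.lw_not_proportional hP.lw_ne_zero hlm h hl hm

theorem linSub_inter_of_meets {l m : LineName} (h : l.Meets m) :
    ∃ u ≠ 0, ∀ v, (v ∈ linSub P.lw l ∧ v ∈ linSub P.lw m) ↔ ∃ c : ℂ, v = c • u :=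
  QPVI.linSub_inter_of_meets hP.lw_ne_zero hP.sum_lw h

/-- Two of the spaces with different names meet in dimension at most one, while each has dimension
two. -/
theorem linSub_injective : Function.Injective (linSub P.lw) := by
  intro l m h
  by_contra hlm
  have h2 := hP.finrank_linSub l
  have : Module.finrank ℂ (linSub P.lw l) ≤ 1 := by
    by_cases hm : l.Meets m
    · obtain ⟨u, hu0, hu⟩ := hP.linSub_inter_of_meets hm
      have hle : linSub P.lw l ≤ Submodule.span ℂ {u} := by
        intro v hv
        obtain ⟨c, rfl⟩ := (hu v).mp ⟨hv, h ▸ hv⟩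
        exact Submodule.smul_mem _ _ (Submodule.mem_span_singleton_self u)
      exact (Submodule.finrank_mono hle).trans (finrank_span_singleton hu0).le
    · have hbot : linSub P.lw l = ⊥ := by
        rw [eq_bot_iff]
        intro v hv
        exact hP.linSub_inter_eq_zero hlm hm hv (h ▸ hv)
      rw [hbot]; simp
  omega

theorem lineSet_injective : Function.Injective P.lineSet := by
  intro l m h
  apply hP.linSub_injective
  rw [hP.lineSet_eq, hP.lineSet_eq] at h
  ext v
  by_cases hv : v = 0
  · simp [hv]
  have hv' : P.liftN v ≠ 0 := fun h => hv (P.liftN_injective (h.trans (map_zero _).symm))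
  have := Set.ext_iff.mp h (Projectivization.mk ℂ _ hv')
  simpa only [Set.mem_ofPred_eq, mk_mem_iff, P.liftN_mem_cone] using this

/-- Since N_∞ is a function of the other coordinates, the cone over a line on the surface is the
image of a plane in ℂ⁶, to which `exists_eq_linSub` applies. -/
theorem exists_eq_lineSet {S : Set CP6} (hS : IsProjLine S) (h : S ⊆ P.segreSurface) :
    ∃ l, S = P.lineSet l := by
  obtain ⟨W, hW, rfl⟩ := hS
  have hseg : ∀ w ∈ W, P.SegreEquations w := by
    intro w hw
    by_cases hw0 : w = 0
    · rw [hw0, ← map_zero P.liftN, hP.segreEquations_liftN]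
      simp [SegreForm]
    · have := h (a := Projectivization.mk ℂ w hw0) (by
        rw [Set.mem_ofPred_eq, Projectivization.submodule_mk, Submodule.span_singleton_le_iff_mem]
        exact hw)
      change P.SegreEquations _ at this
      obtain ⟨a, ha⟩ := Projectivization.exists_smul_eq_mk_rep ℂ w hw0
      rw [← ha] at this
      have := this.smul (a⁻¹ : ℂˣ).val
      rwa [Units.smul_def, smul_smul, ← Units.val_mul, inv_mul_cancel, Units.val_one,
        one_smul] at this
  set Q := W.comap P.liftN with hQ
  have hmap : Q.map P.liftN = W := by
    rw [hQ, Submodule.map_comap_eq, inf_eq_right]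
    intro w hw
    obtain ⟨v, rfl⟩ := hP.exists_eq_liftN (hseg w hw)
    exact LinearMap.mem_range_self _ _
  obtain ⟨l, hl⟩ := exists_eq_linSub hP.lw_ne_zero hP.sum_lw (Q := Q)
    (by rw [(Submodule.equivMapOfInjective P.liftN P.liftN_injective Q).finrank_eq, hmap, hW])
    (fun v hv => (hP.segreEquations_liftN v).mp (hseg _ hv))
  refine ⟨l, ?_⟩
  rw [hP.lineSet_eq, cone, ← hl, hmap]
  ext p
  rw [Set.mem_ofPred_eq, Set.mem_ofPred_eq, Projectivization.submodule_eq,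
    Submodule.span_singleton_le_iff_mem]

theorem mem_affine {v : Fin 6 → ℂ} (hv : SegreForm P.lw v) (hN : P.Ninf v ≠ 0) {p : CP6}
    (hp : p.rep = P.liftN v) : p ∈ affineEmb '' P.affineSurface := by
  have hc := div_ne_zero hP.etaConst_ne_zero hN
  refine ⟨(P.etaConst / P.Ninf v) • v, ?_, ?_⟩
  · change P.SegreEquations _
    rw [hP.affineVec_smul hN]
    exact ((hP.segreEquations_liftN v).mpr hv).smul _
  · rw [← Projectivization.mk_rep p, affineEmb, Projectivization.mk_eq_mk_iff']
    exact ⟨_, by rw [hP.affineVec_smul hN, hp]⟩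

theorem lineSet_not_subset (l : LineName) : ¬ P.lineSet l ⊆ P.sectionAtInfinity := by
  intro h
  obtain ⟨v, hv, hN⟩ := hP.exists_Ninf_ne_zero l
  have hv' : P.liftN v ≠ 0 := fun h => hN (by
    rw [P.liftN_injective (h.trans (map_zero _).symm), map_zero])
  obtain ⟨a, ha⟩ := Projectivization.exists_smul_eq_mk_rep ℂ _ hv'
  have hmem : Projectivization.mk ℂ _ hv' ∈ P.lineSet l := by
    rw [hP.lineSet_eq, Set.mem_ofPred_eq, mk_mem_iff, P.liftN_mem_cone]; exact hv
  refine (h hmem).2 (hP.mem_affine (v := (a : ℂ) • v)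
    (linSub_segreForm hP.sum_lw l (Submodule.smul_mem _ _ hv)) ?_ ?_)
  · rw [map_smul]; exact mul_ne_zero a.ne_zero hN
  · rw [← ha, map_smul]; rfl

theorem mem_inter_iff (l m : LineName) (p : CP6) : p ∈ P.lineSet l ∩ P.lineSet m ↔
    ∃ v, v ≠ 0 ∧ (v ∈ linSub P.lw l ∧ v ∈ linSub P.lw m) ∧ p.rep = P.liftN v := by
  rw [hP.lineSet_eq, hP.lineSet_eq]
  constructor
  · rintro ⟨⟨v, hv, hvp⟩, h⟩
    rw [Set.mem_ofPred_eq, ← hvp, P.liftN_mem_cone] at h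
    refine ⟨v, ?_, ⟨hv, h⟩, hvp.symm⟩
    rintro rfl
    exact p.rep_nonzero (by rw [← hvp, map_zero])
  · rintro ⟨v, -, ⟨hl, hm⟩, h⟩
    exact ⟨⟨v, hl, h.symm⟩, v, hm, h.symm⟩

theorem existsUnique_inter {l m : LineName} (h : l.Meets m) :
    ∃! p : CP6, p ∈ P.lineSet l ∩ P.lineSet m := by
  obtain ⟨u, hu0, hu⟩ := hP.linSub_inter_of_meets h
  have hu' : P.liftN u ≠ 0 := fun h => hu0 (P.liftN_injective (h.trans (map_zero _).symm))
  obtain ⟨a, ha⟩ := Projectivization.exists_smul_eq_mk_rep ℂ _ hu'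
  refine ⟨Projectivization.mk ℂ _ hu', ?_, fun p hp => ?_⟩
  · refine (hP.mem_inter_iff l m _).mpr ⟨(a : ℂ) • u, smul_ne_zero a.ne_zero hu0,
      (hu _).mpr ⟨_, rfl⟩, ?_⟩
    rw [← ha, map_smul]; rfl
  · obtain ⟨v, hv0, hv, hvp⟩ := (hP.mem_inter_iff l m p).mp hp
    obtain ⟨c, rfl⟩ := (hu v).mp hv
    rw [← Projectivization.mk_rep p, Projectivization.mk_eq_mk_iff']
    exact ⟨c, by rw [hvp, map_smul]⟩

theorem nonempty_inter_iff {l m : LineName} (hlm : l ≠ m) :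
    (P.lineSet l ∩ P.lineSet m).Nonempty ↔ l.Meets m := by
  constructor
  · rintro ⟨p, hp⟩
    obtain ⟨v, hv0, hv, -⟩ := (hP.mem_inter_iff l m p).mp hp
    by_contra h
    exact hv0 (hP.linSub_inter_eq_zero hlm h hv.1 hv.2)
  · intro h
    exact (hP.existsUnique_inter h).exists

theorem ncard_neighbours (l : LineName) :
    {m : LineName | m ≠ l ∧ (P.lineSet l ∩ P.lineSet m).Nonempty}.ncard = 5 := by
  rw [← l.ncard_meets]
  congr 1
  ext m
  constructor
  · rintro ⟨hm, h⟩
    exact (hP.nonempty_inter_iff hm.symm).mp h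
  · intro h
    have hne := (LineName.ne_of_meets h).symm
    exact ⟨hne, (hP.nonempty_inter_iff hne.symm).mpr h⟩

theorem intersectionPoints_finite (hF : P.FinitenessConditions) :
    P.intersectionPoints ⊆ affineEmb '' P.affineSurface := by
  rintro p ⟨l, m, hlm, hp⟩
  have hmeets := (hP.nonempty_inter_iff hlm).mp ⟨p, hp⟩
  obtain ⟨v, hv0, ⟨hl, hm⟩, hvp⟩ := (hP.mem_inter_iff l m p).mp hp
  exact hP.mem_affine (linSub_segreForm hP.sum_lw l hl)
    (hP.Ninf_ne_zero_of_meets hF hmeets hv0 hl hm) hvp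

end Admissible
end Params
end QPVI

end

theorem mainTheorem9 (P : QPVI.Params) (hP : P.Admissible) :
    -- the sixteen sets are pairwise different and are exactly the lines on the Segre surface
    Function.Injective P.lineSet ∧
    (∀ S : Set QPVI.CP6,
      (QPVI.IsProjLine S ∧ S ⊆ P.segreSurface) ↔ ∃ l : QPVI.LineName, S = P.lineSet l) ∧
    -- no line lies in the hyperplane section at infinity
    (∀ l : QPVI.LineName, ¬ P.lineSet l ⊆ P.sectionAtInfinity) ∧
    -- two different lines meet if and only if they are adjacent in the graph,
    -- and then in a single point
    (∀ l m : QPVI.LineName, l ≠ m →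
      ((P.lineSet l ∩ P.lineSet m).Nonempty ↔ QPVI.lineGraph.Adj l m)) ∧
    (∀ l m : QPVI.LineName, QPVI.lineGraph.Adj l m →
      ∃! p : QPVI.CP6, p ∈ P.lineSet l ∩ P.lineSet m) ∧
    -- each line meets exactly five others, and there are 40 intersection points
    (∀ l : QPVI.LineName,
      {m : QPVI.LineName | m ≠ l ∧ (P.lineSet l ∩ P.lineSet m).Nonempty}.ncard = 5) ∧
    P.intersectionPoints.ncard = 40 ∧
    -- finiteness of all intersection points
    (P.FinitenessConditions →
      P.intersectionPoints ⊆ QPVI.affineEmb '' P.affineSurface) := by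
  refine ⟨hP.lineSet_injective, fun S => ⟨fun h => hP.exists_eq_lineSet h.1 h.2, ?_⟩,
    hP.lineSet_not_subset, fun l m hlm => hP.nonempty_inter_iff hlm,
    fun l m h => hP.existsUnique_inter h, hP.ncard_neighbours,
    QPVI.ncard_intersections P.lineSet (fun l m hlm => hP.nonempty_inter_iff hlm)
      (fun l m h => hP.existsUnique_inter h), hP.intersectionPoints_finite⟩
  rintro ⟨l, rfl⟩
  exact ⟨hP.lineSet_isProjLine l, hP.lineSet_subset l⟩
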